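/- For $\gamma\in[0,1)$ let $T_\gamma:[0,1]\to[0,1]$ be the LSV map, $T_\gamma(x)=x(1+2^\gamma x^\gamma)$ for $0\le x<\tfrac12$ and $T_\gamma(x)=2x-1$ for $\tfrac12\le x\le 1$. Let $m$ be Lebesgue measure on $[0,1]$, write $m(\phi)=\int_0^1\phi\,dm$, and let $\mathcal L_\gamma$ be the transfer operator of $T_\gamma$, $(\mathcal L_\gamma\phi)(x)=\sum_{T_\gamma(y)=x}\phi(y)/T_\gamma'(y)$, that is, $$(\mathcal L_\gamma\phi)(x)=g_\gamma'(x)\,\phi(g_\gamma(x))+\tfrac12\,\phi\big(\tfrac{x+1}2\big),\qquad x\in(0,1],$$ where $g_\gamma:[0,1]\to[0,\tfrac12]$ is the inverse of $x\mapsto x(1+2^\gamma x^\gamma)$ on $[0,\tfrac12]$. Fix $\alpha\in(0,1)$. For $a>1$ let $\mathcal C_*(a)$ be the set of all $\phi\in C^0(0,1]\cap L^1(m)$ such that $\phi\ge0$, $\phi$ is nonincreasing, $x\mapsto x^{\alpha+1}\phi(x)$ is nondecreasing and $\int_0^x\phi(t)\,dt\le a\,x^{1-\alpha}m(\phi)$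 for $0<x\le1$. For $b_1,b_2,b_3>0$ let $\mathcal C_2=\mathcal C_2(b_1,b_2)$ be the set of all $\phi\in C^2(0,1]$ with $\phi\ge0$, $|\phi'(x)|\le\frac{b_1}{x}\phi(x)$ and $|\phi''(x)|\le\frac{b_2}{x^2}\phi(x)$ on $(0,1]$, and let $\mathcal C_3=\mathcal C_3(b_1,b_2,b_3)$ be the set of all $\phi\in C^3(0,1]\cap\mathcal C_2$ with $|\phi'''(x)|\le\frac{b_3}{x^3}\phi(x)$ on $(0,1]$. **Proposition.** There are constants $a>1$ and $b_1,b_2,b_3>0$, depending only on $\alpha$, such that $\mathcal L_\gamma$ maps each of $\mathcal C_*(a)$, $\mathcal C_2$ and $\mathcal C_3$ into itself for all $0<\gamma\le\alpha$, and such that the following holds. Let $(\Omega,\mathcal F,\mathbb P)$ be a probability space, $\sigma:\Omega\to\Omega$ an invertible (with measurable inverse) ergodic $\mathbb P$-preserving transformation, and $\beta:\Omega\to(0,1)$ a measurable map with $\operatorname{ess\,sup}_{\omega}\beta(\omega)=\alpha$. Put $T_\omega=T_{\beta(\omega)}$, $\mathcal L_\omega=\mathcal L_{\beta(\omega)}$,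 $\mathcal L^n_\omega=\mathcal L_{\sigma^{n-1}\omega}\circ\dots\circ\mathcal L_\omega$ and $\tau(\omega,x)=(\sigma\omega,T_\omega(x))$ on $\Omega\times[0,1]$. Let $\Omega'\in\mathcal F$ satisfy $\sigma^{-1}(\Omega')=\Omega'$, $\mathbb P(\Omega')=1$ and $\beta(\omega)\le\alpha$ for all $\omega\in\Omega'$. Then: 1. There is a unique map $h:\Omega'\to\mathcal C_*(a)\cap\mathcal C_2$, measurable as a map into $L^1(m)$, such that $\mathcal L_\omega h(\omega)=h(\sigma\omega)$ and $\int_0^1h(\omega)\,dm=1$ for all $\omega\in\Omega'$. Moreover, $h(\omega)=\lim_{n\to\infty}\mathcal L^n_{\sigma^{-n}\omega}1$ in $L^1(m)$ for all $\omega\in\Omega'$. 2. The formula $\mu(A\times B)=\int_{A\cap\Omega'}\int_Bh(\omega)\,dm\,d\mathbb P(\omega)$, for $A\in\mathcal F$ and $B\subset[0,1]$ Borel, defines a probability measure $\mu$ on $\Omega\times[0,1]$ which is $\tau$-invariant, ergodic for $\tau$, and equivalent to $\mathbb P\times m$. 3. $\mu$ is the only $\tau$-invariant probability measure that is absolutely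 continuous with respect to $\mathbb P\times m$. -/

import Mathlib

open Set Filter Topology MeasureTheory
open scoped ENNReal

noncomputable section

namespace LSV

/-! ### LSV maps -/

/-- The first branch `f_α (x) = x (1 + 2^α x^α)`. -/
def branch (α x : ℝ) : ℝ := x * (1 + 2 ^ α * x ^ α)

/-- The LSV map `T_α` as a function of a real variable; it is only meant on `[0,1]`. -/
def mapReal (α x : ℝ) : ℝ := if x < 1 / 2 then branch α x else 2 * x - 1

theorem mapReal_mem {α : ℝ} (hα : 0 ≤ α) (x : unitInterval) : mapReal α x ∈ unitInterval := by
  obtain ⟨x, h0, h1⟩ := x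
  unfold mapReal branch
  simp only
  split_ifs with h
  · have hp : (2 : ℝ) ^ α * x ^ α ≤ 1 := by
      rw [← Real.mul_rpow (by norm_num) h0]
      exact Real.rpow_le_one (by positivity) (by linarith) hα
    have hq : (0 : ℝ) ≤ 2 ^ α * x ^ α := by positivity
    constructor
    · positivity
    · nlinarith
  · constructor <;> linarith

/-- The LSV map `T_α : [0,1] → [0,1]`. -/
def map (α : ℝ) (hα : 0 ≤ α) (x : unitInterval) : unitInterval := ⟨mapReal α x, mapReal_mem hα x⟩

/-- The inverse `g_α : [0,1] → [0,1/2]` of the first branch. -/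
def branchInv (α : ℝ) : ℝ → ℝ := Function.invFunOn (branch α) (Icc 0 (1 / 2))

/-! ### Transfer operators

Functions on `(0,1]` are represented by functions `ℝ → ℝ` of which only the values on `(0,1]`
matter. -/

/-- The transfer operator `𝓛_α` of `T_α`: the sum of `φ y / T_α' y` over the preimages `y` of `x`,
namely `y = g_α x` (in the first branch) and `y = (x + 1) / 2` (in the second one, of slope `2`).
At `x = 1` the left limit of this sum is taken, so that `𝓛_α φ` is continuous on `(0,1]`
when `φ` is. -/
def transfer (α : ℝ) (φ : ℝ → ℝ) (x : ℝ) : ℝ :=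
  φ (branchInv α x) / deriv (branch α) (branchInv α x) + φ ((x + 1) / 2) / 2

/-- The cocycle `𝓛_ω^n = 𝓛_{σ^{n-1} ω} ∘ ⋯ ∘ 𝓛_ω`, where `𝓛_ω` is the transfer operator of the
LSV map with parameter `β ω`. -/
def cocycle {Ω : Type*} (σ : Ω → Ω) (β : Ω → Ioo (0 : ℝ) 1) (ω : Ω) : ℕ → (ℝ → ℝ) → (ℝ → ℝ)
  | 0, φ => φ
  | n + 1, φ => transfer (β (σ^[n] ω)) (cocycle σ β ω n φ)

/-! ### Cones -/

/-- The cone `𝓒_*(a)` (for the exponent `α`). -/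
def coneStar (α a : ℝ) : Set (ℝ → ℝ) :=
  {φ | ContinuousOn φ (Ioc 0 1) ∧ IntegrableOn φ (Ioc 0 1) ∧
    (∀ x ∈ Ioc (0 : ℝ) 1, 0 ≤ φ x) ∧
    AntitoneOn φ (Ioc 0 1) ∧
    MonotoneOn (fun x => x ^ (α + 1) * φ x) (Ioc 0 1) ∧
    ∀ x ∈ Ioc (0 : ℝ) 1, (∫ t in (0 : ℝ)..x, φ t) ≤ a * x ^ (1 - α) * (∫ t in (0 : ℝ)..1, φ t)}

/-- The cone `𝓒_2(b₁, b₂)`; derivatives at the end point `1` are one-sided. -/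
def coneTwo (b₁ b₂ : ℝ) : Set (ℝ → ℝ) :=
  {φ | ContDiffOn ℝ 2 φ (Ioc 0 1) ∧ ∀ x ∈ Ioc (0 : ℝ) 1,
    0 ≤ φ x ∧
    |derivWithin φ (Ioc 0 1) x| ≤ b₁ / x * φ x ∧
    |iteratedDerivWithin 2 φ (Ioc 0 1) x| ≤ b₂ / x ^ 2 * φ x}

/-- The cone `𝓒_3(b₁, b₂, b₃)`. -/
def coneThree (b₁ b₂ b₃ : ℝ) : Set (ℝ → ℝ) :=
  {φ | ContDiffOn ℝ 3 φ (Ioc 0 1) ∧ φ ∈ coneTwo b₁ b₂ ∧ ∀ x ∈ Ioc (0 : ℝ) 1,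
    |iteratedDerivWithin 3 φ (Ioc 0 1) x| ≤ b₃ / x ^ 3 * φ x}

/-! ### Random dynamics -/

variable {Ω : Type*}

/-- The skew product `τ (ω, x) = (σ ω, T_ω x)` on `Ω × [0,1]`. -/
def skewProduct (σ : Ω → Ω) (β : Ω → Ioo (0 : ℝ) 1) (p : Ω × unitInterval) : Ω × unitInterval :=
  (σ p.1, map (β p.1) (β p.1).2.1.le p.2)

/-- `ω ↦ h ω`, for `ω` in `Ω'`, is measurable as a map into `L¹(m)`. -/
def MeasurableInL1 [MeasurableSpace Ω] (Ω' : Set Ω) (h : Ω → ℝ → ℝ) : Prop :=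
  ∃ H : Ω' → Lp ℝ 1 (volume.restrict (Ioc (0 : ℝ) 1)),
    StronglyMeasurable H ∧ ∀ ω : Ω', H ω =ᵐ[volume.restrict (Ioc (0 : ℝ) 1)] h ω

/-- `h` is (on `Ω'`) a measurable family of densities on `(0,1]` that belong to the set `K` of
functions and satisfy `𝓛_ω (h ω) = h (σ ω)`. -/
structure IsEquivariantDensity [MeasurableSpace Ω] (σ : Ω → Ω) (β : Ω → Ioo (0 : ℝ) 1)
    (Ω' : Set Ω) (K : Set (ℝ → ℝ)) (h : Ω → ℝ → ℝ) : Prop where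
  measurable : MeasurableInL1 Ω' h
  mem : ∀ ω ∈ Ω', h ω ∈ K
  equivariant : ∀ ω ∈ Ω', EqOn (transfer (β ω) (h ω)) (h (σ ω)) (Ioc 0 1)
  integral_eq_one : ∀ ω ∈ Ω', (∫ x in (0 : ℝ)..1, h ω x) = 1

end LSV

end

/-!
Write `f` for the first branch of an LSV map with exponent `γ ≤ α`, `g` for its inverse and `𝓛`
for the transfer operator. Everything rests on the invariance of the cones and on a uniform loss
of memory.

*Cones.* Put `u = (2 y) ^ γ`, so that `f y = y (1 + u)` and `f' y = 1 + (1 + γ) u`. That `𝓛`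
preserves the monotonicity of `x ^ (α + 1) φ x` amounts to the monotonicity of
`(1 + u) ^ (1 + α) / (1 + (1 + γ) u)` in `u`, which is Bernoulli's inequality
(`rpow_mul_le_rpow_mul`). The mass bound `a x ^ (1 - α)` improves by a multiple of `x` when `x` is replaced by `g x`
(`rpow_branchInv_add_le`), and for `a = 2 / (1 - α)` this pays for the mass, at most `x`, that
arrives through the second branch (`mapsTo_coneStar`). For the cones of smooth functions,
`f y / f' y = y (1 - s)` with `s = γ u / f' y`, while every derivative of `f'`, made scale invariant,
has size `O(s)`. Thus a change of scale gains a factor `1 - s` in each derivative, which absorbs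
the errors from differentiating the weight `1 / f'` as soon as `b₁, b₂, b₃` are large in this
order (`exists_scale`, `abs_le_div_pow_mul`, `mapsTo_coneTwo`, `mapsTo_coneThree`).

*Loss of memory.* Both branches expand, with a gain that is quadratic in the length, so an
interval of length `l`, cut at `1 / 2` when it contains this point, covers `(0, 1)` after a
number of steps that depends on `l` only, and a lower bound on it spreads to all of `(0, 1)`
(`exists_le_cocycle_of_interval`). Let `φ` and `ψ` be probability densities in the cone at `L¹`
distance at least `ε`. They are uniformly integrable and Lipschitz away from `0`, so each
exceeds the other by `ε / 8` on an interval of definite length. Pushed forward, the positive and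
negative parts of `φ - ψ` both acquire a definite lower bound on `(0, 1)`, and this common part
cancels: the distance drops by a definite amount. Hence it falls below `ε` after a number of
steps that depends on `ε` only (`exists_integral_abs_cocycle_sub_lt`).

*The density.* By loss of memory `𝓛^n_{σ^{-n} ω} 1` is a Cauchy sequence in `L¹`, and the
Lipschitz bounds make it converge pointwise on `(0, 1]`. Its members lie in the cone of three
times differentiable functions, so their second derivatives converge too and the limit is in the
cone of `C²` functions (`mem_cones_of_tendsto`). Uniqueness is loss of memory again: an
equivariant density is the image of its own remote past.

*The measure.* Equivariance of the density is invariance of the measure, by duality of the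
transfer operator and the map (`measurePreserving_skewProduct`). Let `E` be an invariant set.
Loss of memory shows that the fibre `E_ω` has the same measure with respect to all densities in
the cone, and, as every Lipschitz function is a difference of two elements of the cone up to a
constant, that it is independent of all Lipschitz functions; so it is null or conull
(`volume_eq_zero_or_of_invariant`). Ergodicity of `σ` then decides between the two for almost
all `ω` at once. Densities in the cone are positive, hence the measure is equivalent to `ℙ × m`,
and an absolutely continuous invariant probability measure is absolutely continuous with respect
to an ergodic one, thus equal to it.
-/

namespace LSV

/-! ### The first branch and its inverse -/

/-- The quantity `(2 y)^γ`, with values in `[0, 1]` on the domain of the first branch, in terms of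
which `branch γ y = y * (1 + pw γ y)`. -/
noncomputable def pw (γ y : ℝ) : ℝ := 2 ^ γ * y ^ γ

/-- The derivative of the first branch. -/
noncomputable def slope (γ y : ℝ) : ℝ := 1 + (1 + γ) * pw γ y

theorem branch_eq (γ y : ℝ) : branch γ y = y * (1 + pw γ y) := rfl

theorem pw_nonneg {γ y : ℝ} (hy : 0 ≤ y) : 0 ≤ pw γ y := by unfold pw; positivity

theorem pw_eq {γ y : ℝ} (hy : 0 ≤ y) : pw γ y = (2 * y) ^ γ :=
  (Real.mul_rpow (by norm_num) hy).symm

theorem pw_le_one {γ y : ℝ} (hγ : 0 ≤ γ) (hy : 0 ≤ y) (hy' : y ≤ 1 / 2) : pw γ y ≤ 1 := by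
  rw [pw_eq hy]; exact Real.rpow_le_one (by positivity) (by linarith) hγ

theorem pw_mono {γ y z : ℝ} (hγ : 0 ≤ γ) (hy : 0 ≤ y) (h : y ≤ z) : pw γ y ≤ pw γ z := by
  unfold pw; gcongr

theorem le_pw {γ y : ℝ} (hγ1 : γ ≤ 1) (hy : 0 ≤ y) (hy' : y ≤ 1 / 2) : 2 * y ≤ pw γ y := by
  rw [pw_eq hy]
  rcases hy.eq_or_lt with rfl | hy0
  · simp only [mul_zero]; positivity
  · exact Real.self_le_rpow_of_le_one (by positivity) (by linarith) hγ1

theorem slope_pos {γ y : ℝ} (hγ : 0 ≤ γ) (hy : 0 ≤ y) : 0 < slope γ y := by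
  have := pw_nonneg (γ := γ) hy; unfold slope; positivity

theorem slope_le_three {γ y : ℝ} (hγ : 0 ≤ γ) (hγ1 : γ ≤ 1) (hy : 0 ≤ y) (hy' : y ≤ 1 / 2) :
    slope γ y ≤ 3 := by
  have h0 := pw_nonneg (γ := γ) hy
  have := pw_le_one hγ hy hy'; unfold slope; nlinarith

theorem hasDerivAt_pw {γ y : ℝ} (hy : 0 < y) : HasDerivAt (pw γ) (γ * pw γ y / y) y := by
  have h := ((hasDerivAt_id y).rpow_const (p := γ) (Or.inl hy.ne')).const_mul (2 ^ γ)
  refine h.congr_deriv ?_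
  simp only [pw, id, Real.rpow_sub hy, Real.rpow_one]
  ring

theorem hasDerivAt_branch {γ y : ℝ} (hy : 0 < y) : HasDerivAt (branch γ) (slope γ y) y := by
  have h := (hasDerivAt_id y).mul ((hasDerivAt_pw (γ := γ) hy).const_add 1)
  refine h.congr_deriv ?_
  simp only [slope, id]
  field_simp
  ring

theorem deriv_branch {γ y : ℝ} (hy : 0 < y) : deriv (branch γ) y = slope γ y :=
  (hasDerivAt_branch hy).deriv

theorem continuous_branch {γ : ℝ} (hγ : 0 ≤ γ) : Continuous (branch γ) := by
  unfold branch
  have := Real.continuous_rpow_const hγ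
  fun_prop

/-- Increments of the branch dominate increments of the variable, with a gain. -/
theorem branch_sub_le {γ p q : ℝ} (hγ : 0 ≤ γ) (hp : 0 ≤ p) (hpq : p ≤ q) :
    (q - p) * (1 + pw γ q) ≤ branch γ q - branch γ p := by
  have h := pw_mono hγ hp hpq
  rw [branch_eq, branch_eq]
  nlinarith

theorem strictMonoOn_branch {γ : ℝ} (hγ : 0 ≤ γ) : StrictMonoOn (branch γ) (Ici 0) := by
  intro p hp q hq hpq
  have h := branch_sub_le hγ hp hpq.le
  have := pw_nonneg (γ := γ) hq
  nlinarith

@[simp] theorem branch_zero (γ : ℝ) : branch γ 0 = 0 := by simp [branch]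

@[simp] theorem branch_half (γ : ℝ) : branch γ (1 / 2) = 1 := by
  rw [branch_eq, pw_eq (by norm_num)]; norm_num

variable {γ : ℝ}

theorem image_branch (hγ : 0 ≤ γ) : branch γ '' Icc 0 (1 / 2) = Icc 0 1 := by
  apply Subset.antisymm
  · rintro _ ⟨y, hy, rfl⟩
    have h1 := (strictMonoOn_branch hγ).monotoneOn self_mem_Ici hy.1 hy.1
    have h2 := (strictMonoOn_branch hγ).monotoneOn hy.1 (b := 1 / 2) (by simp) hy.2
    rw [branch_zero] at h1; rw [branch_half] at h2
    exact ⟨h1, h2⟩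
  · have := intermediate_value_Icc (a := (0 : ℝ)) (b := 1 / 2) (by norm_num)
      (continuous_branch hγ).continuousOn
    simpa only [branch_zero, branch_half] using this

theorem branchInv_mem_Icc (hγ : 0 ≤ γ) {x : ℝ} (hx : x ∈ Icc (0 : ℝ) 1) :
    branchInv γ x ∈ Icc (0 : ℝ) (1 / 2) :=
  Function.invFunOn_mem (show x ∈ branch γ '' _ by rwa [image_branch hγ])

theorem branch_branchInv (hγ : 0 ≤ γ) {x : ℝ} (hx : x ∈ Icc (0 : ℝ) 1) :
    branch γ (branchInv γ x) = x :=
  Function.invFunOn_eq (show x ∈ branch γ '' _ by rwa [image_branch hγ])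

theorem branch_mem_Icc (hγ : 0 ≤ γ) {y : ℝ} (hy : y ∈ Icc (0 : ℝ) (1 / 2)) :
    branch γ y ∈ Icc (0 : ℝ) 1 := image_branch hγ ▸ mem_image_of_mem _ hy

theorem branchInv_branch (hγ : 0 ≤ γ) {y : ℝ} (hy : y ∈ Icc (0 : ℝ) (1 / 2)) :
    branchInv γ (branch γ y) = y :=
  (strictMonoOn_branch hγ).injOn (branchInv_mem_Icc hγ (branch_mem_Icc hγ hy)).1 hy.1
    (branch_branchInv hγ (branch_mem_Icc hγ hy))

theorem branchInv_le_iff (hγ : 0 ≤ γ) {x t : ℝ} (hx : x ∈ Icc (0 : ℝ) 1) (ht : 0 ≤ t) :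
    branchInv γ x ≤ t ↔ x ≤ branch γ t := by
  rw [← (strictMonoOn_branch hγ).le_iff_le (branchInv_mem_Icc hγ hx).1 ht, branch_branchInv hγ hx]

theorem lt_branchInv_iff (hγ : 0 ≤ γ) {x t : ℝ} (hx : x ∈ Icc (0 : ℝ) 1) (ht : 0 ≤ t) :
    t < branchInv γ x ↔ branch γ t < x := by
  rw [← not_le, branchInv_le_iff hγ hx ht, not_le]

theorem branchInv_lt_iff (hγ : 0 ≤ γ) {x t : ℝ} (hx : x ∈ Icc (0 : ℝ) 1) (ht : 0 ≤ t) :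
    branchInv γ x < t ↔ x < branch γ t := by
  rw [← (strictMonoOn_branch hγ).lt_iff_lt (branchInv_mem_Icc hγ hx).1 ht, branch_branchInv hγ hx]

theorem branchInv_pos (hγ : 0 ≤ γ) {x : ℝ} (hx : x ∈ Ioc (0 : ℝ) 1) : 0 < branchInv γ x :=
  (lt_branchInv_iff hγ ⟨hx.1.le, hx.2⟩ le_rfl).2 (by simpa using hx.1)

theorem branchInv_mem (hγ : 0 ≤ γ) {x : ℝ} (hx : x ∈ Ioc (0 : ℝ) 1) :
    branchInv γ x ∈ Ioc (0 : ℝ) (1 / 2) :=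
  ⟨branchInv_pos hγ hx, (branchInv_mem_Icc hγ ⟨hx.1.le, hx.2⟩).2⟩

theorem branchInv_mem_Ioc (hγ : 0 ≤ γ) {x : ℝ} (hx : x ∈ Ioc (0 : ℝ) 1) :
    branchInv γ x ∈ Ioc (0 : ℝ) 1 :=
  ⟨branchInv_pos hγ hx, (branchInv_mem hγ hx).2.trans (by norm_num)⟩

theorem half_mem_Ioc {x : ℝ} (hx : x ∈ Ioc (0 : ℝ) 1) : (x + 1) / 2 ∈ Ioc (0 : ℝ) 1 :=
  ⟨by linarith [hx.1], by linarith [hx.2]⟩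

@[simp] theorem branchInv_one (hγ : 0 ≤ γ) : branchInv γ 1 = 1 / 2 := by
  have h := branchInv_branch hγ (y := 1 / 2) (by norm_num)
  rwa [branch_half] at h

theorem strictMonoOn_branchInv (hγ : 0 ≤ γ) : StrictMonoOn (branchInv γ) (Icc 0 1) := by
  intro x hx y hy hxy
  rwa [lt_branchInv_iff hγ hy (branchInv_mem_Icc hγ hx).1, branch_branchInv hγ hx]

/-- The inverse of the first branch is `1`-Lipschitz. -/
theorem branchInv_sub_le (hγ : 0 ≤ γ) {x y : ℝ} (hx : x ∈ Icc (0 : ℝ) 1) (hy : y ∈ Icc (0 : ℝ) 1)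
    (hxy : x ≤ y) : branchInv γ y - branchInv γ x ≤ y - x := by
  have hm := (strictMonoOn_branchInv hγ).monotoneOn hx hy hxy
  have h := branch_sub_le hγ (branchInv_mem_Icc hγ hx).1 hm
  rw [branch_branchInv hγ hx, branch_branchInv hγ hy] at h
  have := pw_nonneg (γ := γ) (branchInv_mem_Icc hγ hy).1
  nlinarith

theorem continuousOn_branchInv (hγ : 0 ≤ γ) : ContinuousOn (branchInv γ) (Icc 0 1) := by
  have : LipschitzOnWith 1 (branchInv γ) (Icc 0 1) := by
    refine LipschitzOnWith.of_dist_le_mul fun x hx y hy => ?_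
    simp only [NNReal.coe_one, one_mul, Real.dist_eq]
    rcases le_total x y with h | h
    · rw [abs_sub_comm, abs_sub_comm x y,
        abs_of_nonneg (sub_nonneg.2 ((strictMonoOn_branchInv hγ).monotoneOn hx hy h)),
        abs_of_nonneg (sub_nonneg.2 h)]
      exact branchInv_sub_le hγ hx hy h
    · rw [abs_of_nonneg (sub_nonneg.2 ((strictMonoOn_branchInv hγ).monotoneOn hy hx h)),
        abs_of_nonneg (sub_nonneg.2 h)]
      exact branchInv_sub_le hγ hy hx h
  exact this.continuousOn

theorem hasDerivWithinAt_branchInv (hγ : 0 ≤ γ) {x : ℝ} (hx : x ∈ Ioc (0 : ℝ) 1) :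
    HasDerivWithinAt (branchInv γ) (slope γ (branchInv γ x))⁻¹ (Ioc 0 1) x := by
  have hpos := branchInv_pos hγ hx
  have hd := (hasDerivAt_branch (γ := γ) hpos).hasDerivWithinAt (s := univ)
  have hne := (slope_pos hγ hpos.le).ne'
  have ht : Tendsto (branchInv γ) (𝓝[Ioc 0 1] x) (𝓝[univ] (branchInv γ x)) := by
    rw [nhdsWithin_univ]
    exact ((continuousOn_branchInv hγ) x ⟨hx.1.le, hx.2⟩).mono Ioc_subset_Icc_self
  have := HasFDerivWithinAt.of_local_left_inverse
    (f' := ContinuousLinearEquiv.unitsEquivAut ℝ (Units.mk0 _ hne)) ht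
    (by
      refine hd.hasFDerivWithinAt.congr_fderiv ?_
      ext; simp) hx
    (by
      filter_upwards [self_mem_nhdsWithin] with y hy
      exact branch_branchInv hγ ⟨hy.1.le, hy.2⟩)
  refine this.hasDerivWithinAt.congr_deriv ?_
  simp [ContinuousLinearEquiv.unitsEquivAut]

theorem transfer_eq (hγ : 0 ≤ γ) (φ : ℝ → ℝ) {x : ℝ} (hx : x ∈ Ioc (0 : ℝ) 1) :
    transfer γ φ x = φ (branchInv γ x) * (slope γ (branchInv γ x))⁻¹ + φ ((x + 1) / 2) / 2 := by
  rw [transfer, deriv_branch (branchInv_pos hγ hx), div_eq_mul_inv]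

/-! ### Change of variables for the transfer operator -/

variable {γ : ℝ}

theorem image_branchInv (hγ : 0 ≤ γ) {x : ℝ} (hx : x ∈ Ioc (0 : ℝ) 1) :
    branchInv γ '' Ioc 0 x = Ioc 0 (branchInv γ x) := by
  have hx' : x ∈ Icc (0 : ℝ) 1 := ⟨hx.1.le, hx.2⟩
  ext y
  constructor
  · rintro ⟨t, ht, rfl⟩
    exact ⟨branchInv_pos hγ ⟨ht.1, ht.2.trans hx.2⟩,
      (strictMonoOn_branchInv hγ).monotoneOn ⟨ht.1.le, ht.2.trans hx.2⟩ hx' ht.2⟩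
  · rintro ⟨hy0, hy⟩
    have hyI : y ∈ Icc (0 : ℝ) (1 / 2) := ⟨hy0.le, hy.trans (branchInv_mem hγ hx).2⟩
    refine ⟨branch γ y, ⟨?_, ?_⟩, branchInv_branch hγ hyI⟩
    · simpa using strictMonoOn_branch hγ self_mem_Ici hyI.1 hy0
    · rw [← branch_branchInv hγ hx']
      exact (strictMonoOn_branch hγ).monotoneOn hyI.1 (branchInv_mem_Icc hγ hx').1 hy

theorem image_half (x : ℝ) :
    (fun t : ℝ => (t + 1) / 2) '' Ioc 0 x = Ioc (1 / 2) ((x + 1) / 2) := by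
  ext y
  constructor
  · rintro ⟨t, ht, rfl⟩
    exact ⟨by linarith [ht.1], by linarith [ht.2]⟩
  · rintro ⟨h1, h2⟩
    exact ⟨2 * y - 1, ⟨by linarith, by linarith⟩, by ring⟩

/-- The transfer operator is a change of variables on each of the two branches: on `(0, x]` it
collects the masses of the two preimages of `(0, x]`. -/
theorem integrableOn_transfer_and_integral (hγ : 0 ≤ γ) {φ : ℝ → ℝ}
    (hφ : IntegrableOn φ (Ioc 0 1)) {x : ℝ} (hx : x ∈ Ioc (0 : ℝ) 1) :
    IntegrableOn (transfer γ φ) (Ioc 0 x) ∧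
      ∫ t in Ioc 0 x, transfer γ φ t =
        (∫ t in Ioc 0 (branchInv γ x), φ t) + ∫ t in Ioc (1 / 2) ((x + 1) / 2), φ t := by
  have hsub : Ioc 0 x ⊆ Ioc (0 : ℝ) 1 := Ioc_subset_Ioc_right hx.2
  have d1 : ∀ t ∈ Ioc 0 x, HasDerivWithinAt (branchInv γ) (slope γ (branchInv γ t))⁻¹
      (Ioc 0 x) t := fun t ht => (hasDerivWithinAt_branchInv hγ (hsub ht)).mono hsub
  have i1 : InjOn (branchInv γ) (Ioc 0 x) :=
    (strictMonoOn_branchInv hγ).injOn.mono (hsub.trans Ioc_subset_Icc_self)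
  have d2 : ∀ t ∈ Ioc 0 x, HasDerivWithinAt (fun t : ℝ => (t + 1) / 2) (1 / 2) (Ioc 0 x) t :=
    fun t _ => (((hasDerivAt_id t).add_const 1).div_const 2).hasDerivWithinAt
  have i2 : InjOn (fun t : ℝ => (t + 1) / 2) (Ioc 0 x) := by
    intro s _ t _ h
    have h' : (s + 1) / 2 = (t + 1) / 2 := h
    linarith
  have I1 := integrableOn_image_iff_integrableOn_abs_deriv_smul measurableSet_Ioc d1 i1 φ
  have I2 := integrableOn_image_iff_integrableOn_abs_deriv_smul measurableSet_Ioc d2 i2 φ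
  have E1 := integral_image_eq_integral_abs_deriv_smul measurableSet_Ioc d1 i1 φ
  have E2 := integral_image_eq_integral_abs_deriv_smul measurableSet_Ioc d2 i2 φ
  rw [image_branchInv hγ hx] at I1 E1
  rw [image_half] at I2 E2
  have J1 := I1.1 (hφ.mono_set (Ioc_subset_Ioc_right (branchInv_mem_Ioc hγ hx).2))
  have J2 := I2.1 (hφ.mono_set (Ioc_subset_Ioc (by norm_num) (half_mem_Ioc hx).2))
  have hcongr : EqOn (transfer γ φ) (fun t => |(slope γ (branchInv γ t))⁻¹| • φ (branchInv γ t) +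
      |(1 / 2 : ℝ)| • φ ((t + 1) / 2)) (Ioc 0 x) := by
    intro t ht
    have hs := slope_pos hγ (branchInv_pos hγ (hsub ht)).le
    simp only [transfer_eq hγ φ (hsub ht), smul_eq_mul, abs_of_pos (inv_pos.2 hs)]
    rw [abs_of_pos (by norm_num)]
    ring
  refine ⟨(IntegrableOn.congr_fun (J1.add J2) hcongr.symm measurableSet_Ioc), ?_⟩
  rw [E1, E2, setIntegral_congr_fun measurableSet_Ioc hcongr]
  exact integral_add J1 J2

theorem integrableOn_transfer (hγ : 0 ≤ γ) {φ : ℝ → ℝ} (hφ : IntegrableOn φ (Ioc 0 1)) :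
    IntegrableOn (transfer γ φ) (Ioc 0 1) :=
  (integrableOn_transfer_and_integral hγ hφ (right_mem_Ioc.2 one_pos)).1

theorem integral_transfer (hγ : 0 ≤ γ) {φ : ℝ → ℝ} (hφ : IntegrableOn φ (Ioc 0 1)) :
    ∫ x in Ioc 0 1, transfer γ φ x = ∫ x in Ioc 0 1, φ x := by
  have h := (integrableOn_transfer_and_integral hγ hφ (right_mem_Ioc.2 one_pos)).2
  rw [h, branchInv_one hγ, add_self_div_two,
    ← setIntegral_union (Ioc_disjoint_Ioc_of_le le_rfl) measurableSet_Ioc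
      (hφ.mono_set (Ioc_subset_Ioc_right (by norm_num)))
      (hφ.mono_set (Ioc_subset_Ioc_left (by norm_num))),
    Ioc_union_Ioc_eq_Ioc (by norm_num) (by norm_num)]

theorem mapReal_branchInv (hγ : 0 ≤ γ) {x : ℝ} (hx : x ∈ Ioo (0 : ℝ) 1) :
    mapReal γ (branchInv γ x) = x := by
  have hx' : x ∈ Icc (0 : ℝ) 1 := ⟨hx.1.le, hx.2.le⟩
  have h : branchInv γ x < 1 / 2 := by
    rw [branchInv_lt_iff hγ hx' (by norm_num), branch_half]; exact hx.2
  rw [mapReal, if_pos h, branch_branchInv hγ hx']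

theorem mapReal_half {x : ℝ} (hx : 0 < x) : mapReal γ ((x + 1) / 2) = x := by
  rw [mapReal, if_neg (by linarith)]; ring

theorem measurable_mapReal_uncurry : Measurable fun p : ℝ × ℝ => mapReal p.1 p.2 := by
  unfold mapReal branch
  refine Measurable.ite (measurableSet_lt measurable_snd measurable_const) ?_ ?_ <;> fun_prop

theorem measurable_mapReal (γ : ℝ) : Measurable (mapReal γ) :=
  measurable_mapReal_uncurry.comp measurable_prodMk_left

/-- The transfer operator is dual to composition with the map, here for indicator functions. -/
theorem setIntegral_transfer (hγ : 0 ≤ γ) {φ : ℝ → ℝ} (hφ : IntegrableOn φ (Ioc 0 1))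
    {R : Set ℝ} (hR : MeasurableSet R) :
    ∫ x in R ∩ Ioc 0 1, transfer γ φ x = ∫ x in mapReal γ ⁻¹' R ∩ Ioc 0 1, φ x := by
  have hR' : MeasurableSet (mapReal γ ⁻¹' R) := measurable_mapReal γ hR
  have h := integral_transfer hγ (φ := (mapReal γ ⁻¹' R).indicator φ) (hφ.indicator hR')
  rw [setIntegral_indicator hR'] at h
  rw [inter_comm _ (Ioc 0 1), inter_comm _ (Ioc 0 1), ← h, ← setIntegral_indicator hR,
    integral_Ioc_eq_integral_Ioo, integral_Ioc_eq_integral_Ioo]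
  refine setIntegral_congr_fun measurableSet_Ioo fun x hx => ?_
  have h1 := mapReal_branchInv hγ hx
  have h2 := mapReal_half (γ := γ) hx.1
  by_cases hxR : x ∈ R
  · simp [transfer, indicator, hxR, h1, h2]
  · simp [transfer, indicator, hxR, h1, h2]

/-! ### Invariance of the cone of decreasing functions -/

variable {γ α a : ℝ}

theorem transfer_mono {φ ψ : ℝ → ℝ} (hγ : 0 ≤ γ) (h : ∀ x ∈ Ioc (0 : ℝ) 1, φ x ≤ ψ x)
    {x : ℝ} (hx : x ∈ Ioc (0 : ℝ) 1) : transfer γ φ x ≤ transfer γ ψ x := by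
  rw [transfer_eq hγ _ hx, transfer_eq hγ _ hx]
  have h1 := h _ (branchInv_mem_Ioc hγ hx)
  have h2 := h _ (half_mem_Ioc hx)
  have h3 := slope_pos hγ (branchInv_pos hγ hx).le
  gcongr

theorem transfer_nonneg {φ : ℝ → ℝ} (hγ : 0 ≤ γ) (h : ∀ x ∈ Ioc (0 : ℝ) 1, 0 ≤ φ x)
    {x : ℝ} (hx : x ∈ Ioc (0 : ℝ) 1) : 0 ≤ transfer γ φ x := by
  rw [transfer_eq hγ _ hx]
  have h1 := h _ (branchInv_mem_Ioc hγ hx)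
  have h2 := h _ (half_mem_Ioc hx)
  have h3 := slope_pos hγ (branchInv_pos hγ hx).le
  positivity

theorem slope_mono (hγ : 0 ≤ γ) {y z : ℝ} (hy : 0 ≤ y) (h : y ≤ z) : slope γ y ≤ slope γ z := by
  have := pw_mono hγ hy h
  unfold slope
  gcongr

theorem continuous_slope (hγ : 0 ≤ γ) : Continuous (slope γ) := by
  unfold slope pw
  have := Real.continuous_rpow_const hγ
  fun_prop

theorem mapsTo_branchInv (hγ : 0 ≤ γ) : MapsTo (branchInv γ) (Ioc 0 1) (Ioc 0 1) :=
  fun _ hx => branchInv_mem_Ioc hγ hx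

theorem continuousOn_transfer (hγ : 0 ≤ γ) {φ : ℝ → ℝ} (hφ : ContinuousOn φ (Ioc 0 1)) :
    ContinuousOn (transfer γ φ) (Ioc 0 1) := by
  have hg := (continuousOn_branchInv hγ).mono Ioc_subset_Icc_self
  have h1 : ContinuousOn (fun x => φ (branchInv γ x)) (Ioc 0 1) := hφ.comp hg (mapsTo_branchInv hγ)
  have h2 : ContinuousOn (fun x : ℝ => φ ((x + 1) / 2)) (Ioc 0 1) :=
    hφ.comp (by fun_prop) fun x hx => half_mem_Ioc hx
  have h3 : ContinuousOn (fun x => (slope γ (branchInv γ x))⁻¹) (Ioc 0 1) :=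
    ((continuous_slope hγ).comp_continuousOn hg).inv₀
      fun x hx => (slope_pos hγ (branchInv_pos hγ hx).le).ne'
  exact ((h1.mul h3).add (h2.div_const 2)).congr fun x hx => transfer_eq hγ φ hx

theorem antitoneOn_transfer (hγ : 0 ≤ γ) {φ : ℝ → ℝ} (h0 : ∀ x ∈ Ioc (0 : ℝ) 1, 0 ≤ φ x)
    (hφ : AntitoneOn φ (Ioc 0 1)) : AntitoneOn (transfer γ φ) (Ioc 0 1) := by
  intro x hx y hy hxy
  rw [transfer_eq hγ _ hx, transfer_eq hγ _ hy]
  have hg := (strictMonoOn_branchInv hγ).monotoneOn ⟨hx.1.le, hx.2⟩ ⟨hy.1.le, hy.2⟩ hxy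
  have h1 := hφ (branchInv_mem_Ioc hγ hx) (branchInv_mem_Ioc hγ hy) hg
  have h2 := hφ (half_mem_Ioc hx) (half_mem_Ioc hy) (by linarith)
  have h3 := slope_mono hγ (branchInv_pos hγ hx).le hg
  have h4 := slope_pos hγ (branchInv_pos hγ hx).le
  have h5 := h0 _ (branchInv_mem_Ioc hγ hx)
  have h6 : (slope γ (branchInv γ y))⁻¹ ≤ (slope γ (branchInv γ x))⁻¹ := by gcongr
  have h7 := inv_pos.2 (h4.trans_le h3)
  gcongr

/-- Monotonicity of `u ↦ (1 + u) ^ (1 + α) / (1 + (1 + γ) u)`, by Bernoulli's inequality. -/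
theorem rpow_mul_le_rpow_mul (hγ : 0 ≤ γ) (hγα : γ ≤ α) {u v : ℝ} (hu : 0 ≤ u) (huv : u ≤ v) :
    (1 + u) ^ (α + 1) * (1 + (1 + γ) * v) ≤ (1 + v) ^ (α + 1) * (1 + (1 + γ) * u) := by
  set s := (v - u) / (1 + u) with hs
  have hs0 : 0 ≤ s := by have := sub_nonneg.2 huv; positivity
  have hv : 1 + v = (1 + u) * (1 + s) := by rw [hs]; field_simp; ring
  have hB := one_add_mul_self_le_rpow_one_add (s := s) (by linarith) (p := α + 1) (by linarith)
  rw [hv, Real.mul_rpow (by positivity) (by positivity)]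
  have hP : 0 < (1 + u) ^ (α + 1) := by positivity
  rw [mul_assoc]
  refine mul_le_mul_of_nonneg_left ?_ hP.le
  refine le_trans ?_ (mul_le_mul_of_nonneg_right hB (by positivity))
  have hv' : v = u + s * (1 + u) := by linarith
  rw [hv']
  have h1 : 0 ≤ s * (α - γ) := mul_nonneg hs0 (by linarith)
  have h2 : 0 ≤ s * u := mul_nonneg hs0 hu
  nlinarith [mul_nonneg h2 hγ, mul_nonneg h2 (hγ.trans hγα), mul_nonneg (mul_nonneg h2 hγ)
    (hγ.trans hγα)]

/-- Each branch contributes a product of two increasing functions: the weight `x ^ (α + 1)` is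
split into the same weight at the preimage and a factor that depends on the branch only. -/
theorem monotoneOn_rpow_mul_transfer (hγ : 0 ≤ γ) (hγα : γ ≤ α) {φ : ℝ → ℝ}
    (h0 : ∀ x ∈ Ioc (0 : ℝ) 1, 0 ≤ φ x)
    (hφ : MonotoneOn (fun x => x ^ (α + 1) * φ x) (Ioc 0 1)) :
    MonotoneOn (fun x => x ^ (α + 1) * transfer γ φ x) (Ioc 0 1) := by
  have hα : 0 ≤ α := hγ.trans hγα
  intro x hx y hy hxy
  simp only
  rw [transfer_eq hγ _ hx, transfer_eq hγ _ hy, mul_add, mul_add]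
  have hgx := branchInv_mem_Ioc hγ hx
  have hgy := branchInv_mem_Ioc hγ hy
  have hg := (strictMonoOn_branchInv hγ).monotoneOn ⟨hx.1.le, hx.2⟩ ⟨hy.1.le, hy.2⟩ hxy
  refine add_le_add ?_ ?_
  · have key : ∀ z ∈ Ioc (0 : ℝ) 1, z ^ (α + 1) * (φ (branchInv γ z) * (slope γ (branchInv γ z))⁻¹)
        = (branchInv γ z ^ (α + 1) * φ (branchInv γ z)) *
          ((1 + pw γ (branchInv γ z)) ^ (α + 1) * (slope γ (branchInv γ z))⁻¹) := by
      intro z hz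
      have hb := branch_branchInv hγ (x := z) ⟨hz.1.le, hz.2⟩
      have hp := pw_nonneg (γ := γ) (branchInv_pos hγ hz).le
      conv_lhs => rw [← hb]
      rw [branchInv_branch hγ (branchInv_mem_Icc hγ ⟨hz.1.le, hz.2⟩), branch_eq,
        Real.mul_rpow (branchInv_pos hγ hz).le (by positivity)]
      ring
    rw [key x hx, key y hy]
    have h1 := hφ hgx hgy hg
    have h2 := pw_mono hγ hgx.1.le hg
    have h3 := pw_nonneg (γ := γ) hgx.1.le
    have h4 := rpow_mul_le_rpow_mul hγ hγα h3 h2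
    have hsx := slope_pos hγ hgx.1.le
    have hsy := slope_pos hγ hgy.1.le
    have h5 : (1 + pw γ (branchInv γ x)) ^ (α + 1) * (slope γ (branchInv γ x))⁻¹ ≤
        (1 + pw γ (branchInv γ y)) ^ (α + 1) * (slope γ (branchInv γ y))⁻¹ := by
      rw [← div_eq_mul_inv, ← div_eq_mul_inv, div_le_div_iff₀ hsx hsy]
      exact h4
    have h6 : 0 ≤ branchInv γ y ^ (α + 1) * φ (branchInv γ y) :=
      mul_nonneg (Real.rpow_nonneg hgy.1.le _) (h0 _ hgy)
    exact mul_le_mul h1 h5 (by positivity) h6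
  · have key : ∀ z ∈ Ioc (0 : ℝ) 1, z ^ (α + 1) * (φ ((z + 1) / 2) / 2)
        = (((z + 1) / 2) ^ (α + 1) * φ ((z + 1) / 2)) * ((2 * z / (z + 1)) ^ (α + 1) / 2) := by
      intro z hz
      have : z = (z + 1) / 2 * (2 * z / (z + 1)) := by
        have := hz.1; field_simp
      conv_lhs => rw [this]
      have hz0 := hz.1
      rw [Real.mul_rpow (by positivity) (by positivity), ← this]
      ring
    rw [key x hx, key y hy]
    have hx0 := hx.1
    have hy0 := hy.1
    have h1 := hφ (half_mem_Ioc hx) (half_mem_Ioc hy) (by linarith)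
    have h2 : 2 * x / (x + 1) ≤ 2 * y / (y + 1) := by
      rw [div_le_div_iff₀ (by positivity) (by positivity)]; nlinarith
    have h3 : (2 * x / (x + 1)) ^ (α + 1) / 2 ≤ (2 * y / (y + 1)) ^ (α + 1) / 2 := by gcongr
    exact mul_le_mul h1 h3 (by positivity)
      (mul_nonneg (by positivity) (h0 _ (half_mem_Ioc hy)))

/-- A gain at scale `x` in the mass bound of the cone: passing from `x` to `g x` wins a term
proportional to `x`. -/
theorem rpow_branchInv_add_le (hγ : 0 ≤ γ) (hγα : γ ≤ α) (hα1 : α < 1) {x : ℝ}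
    (hx : x ∈ Ioc (0 : ℝ) 1) :
    2 / (1 - α) * branchInv γ x ^ (1 - α) + x ≤ 2 / (1 - α) * x ^ (1 - α) := by
  have hα : 0 ≤ α := hγ.trans hγα
  have hc : 0 < 1 - α := by linarith
  set y := branchInv γ x with hy
  have hyI : y ∈ Ioc (0 : ℝ) (1 / 2) := branchInv_mem hγ hx
  have hy0 := hyI.1
  have hx0 := hx.1
  have hxy : y * (1 + pw γ y) = x := branch_branchInv hγ ⟨hx.1.le, hx.2⟩
  have hu0 := pw_nonneg (γ := γ) hy0.le
  have hu1 := pw_le_one hγ hy0.le hyI.2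
  have hx2 : x ≤ 2 * y := by nlinarith
  have hu : x ^ α ≤ pw γ y := by
    rw [pw_eq hy0.le]
    calc x ^ α ≤ x ^ γ := Real.rpow_le_rpow_of_exponent_ge hx0 hx.2 hγα
      _ ≤ (2 * y) ^ γ := by gcongr
  -- concavity of the power `1 - α`
  have hB := rpow_one_add_le_one_add_mul_self (s := y / x - 1)
    (by linarith [div_pos hy0 hx0]) (p := 1 - α) hc.le (by linarith)
  rw [add_sub_cancel, Real.div_rpow hy0.le hx0.le, div_le_iff₀ (by positivity)] at hB
  have hxα : x ^ (1 - α) = x / x ^ α := by rw [Real.rpow_sub hx0, Real.rpow_one]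
  have hXpos : 0 < x ^ α := by positivity
  have hkey : y ^ (1 - α) + (1 - α) / 2 * x ≤ x ^ (1 - α) := by
    have h1 : (1 - α) / 2 * x ≤ (1 - α) * (1 - y / x) * x ^ (1 - α) := by
      have h2 : x / 2 ≤ (1 - y / x) * x ^ (1 - α) := by
        rw [hxα]
        have h3 : (1 - y / x) * (x / x ^ α) = (x - y) / x ^ α := by field_simp
        rw [h3, le_div_iff₀ hXpos]
        nlinarith
      nlinarith
    nlinarith
  calc 2 / (1 - α) * y ^ (1 - α) + x = 2 / (1 - α) * (y ^ (1 - α) + (1 - α) / 2 * x) := by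
        field_simp
    _ ≤ _ := by gcongr

theorem coneStar_mul_le {φ : ℝ → ℝ} (hφ : φ ∈ coneStar α a) {x : ℝ} (hx : x ∈ Ioc (0 : ℝ) 1) :
    x * φ x ≤ ∫ t in Ioc 0 x, φ t := by
  obtain ⟨-, hi, h0, hanti, -⟩ := hφ
  have hsub : Ioc 0 x ⊆ Ioc (0 : ℝ) 1 := Ioc_subset_Ioc_right hx.2
  have h := setIntegral_mono_on (f := fun _ => φ x) (g := φ) (μ := volume) (s := Ioc 0 x)
    (by simp) (hi.mono_set hsub) measurableSet_Ioc fun t ht => hanti (hsub ht) hx ht.2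
  simpa [hx.1.le] using h

theorem setIntegral_le_of_subset {φ : ℝ → ℝ} (hi : IntegrableOn φ (Ioc 0 1))
    (h0 : ∀ x ∈ Ioc (0 : ℝ) 1, 0 ≤ φ x) {s : Set ℝ} (hs : s ⊆ Ioc 0 1) :
    ∫ t in s, φ t ≤ ∫ t in Ioc 0 1, φ t :=
  setIntegral_mono_set hi ((ae_restrict_mem measurableSet_Ioc).mono h0) hs.eventuallyLE

theorem coneStar_setIntegral_le {φ : ℝ → ℝ} (hφ : φ ∈ coneStar α a) {x : ℝ}
    (hx : x ∈ Ioc (0 : ℝ) 1) :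
    ∫ t in Ioc 0 x, φ t ≤ a * x ^ (1 - α) * ∫ t in Ioc 0 1, φ t := by
  have h := hφ.2.2.2.2.2 x hx
  rwa [intervalIntegral.integral_of_le hx.1.le, intervalIntegral.integral_of_le zero_le_one] at h

/-- The mass of `𝓛 φ` on `(0, x]` is the mass of `φ` on `(0, g x]`, plus at most `x` times the total
mass from the second branch; by `rpow_branchInv_add_le` the bound on the former leaves room for the
latter. -/
theorem mapsTo_coneStar (hγ : 0 ≤ γ) (hγα : γ ≤ α) (hα1 : α < 1) :
    MapsTo (transfer γ) (coneStar α (2 / (1 - α))) (coneStar α (2 / (1 - α))) := by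
  rintro φ hφ
  obtain ⟨hc, hi, h0, hanti, hmono, hint⟩ := id hφ
  refine ⟨continuousOn_transfer hγ hc, integrableOn_transfer hγ hi,
    fun x hx => transfer_nonneg hγ h0 hx, antitoneOn_transfer hγ h0 hanti,
    monotoneOn_rpow_mul_transfer hγ hγα h0 hmono, fun x hx => ?_⟩
  rw [intervalIntegral.integral_of_le hx.1.le, intervalIntegral.integral_of_le zero_le_one,
    integral_transfer hγ hi, (integrableOn_transfer_and_integral hγ hi hx).2]
  have hm0 : 0 ≤ ∫ t in Ioc 0 1, φ t := setIntegral_nonneg measurableSet_Ioc h0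
  have h1 := coneStar_setIntegral_le hφ (branchInv_mem_Ioc hγ hx)
  have hhalf : (1 / 2 : ℝ) ∈ Ioc (0 : ℝ) 1 := by norm_num
  have hφhalf : φ (1 / 2) ≤ 2 * ∫ t in Ioc 0 1, φ t := by
    have h2 := coneStar_mul_le hφ hhalf
    have h3 := setIntegral_le_of_subset hi h0 (Ioc_subset_Ioc_right hhalf.2)
    linarith
  have hsub : Ioc (1 / 2) ((x + 1) / 2) ⊆ Ioc (0 : ℝ) 1 :=
    Ioc_subset_Ioc (by norm_num) (half_mem_Ioc hx).2
  have h2 : ∫ t in Ioc (1 / 2) ((x + 1) / 2), φ t ≤ x * ∫ t in Ioc 0 1, φ t := by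
    have h := setIntegral_mono_on (f := φ) (g := fun _ => φ (1 / 2)) (μ := volume)
      (s := Ioc (1 / 2) ((x + 1) / 2)) (hi.mono_set hsub) (by simp) measurableSet_Ioc
      fun t ht => hanti hhalf (hsub ht) ht.1.le
    have h' : ∫ t in Ioc (1 / 2) ((x + 1) / 2), φ t ≤ x / 2 * φ (1 / 2) := by
      refine h.trans_eq ?_
      simp only [integral_const, smul_eq_mul, measureReal_restrict_apply_univ]
      rw [Real.volume_real_Ioc_of_le (by linarith [hx.1])]
      ring
    nlinarith [hx.1]
  have h3 := mul_le_mul_of_nonneg_right (rpow_branchInv_add_le hγ hγα hα1 hx) hm0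
  linarith

/-! ### Cones of smooth functions in terms of successive derivatives -/

section Chains

variable {S : Set ℝ}

theorem contDiffOn_succ_iff_of_hasDerivWithinAt (hS : UniqueDiffOn ℝ S) {f f' : ℝ → ℝ} {n : ℕ}
    (h : ∀ x ∈ S, HasDerivWithinAt f (f' x) S x) :
    ContDiffOn ℝ (n + 1) f S ↔ ContDiffOn ℝ n f' S := by
  have he : EqOn (derivWithin f S) f' S := fun x hx => (h x hx).derivWithin (hS x hx)
  rw [contDiffOn_succ_iff_derivWithin hS]
  constructor
  · rintro ⟨-, -, h3⟩
    exact h3.congr he.symm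
  · intro h3
    exact ⟨fun x hx => (h x hx).differentiableWithinAt, by simp, h3.congr he⟩

theorem iteratedDerivWithin_two_eq (hS : UniqueDiffOn ℝ S) {f f₁ f₂ : ℝ → ℝ}
    (h₁ : ∀ x ∈ S, HasDerivWithinAt f (f₁ x) S x) (h₂ : ∀ x ∈ S, HasDerivWithinAt f₁ (f₂ x) S x) :
    EqOn (iteratedDerivWithin 2 f S) f₂ S := by
  intro x hx
  have he : EqOn (iteratedDerivWithin 1 f S) f₁ S := fun y hy => by
    rw [iteratedDerivWithin_one]
    exact (h₁ y hy).derivWithin (hS y hy)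
  rw [iteratedDerivWithin_succ, derivWithin_congr he (he hx)]
  exact (h₂ x hx).derivWithin (hS x hx)

theorem iteratedDerivWithin_three_eq (hS : UniqueDiffOn ℝ S) {f f₁ f₂ f₃ : ℝ → ℝ}
    (h₁ : ∀ x ∈ S, HasDerivWithinAt f (f₁ x) S x) (h₂ : ∀ x ∈ S, HasDerivWithinAt f₁ (f₂ x) S x)
    (h₃ : ∀ x ∈ S, HasDerivWithinAt f₂ (f₃ x) S x) :
    EqOn (iteratedDerivWithin 3 f S) f₃ S := by
  intro x hx
  have he := iteratedDerivWithin_two_eq hS h₁ h₂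
  rw [iteratedDerivWithin_succ, derivWithin_congr he (he hx)]
  exact (h₃ x hx).derivWithin (hS x hx)

theorem hasDerivWithinAt_derivWithin {f : ℝ → ℝ} (hf : ContDiffOn ℝ 1 f S) {x : ℝ} (hx : x ∈ S) :
    HasDerivWithinAt f (derivWithin f S x) S x :=
  (hf.differentiableOn (by norm_num) x hx).hasDerivWithinAt

theorem hasDerivWithinAt_iteratedDerivWithin {f : ℝ → ℝ} {n : ℕ} (hS : UniqueDiffOn ℝ S)
    (hf : ContDiffOn ℝ (n + 1) f S) {x : ℝ} (hx : x ∈ S) :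
    HasDerivWithinAt (iteratedDerivWithin n f S) (iteratedDerivWithin (n + 1) f S x) S x := by
  have h := hf.differentiableOn_iteratedDerivWithin (m := n) (by exact_mod_cast n.lt_succ_self) hS
  rw [iteratedDerivWithin_succ]
  exact (h x hx).hasDerivWithinAt

theorem mem_coneTwo_iff {b₁ b₂ : ℝ} {φ : ℝ → ℝ} :
    φ ∈ coneTwo b₁ b₂ ↔ ∃ φ₁ φ₂ : ℝ → ℝ,
      (∀ x ∈ Ioc (0 : ℝ) 1, HasDerivWithinAt φ (φ₁ x) (Ioc 0 1) x) ∧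
      (∀ x ∈ Ioc (0 : ℝ) 1, HasDerivWithinAt φ₁ (φ₂ x) (Ioc 0 1) x) ∧
      ContinuousOn φ₂ (Ioc 0 1) ∧
      ∀ x ∈ Ioc (0 : ℝ) 1, 0 ≤ φ x ∧ |φ₁ x| ≤ b₁ / x * φ x ∧ |φ₂ x| ≤ b₂ / x ^ 2 * φ x := by
  have hS := uniqueDiffOn_Ioc (0 : ℝ) 1
  constructor
  · rintro ⟨hc, hb⟩
    refine ⟨_, _, fun x hx => hasDerivWithinAt_derivWithin (hc.of_le (by norm_num)) hx,
      fun x hx => ?_,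
      hc.continuousOn_iteratedDerivWithin le_rfl hS, hb⟩
    have := hasDerivWithinAt_iteratedDerivWithin (n := 1) hS (by exact_mod_cast hc) hx
    refine this.congr (fun y _ => ?_) ?_ <;> rw [iteratedDerivWithin_one]
  · rintro ⟨φ₁, φ₂, h₁, h₂, hc, hb⟩
    refine ⟨?_, fun x hx => ?_⟩
    · have h : ContDiffOn ℝ ((1 : ℕ) + 1) φ (Ioc 0 1) := by
        rw [contDiffOn_succ_iff_of_hasDerivWithinAt hS h₁]
        have : ContDiffOn ℝ ((0 : ℕ) + 1) φ₁ (Ioc 0 1) := by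
          rw [contDiffOn_succ_iff_of_hasDerivWithinAt hS h₂]
          exact_mod_cast contDiffOn_zero.2 hc
        exact_mod_cast this
      exact_mod_cast h
    · rw [iteratedDerivWithin_two_eq hS h₁ h₂ hx, (h₁ x hx).derivWithin (hS x hx)]
      exact hb x hx

theorem mem_coneThree_iff {b₁ b₂ b₃ : ℝ} {φ : ℝ → ℝ} :
    φ ∈ coneThree b₁ b₂ b₃ ↔ ∃ φ₁ φ₂ φ₃ : ℝ → ℝ,
      (∀ x ∈ Ioc (0 : ℝ) 1, HasDerivWithinAt φ (φ₁ x) (Ioc 0 1) x) ∧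
      (∀ x ∈ Ioc (0 : ℝ) 1, HasDerivWithinAt φ₁ (φ₂ x) (Ioc 0 1) x) ∧
      (∀ x ∈ Ioc (0 : ℝ) 1, HasDerivWithinAt φ₂ (φ₃ x) (Ioc 0 1) x) ∧
      ContinuousOn φ₃ (Ioc 0 1) ∧
      ∀ x ∈ Ioc (0 : ℝ) 1, 0 ≤ φ x ∧ |φ₁ x| ≤ b₁ / x * φ x ∧ |φ₂ x| ≤ b₂ / x ^ 2 * φ x ∧
        |φ₃ x| ≤ b₃ / x ^ 3 * φ x := by
  have hS := uniqueDiffOn_Ioc (0 : ℝ) 1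
  constructor
  · rintro ⟨hc, ⟨-, hb⟩, hb'⟩
    refine ⟨_, _, _, fun x hx => hasDerivWithinAt_derivWithin (hc.of_le (by norm_num)) hx,
      fun x hx => ?_,
      fun x hx => hasDerivWithinAt_iteratedDerivWithin (n := 2) hS (by exact_mod_cast hc) hx,
      hc.continuousOn_iteratedDerivWithin le_rfl hS,
      fun x hx => ⟨(hb x hx).1, (hb x hx).2.1, (hb x hx).2.2, hb' x hx⟩⟩
    have := hasDerivWithinAt_iteratedDerivWithin (n := 1) hS
      (by exact_mod_cast hc.of_le (by norm_num : (2 : WithTop ℕ∞) ≤ 3)) hx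
    refine this.congr (fun y _ => ?_) ?_ <;> rw [iteratedDerivWithin_one]
  · rintro ⟨φ₁, φ₂, φ₃, h₁, h₂, h₃, hc, hb⟩
    refine ⟨?_, mem_coneTwo_iff.2 ⟨φ₁, φ₂, h₁, h₂, fun x hx => (h₃ x hx).continuousWithinAt,
      fun x hx => ⟨(hb x hx).1, (hb x hx).2.1, (hb x hx).2.2.1⟩⟩, fun x hx => ?_⟩
    · have h : ContDiffOn ℝ ((2 : ℕ) + 1) φ (Ioc 0 1) := by
        rw [contDiffOn_succ_iff_of_hasDerivWithinAt hS h₁]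
        have : ContDiffOn ℝ ((1 : ℕ) + 1) φ₁ (Ioc 0 1) := by
          rw [contDiffOn_succ_iff_of_hasDerivWithinAt hS h₂]
          have : ContDiffOn ℝ ((0 : ℕ) + 1) φ₂ (Ioc 0 1) := by
            rw [contDiffOn_succ_iff_of_hasDerivWithinAt hS h₃]
            exact_mod_cast contDiffOn_zero.2 hc
          exact_mod_cast this
        exact_mod_cast this
      exact_mod_cast h
    · rw [iteratedDerivWithin_three_eq hS h₁ h₂ h₃ hx]
      exact (hb x hx).2.2.2

end Chains

/-! ### Invariance of the cones of smooth functions -/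

section Smooth

variable {γ : ℝ}

/-- The derivative of `slope γ`. -/
noncomputable def slope₁ (γ y : ℝ) : ℝ := (1 + γ) * γ * pw γ y / y

/-- The second derivative of `slope γ`. -/
noncomputable def slope₂ (γ y : ℝ) : ℝ := (1 + γ) * γ * (γ - 1) * pw γ y / y ^ 2

/-- The third derivative of `slope γ`. -/
noncomputable def slope₃ (γ y : ℝ) : ℝ := (1 + γ) * γ * (γ - 1) * (γ - 2) * pw γ y / y ^ 3

theorem hasDerivAt_slope {y : ℝ} (hy : 0 < y) : HasDerivAt (slope γ) (slope₁ γ y) y := by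
  refine (((hasDerivAt_pw hy).const_mul (1 + γ)).const_add 1).congr_deriv ?_
  unfold slope₁; ring

theorem hasDerivAt_slope₁ {y : ℝ} (hy : 0 < y) : HasDerivAt (slope₁ γ) (slope₂ γ y) y := by
  refine (((hasDerivAt_pw hy).const_mul ((1 + γ) * γ)).div (hasDerivAt_id y) hy.ne').congr_deriv ?_
  simp only [slope₂, id]; field_simp

theorem hasDerivAt_slope₂ {y : ℝ} (hy : 0 < y) : HasDerivAt (slope₂ γ) (slope₃ γ y) y := by
  refine (((hasDerivAt_pw hy).const_mul ((1 + γ) * γ * (γ - 1))).div (hasDerivAt_pow 2 y)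
    (by positivity)).congr_deriv ?_
  simp only [slope₃]; field_simp; ring

theorem continuousAt_slope₃ {y : ℝ} (hy : 0 < y) : ContinuousAt (slope₃ γ) y := by
  unfold slope₃
  exact ((hasDerivAt_pw hy).continuousAt.const_mul _).div (by fun_prop) (by positivity)

theorem hasDerivAt_inv_slope (hγ : 0 ≤ γ) {y : ℝ} (hy : 0 < y) :
    HasDerivAt (fun y => (slope γ y)⁻¹) (-slope₁ γ y * (slope γ y)⁻¹ ^ 2) y := by
  have h := slope_pos hγ hy.le
  refine ((hasDerivAt_slope hy).inv h.ne').congr_deriv ?_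
  field_simp

/-- If `F` has derivative `F'`, then `F ∘ branchInv γ` has derivative `(F' / slope) ∘ branchInv γ`;
here `G = F' / slope`. -/
theorem hasDerivWithinAt_comp_branchInv (hγ : 0 ≤ γ) {F F' G : ℝ → ℝ}
    (hF : ∀ y ∈ Ioc (0 : ℝ) 1, HasDerivWithinAt F (F' y) (Ioc 0 1) y)
    (hG : ∀ y ∈ Ioc (0 : ℝ) 1, F' y * (slope γ y)⁻¹ = G y) {x : ℝ} (hx : x ∈ Ioc (0 : ℝ) 1) :
    HasDerivWithinAt (fun x => F (branchInv γ x)) (G (branchInv γ x)) (Ioc 0 1) x := by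
  have hg := branchInv_mem_Ioc hγ hx
  rw [← hG _ hg]
  exact (hF _ hg).comp x (hasDerivWithinAt_branchInv hγ hx) (mapsTo_branchInv hγ)

theorem hasDerivWithinAt_comp_half {F F' : ℝ → ℝ}
    (hF : ∀ y ∈ Ioc (0 : ℝ) 1, HasDerivWithinAt F (F' y) (Ioc 0 1) y) (c : ℝ)
    {x : ℝ} (hx : x ∈ Ioc (0 : ℝ) 1) :
    HasDerivWithinAt (fun x => F ((x + 1) / 2) / c) (F' ((x + 1) / 2) / (2 * c)) (Ioc 0 1) x := by
  have h := ((hF _ (half_mem_Ioc hx)).comp x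
    (((hasDerivAt_id x).add_const 1).div_const 2).hasDerivWithinAt
    fun y hy => half_mem_Ioc hy).div_const c
  refine h.congr_deriv ?_
  ring

/-- The contribution of the first branch to the transfer operator, as a function of the
preimage. -/
noncomputable def pull₀ (γ : ℝ) (φ : ℝ → ℝ) (y : ℝ) : ℝ := φ y * (slope γ y)⁻¹

/-- The derivative of `pull₀ γ φ` with respect to the image point, where `φ₁ = φ'`. -/
noncomputable def pull₁ (γ : ℝ) (φ φ₁ : ℝ → ℝ) (y : ℝ) : ℝ :=
  φ₁ y * (slope γ y)⁻¹ ^ 2 - φ y * slope₁ γ y * (slope γ y)⁻¹ ^ 3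

/-- The second derivative of `pull₀ γ φ` with respect to the image point, where `φ₁` and `φ₂` are
the derivatives of `φ`. -/
noncomputable def pull₂ (γ : ℝ) (φ φ₁ φ₂ : ℝ → ℝ) (y : ℝ) : ℝ :=
  φ₂ y * (slope γ y)⁻¹ ^ 3 - 3 * φ₁ y * slope₁ γ y * (slope γ y)⁻¹ ^ 4
    - φ y * slope₂ γ y * (slope γ y)⁻¹ ^ 4 + 3 * φ y * slope₁ γ y ^ 2 * (slope γ y)⁻¹ ^ 5

/-- The third derivative of `pull₀ γ φ` with respect to the image point, where `φ₁`, `φ₂` and `φ₃`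
are the derivatives of `φ`. -/
noncomputable def pull₃ (γ : ℝ) (φ φ₁ φ₂ φ₃ : ℝ → ℝ) (y : ℝ) : ℝ :=
  φ₃ y * (slope γ y)⁻¹ ^ 4 - 6 * φ₂ y * slope₁ γ y * (slope γ y)⁻¹ ^ 5
    + φ₁ y * (-4 * slope₂ γ y * (slope γ y)⁻¹ ^ 5 + 15 * slope₁ γ y ^ 2 * (slope γ y)⁻¹ ^ 6)
    + φ y * (-slope₃ γ y * (slope γ y)⁻¹ ^ 5 + 10 * slope₁ γ y * slope₂ γ y * (slope γ y)⁻¹ ^ 6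
      - 15 * slope₁ γ y ^ 3 * (slope γ y)⁻¹ ^ 7)

variable {φ φ₁ φ₂ φ₃ : ℝ → ℝ}

theorem hasDerivWithinAt_pull₀ (hγ : 0 ≤ γ)
    (h₁ : ∀ x ∈ Ioc (0 : ℝ) 1, HasDerivWithinAt φ (φ₁ x) (Ioc 0 1) x)
    {x : ℝ} (hx : x ∈ Ioc (0 : ℝ) 1) :
    HasDerivWithinAt (fun x => pull₀ γ φ (branchInv γ x)) (pull₁ γ φ φ₁ (branchInv γ x))
      (Ioc 0 1) x := by
  refine hasDerivWithinAt_comp_branchInv hγ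
    (fun y hy => (h₁ y hy).mul (hasDerivAt_inv_slope hγ hy.1).hasDerivWithinAt) (fun y hy => ?_) hx
  simp only [pull₁]; ring

theorem hasDerivWithinAt_pull₁ (hγ : 0 ≤ γ)
    (h₁ : ∀ x ∈ Ioc (0 : ℝ) 1, HasDerivWithinAt φ (φ₁ x) (Ioc 0 1) x)
    (h₂ : ∀ x ∈ Ioc (0 : ℝ) 1, HasDerivWithinAt φ₁ (φ₂ x) (Ioc 0 1) x)
    {x : ℝ} (hx : x ∈ Ioc (0 : ℝ) 1) :
    HasDerivWithinAt (fun x => pull₁ γ φ φ₁ (branchInv γ x)) (pull₂ γ φ φ₁ φ₂ (branchInv γ x))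
      (Ioc 0 1) x := by
  have hw := fun y (hy : y ∈ Ioc (0 : ℝ) 1) =>
    (hasDerivAt_inv_slope hγ hy.1).hasDerivWithinAt (s := Ioc 0 1)
  have hA := fun y (hy : y ∈ Ioc (0 : ℝ) 1) =>
    (hasDerivAt_slope₁ (γ := γ) hy.1).hasDerivWithinAt (s := Ioc 0 1)
  refine hasDerivWithinAt_comp_branchInv hγ
    (fun y hy => ((h₂ y hy).mul ((hw y hy).pow 2)).sub
      (((h₁ y hy).mul (hA y hy)).mul ((hw y hy).pow 3))) (fun y hy => ?_) hx
  simp only [pull₂]; norm_num; ring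

theorem hasDerivWithinAt_pull₂ (hγ : 0 ≤ γ)
    (h₁ : ∀ x ∈ Ioc (0 : ℝ) 1, HasDerivWithinAt φ (φ₁ x) (Ioc 0 1) x)
    (h₂ : ∀ x ∈ Ioc (0 : ℝ) 1, HasDerivWithinAt φ₁ (φ₂ x) (Ioc 0 1) x)
    (h₃ : ∀ x ∈ Ioc (0 : ℝ) 1, HasDerivWithinAt φ₂ (φ₃ x) (Ioc 0 1) x)
    {x : ℝ} (hx : x ∈ Ioc (0 : ℝ) 1) :
    HasDerivWithinAt (fun x => pull₂ γ φ φ₁ φ₂ (branchInv γ x))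
      (pull₃ γ φ φ₁ φ₂ φ₃ (branchInv γ x)) (Ioc 0 1) x := by
  have hw := fun y (hy : y ∈ Ioc (0 : ℝ) 1) =>
    (hasDerivAt_inv_slope hγ hy.1).hasDerivWithinAt (s := Ioc 0 1)
  have hA := fun y (hy : y ∈ Ioc (0 : ℝ) 1) =>
    (hasDerivAt_slope₁ (γ := γ) hy.1).hasDerivWithinAt (s := Ioc 0 1)
  have hB := fun y (hy : y ∈ Ioc (0 : ℝ) 1) =>
    (hasDerivAt_slope₂ (γ := γ) hy.1).hasDerivWithinAt (s := Ioc 0 1)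
  refine hasDerivWithinAt_comp_branchInv hγ
    (fun y hy => ((((h₃ y hy).mul ((hw y hy).pow 3)).sub
      ((((h₂ y hy).const_mul 3).mul (hA y hy)).mul ((hw y hy).pow 4))).sub
      (((h₁ y hy).mul (hB y hy)).mul ((hw y hy).pow 4))).add
      ((((h₁ y hy).const_mul 3).mul ((hA y hy).pow 2)).mul ((hw y hy).pow 5)))
    (fun y hy => ?_) hx
  simp only [pull₃]; norm_num; ring

theorem continuousOn_pull₂ (hγ : 0 ≤ γ) (h : ContinuousOn φ (Ioc 0 1))
    (h₁ : ContinuousOn φ₁ (Ioc 0 1)) (h₂ : ContinuousOn φ₂ (Ioc 0 1)) :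
    ContinuousOn (fun x => pull₂ γ φ φ₁ φ₂ (branchInv γ x)) (Ioc 0 1) := by
  have hw : ContinuousOn (fun y => (slope γ y)⁻¹) (Ioc 0 1) := fun y hy =>
    (hasDerivAt_inv_slope hγ hy.1).continuousAt.continuousWithinAt
  have hA : ContinuousOn (slope₁ γ) (Ioc 0 1) := fun y hy =>
    (hasDerivAt_slope₁ hy.1).continuousAt.continuousWithinAt
  have hB : ContinuousOn (slope₂ γ) (Ioc 0 1) := fun y hy =>
    (hasDerivAt_slope₂ hy.1).continuousAt.continuousWithinAt
  refine ContinuousOn.comp (g := pull₂ γ φ φ₁ φ₂) (t := Ioc 0 1) ?_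
    ((continuousOn_branchInv hγ).mono Ioc_subset_Icc_self) (mapsTo_branchInv hγ)
  unfold pull₂
  fun_prop

theorem continuousOn_pull₃ (hγ : 0 ≤ γ) (h : ContinuousOn φ (Ioc 0 1))
    (h₁ : ContinuousOn φ₁ (Ioc 0 1)) (h₂ : ContinuousOn φ₂ (Ioc 0 1))
    (h₃ : ContinuousOn φ₃ (Ioc 0 1)) :
    ContinuousOn (fun x => pull₃ γ φ φ₁ φ₂ φ₃ (branchInv γ x)) (Ioc 0 1) := by
  have hw : ContinuousOn (fun y => (slope γ y)⁻¹) (Ioc 0 1) := fun y hy =>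
    (hasDerivAt_inv_slope hγ hy.1).continuousAt.continuousWithinAt
  have hA : ContinuousOn (slope₁ γ) (Ioc 0 1) := fun y hy =>
    (hasDerivAt_slope₁ hy.1).continuousAt.continuousWithinAt
  have hB : ContinuousOn (slope₂ γ) (Ioc 0 1) := fun y hy =>
    (hasDerivAt_slope₂ hy.1).continuousAt.continuousWithinAt
  have hC : ContinuousOn (slope₃ γ) (Ioc 0 1) := fun y hy =>
    (continuousAt_slope₃ hy.1).continuousWithinAt
  refine ContinuousOn.comp (g := pull₃ γ φ φ₁ φ₂ φ₃) (t := Ioc 0 1) ?_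
    ((continuousOn_branchInv hγ).mono Ioc_subset_Icc_self) (mapsTo_branchInv hγ)
  unfold pull₃
  fun_prop

/-- The scale-invariant form of the derivatives of the branch at `y`: with `s = γ u / f'(y)`,
where `u = (2 y) ^ γ`, one has `f(y) / f'(y) = y (1 - s)`, and the derivatives of `f'` are
multiples of `s f'(y)`. -/
theorem exists_scale (hγ : 0 ≤ γ) (hγ1 : γ ≤ 1) {y : ℝ} (hy : 0 < y) :
    ∃ s e₁ e₂ e₃ : ℝ, 0 ≤ s ∧ s ≤ 1 ∧ |e₁| ≤ 2 * s ∧ |e₂| ≤ s ∧ |e₃| ≤ 2 * s ∧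
      branch γ y * (slope γ y)⁻¹ = y * (1 - s) ∧
      y * (slope₁ γ y * (slope γ y)⁻¹) = e₁ ∧
      y ^ 2 * (slope₂ γ y * (slope γ y)⁻¹) = e₂ ∧
      y ^ 3 * (slope₃ γ y * (slope γ y)⁻¹) = e₃ := by
  have hu := pw_nonneg (γ := γ) hy.le
  have hD := slope_pos hγ hy.le
  have hs0 : 0 ≤ γ * pw γ y * (slope γ y)⁻¹ := by positivity
  refine ⟨γ * pw γ y * (slope γ y)⁻¹, (1 + γ) * (γ * pw γ y * (slope γ y)⁻¹),
    -((1 + γ) * (1 - γ) * (γ * pw γ y * (slope γ y)⁻¹)),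
    (1 + γ) * (1 - γ) * (2 - γ) * (γ * pw γ y * (slope γ y)⁻¹), hs0, ?_, ?_, ?_, ?_, ?_, ?_, ?_, ?_⟩
  · rw [← div_eq_mul_inv, div_le_one hD]
    unfold slope; nlinarith
  · rw [abs_of_nonneg (by positivity)]
    exact mul_le_mul_of_nonneg_right (by linarith) hs0
  · have h1 : 0 ≤ 1 - γ := by linarith
    rw [abs_neg, abs_of_nonneg (by positivity)]
    refine mul_le_of_le_one_left hs0 ?_
    nlinarith
  · have h1 : 0 ≤ 1 - γ := by linarith
    have h2 : 0 ≤ 2 - γ := by linarith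
    rw [abs_of_nonneg (by positivity)]
    refine mul_le_mul_of_nonneg_right ?_ hs0
    have h3 : (1 + γ) * (1 - γ) ≤ 1 := by nlinarith
    nlinarith
  · have : branch γ y = y * (slope γ y - γ * pw γ y) := by rw [branch_eq]; unfold slope; ring
    rw [this]; field_simp
  · unfold slope₁; field_simp
  · unfold slope₂; field_simp; ring
  · unfold slope₃; field_simp; ring

/-- The factor `1 - s` gained by the scale change absorbs an error of order `s`. -/
theorem one_sub_pow_mul_le {s b c : ℝ} (hs0 : 0 ≤ s) (hs1 : s ≤ 1) (hc : 0 ≤ c) (hcb : c ≤ b)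
    {n : ℕ} (hn : n ≠ 0) : (1 - s) ^ n * (b + c * s) ≤ b := by
  have h1 : (1 - s) ^ n ≤ 1 - s := pow_le_of_le_one (by linarith) (by linarith) hn
  have h2 : 0 ≤ c * s := mul_nonneg hc hs0
  calc (1 - s) ^ n * (b + c * s) ≤ (1 - s) * (b + c * s) := by gcongr; linarith
    _ ≤ b := by nlinarith [mul_nonneg h2 hs0, mul_nonneg (sub_nonneg.2 hcb) hs0]

theorem abs_mul_le_mul {x y a b : ℝ} (hx : |x| ≤ a) (hy : |y| ≤ b) : |x * y| ≤ a * b := by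
  rw [abs_mul]; exact mul_le_mul hx hy (abs_nonneg _) ((abs_nonneg _).trans hx)

/-- From a scale-invariant expression of a derivative to the bound in the definition of the
cones. -/
theorem abs_le_div_pow_mul {x k E s b c f w : ℝ} {n : ℕ} (hn : n ≠ 0) (hx : 0 < x) (hw : 0 ≤ w)
    (hf : 0 ≤ f) (hs0 : 0 ≤ s) (hs1 : s ≤ 1) (hc : 0 ≤ c) (hcb : c ≤ b)
    (hk : x ^ n * k = (1 - s) ^ n * w * E) (hE : |E| ≤ (b + c * s) * f) :
    |k| ≤ b / x ^ n * (f * w) := by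
  have hs2 : 0 ≤ (1 - s) ^ n := pow_nonneg (by linarith) n
  have h1 : x ^ n * |k| ≤ b * (f * w) := by
    rw [← abs_of_pos (pow_pos hx n), ← abs_mul, hk, abs_mul, abs_of_nonneg (by positivity)]
    calc (1 - s) ^ n * w * |E| ≤ (1 - s) ^ n * w * ((b + c * s) * f) := by gcongr
      _ = (1 - s) ^ n * (b + c * s) * (f * w) := by ring
      _ ≤ b * (f * w) := by
        gcongr
        exact one_sub_pow_mul_le hs0 hs1 hc hcb hn
  rw [div_mul_eq_mul_div, le_div_iff₀ (pow_pos hx n)]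
  linarith

theorem abs_mul_pow_le {y p b f : ℝ} {n : ℕ} (hy : 0 < y) (h : |p| ≤ b / y ^ n * f) :
    |y ^ n * p| ≤ b * f := by
  rw [abs_mul, abs_of_pos (pow_pos hy n)]
  calc y ^ n * |p| ≤ y ^ n * (b / y ^ n * f) := by gcongr
    _ = b * f := by field_simp

/-- Differentiating the weight `1 / f'` costs an error `|e₁| ≤ 2 s`, which is of order `s` with a
constant not above the bound `2` itself; hence the scale factor `1 - s` absorbs it. -/
theorem abs_pull₁_le {y : ℝ} (hγ : 0 ≤ γ) (hγ1 : γ ≤ 1) (hy : 0 < y) (h0 : 0 ≤ φ y)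
    (hb₁ : |φ₁ y| ≤ 2 / y * φ y) :
    |pull₁ γ φ φ₁ y| ≤ 2 / branch γ y * pull₀ γ φ y := by
  obtain ⟨s, e₁, -, -, hs0, hs1, he₁, -, -, hx, h₁, -, -⟩ := exists_scale hγ hγ1 hy
  have hw : 0 < (slope γ y)⁻¹ := inv_pos.2 (slope_pos hγ hy.le)
  have hxpos : 0 < branch γ y := by simpa using strictMonoOn_branch hγ self_mem_Ici hy.le hy
  have hP₁ : |y ^ 1 * φ₁ y| ≤ 2 * φ y := abs_mul_pow_le hy (by simpa using hb₁)
  have := abs_le_div_pow_mul (n := 1) (k := pull₁ γ φ φ₁ y) (c := 2) (b := 2)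
    (E := y ^ 1 * φ₁ y - e₁ * φ y) one_ne_zero hxpos hw.le h0 hs0 hs1 (by norm_num) (by norm_num)
    ?_ ?_
  · simpa [pull₀] using this
  · have hk : branch γ y ^ 1 * pull₁ γ φ φ₁ y =
        (branch γ y * (slope γ y)⁻¹) ^ 1 * (slope γ y)⁻¹ *
          (φ₁ y - (slope₁ γ y * (slope γ y)⁻¹) * φ y) := by
      simp only [pull₁]; ring
    rw [hk, hx, ← h₁]; ring
  · have hφ := abs_of_nonneg h0
    have t₁ := abs_mul_le_mul he₁ hφ.le
    have := abs_sub (y ^ 1 * φ₁ y) (e₁ * φ y)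
    linarith

/-- As in the first order, with errors of at most `(12 + 1 + 12) s ≤ 30 s`. -/
theorem abs_pull₂_le {y : ℝ} (hγ : 0 ≤ γ) (hγ1 : γ ≤ 1) (hy : 0 < y) (h0 : 0 ≤ φ y)
    (hb₁ : |φ₁ y| ≤ 2 / y * φ y) (hb₂ : |φ₂ y| ≤ 30 / y ^ 2 * φ y) :
    |pull₂ γ φ φ₁ φ₂ y| ≤ 30 / branch γ y ^ 2 * pull₀ γ φ y := by
  obtain ⟨s, e₁, e₂, -, hs0, hs1, he₁, he₂, -, hx, h₁, h₂, -⟩ := exists_scale hγ hγ1 hy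
  have hw : 0 < (slope γ y)⁻¹ := inv_pos.2 (slope_pos hγ hy.le)
  have hxpos : 0 < branch γ y := by simpa using strictMonoOn_branch hγ self_mem_Ici hy.le hy
  have hP₁ : |y ^ 1 * φ₁ y| ≤ 2 * φ y := abs_mul_pow_le hy (by simpa using hb₁)
  have hP₂ : |y ^ 2 * φ₂ y| ≤ 30 * φ y := abs_mul_pow_le hy hb₂
  refine abs_le_div_pow_mul (n := 2) (k := pull₂ γ φ φ₁ φ₂ y) (c := 30) (b := 30)
    (E := y ^ 2 * φ₂ y - 3 * ((y ^ 1 * φ₁ y) * e₁) - φ y * e₂ + 3 * (φ y * (e₁ * e₁))) two_ne_zero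
    hxpos hw.le h0 hs0 hs1 (by norm_num) (by norm_num) ?_ ?_
  · have hk : branch γ y ^ 2 * pull₂ γ φ φ₁ φ₂ y =
        (branch γ y * (slope γ y)⁻¹) ^ 2 * (slope γ y)⁻¹ *
          (φ₂ y - 3 * φ₁ y * (slope₁ γ y * (slope γ y)⁻¹) - φ y * (slope₂ γ y * (slope γ y)⁻¹) +
            3 * φ y * (slope₁ γ y * (slope γ y)⁻¹) ^ 2) := by
      simp only [pull₂]; ring
    rw [hk, hx, ← h₁, ← h₂]; ring
  · have hφ := (abs_of_nonneg h0).le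
    have t₁ := abs_mul_le_mul hP₁ he₁
    have t₂ := abs_mul_le_mul hφ he₂
    have t₃ := abs_mul_le_mul hφ (abs_mul_le_mul he₁ he₁)
    have hss : φ y * (s * s) ≤ φ y * s := by gcongr; nlinarith
    rw [abs_le] at *
    constructor <;> linarith

/-- As in the first order, with errors of at most `(360 + 8 + 120 + 2 + 20 + 120) s ≤ 1000 s`. -/
theorem abs_pull₃_le {y : ℝ} (hγ : 0 ≤ γ) (hγ1 : γ ≤ 1) (hy : 0 < y) (h0 : 0 ≤ φ y)
    (hb₁ : |φ₁ y| ≤ 2 / y * φ y) (hb₂ : |φ₂ y| ≤ 30 / y ^ 2 * φ y)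
    (hb₃ : |φ₃ y| ≤ 1000 / y ^ 3 * φ y) :
    |pull₃ γ φ φ₁ φ₂ φ₃ y| ≤ 1000 / branch γ y ^ 3 * pull₀ γ φ y := by
  obtain ⟨s, e₁, e₂, e₃, hs0, hs1, he₁, he₂, he₃, hx, h₁, h₂, h₃⟩ := exists_scale hγ hγ1 hy
  have hw : 0 < (slope γ y)⁻¹ := inv_pos.2 (slope_pos hγ hy.le)
  have hxpos : 0 < branch γ y := by simpa using strictMonoOn_branch hγ self_mem_Ici hy.le hy
  have hP₁ : |y ^ 1 * φ₁ y| ≤ 2 * φ y := abs_mul_pow_le hy (by simpa using hb₁)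
  have hP₂ : |y ^ 2 * φ₂ y| ≤ 30 * φ y := abs_mul_pow_le hy hb₂
  have hP₃ : |y ^ 3 * φ₃ y| ≤ 1000 * φ y := abs_mul_pow_le hy hb₃
  refine abs_le_div_pow_mul (n := 3) (k := pull₃ γ φ φ₁ φ₂ φ₃ y) (c := 1000) (b := 1000)
    (E := y ^ 3 * φ₃ y - 6 * ((y ^ 2 * φ₂ y) * e₁) - 4 * ((y ^ 1 * φ₁ y) * e₂)
      + 15 * ((y ^ 1 * φ₁ y) * (e₁ * e₁)) - φ y * e₃ + 10 * (φ y * (e₁ * e₂))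
      - 15 * (φ y * (e₁ * (e₁ * e₁)))) three_ne_zero
    hxpos hw.le h0 hs0 hs1 (by norm_num) (by norm_num) ?_ ?_
  · have hk : branch γ y ^ 3 * pull₃ γ φ φ₁ φ₂ φ₃ y =
        (branch γ y * (slope γ y)⁻¹) ^ 3 * (slope γ y)⁻¹ *
          (φ₃ y - 6 * φ₂ y * (slope₁ γ y * (slope γ y)⁻¹)
            - 4 * φ₁ y * (slope₂ γ y * (slope γ y)⁻¹)
            + 15 * φ₁ y * (slope₁ γ y * (slope γ y)⁻¹) ^ 2
            - φ y * (slope₃ γ y * (slope γ y)⁻¹)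
            + 10 * φ y * (slope₁ γ y * (slope γ y)⁻¹) * (slope₂ γ y * (slope γ y)⁻¹)
            - 15 * φ y * (slope₁ γ y * (slope γ y)⁻¹) ^ 3) := by
      simp only [pull₃]; ring
    rw [hk, hx, ← h₁, ← h₂, ← h₃]; ring
  · have hφ := (abs_of_nonneg h0).le
    have t₁ := abs_mul_le_mul hP₂ he₁
    have t₂ := abs_mul_le_mul hP₁ he₂
    have t₃ := abs_mul_le_mul hP₁ (abs_mul_le_mul he₁ he₁)
    have t₄ := abs_mul_le_mul hφ he₃
    have t₅ := abs_mul_le_mul hφ (abs_mul_le_mul he₁ he₂)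
    have t₆ := abs_mul_le_mul hφ (abs_mul_le_mul he₁ (abs_mul_le_mul he₁ he₁))
    have hss : φ y * (s * s) ≤ φ y * s := by gcongr; nlinarith
    have hsss : φ y * (s * (s * s)) ≤ φ y * s := by
      gcongr; nlinarith [mul_nonneg hs0 hs0]
    rw [abs_le] at *
    constructor <;> linarith

theorem transfer_eq_pull₀ (hγ : 0 ≤ γ) (φ : ℝ → ℝ) :
    EqOn (transfer γ φ) (fun x => pull₀ γ φ (branchInv γ x) + φ ((x + 1) / 2) / 2) (Ioc 0 1) :=
  fun _ hx => transfer_eq hγ φ hx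

/-- The bounds of the cones on the contribution of the second branch. -/
theorem abs_comp_half_div_le {n : ℕ} {x b p f : ℝ} (hx : x ∈ Ioc (0 : ℝ) 1) (hb : 0 ≤ b)
    (hf : 0 ≤ f) (h : |p| ≤ b / ((x + 1) / 2) ^ n * f) :
    |p / (2 ^ n * 2)| ≤ b / x ^ n * (f / 2) := by
  have hx0 := hx.1
  rw [abs_div, abs_of_pos (by positivity : (0 : ℝ) < 2 ^ n * 2), div_le_iff₀ (by positivity)]
  refine h.trans ?_
  have : b / ((x + 1) / 2) ^ n = b / (x + 1) ^ n * 2 ^ n := by rw [div_pow]; field_simp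
  rw [this]
  have h2 : b / (x + 1) ^ n ≤ b / x ^ n := by gcongr; linarith
  calc b / (x + 1) ^ n * 2 ^ n * f ≤ b / x ^ n * 2 ^ n * f := by gcongr
    _ = _ := by ring

theorem mapsTo_coneTwo (hγ : 0 ≤ γ) (hγ1 : γ ≤ 1) :
    MapsTo (transfer γ) (coneTwo 2 30) (coneTwo 2 30) := by
  intro φ hφ
  obtain ⟨φ₁, φ₂, h₁, h₂, hc, hb⟩ := mem_coneTwo_iff.1 hφ
  have hE := transfer_eq_pull₀ hγ φ
  refine mem_coneTwo_iff.2 ⟨fun x => pull₁ γ φ φ₁ (branchInv γ x) + φ₁ ((x + 1) / 2) / (2 * 2),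
    fun x => pull₂ γ φ φ₁ φ₂ (branchInv γ x) + φ₂ ((x + 1) / 2) / (2 * (2 * 2)), ?_, ?_, ?_, ?_⟩
  · intro x hx
    exact ((hasDerivWithinAt_pull₀ hγ h₁ hx).add (hasDerivWithinAt_comp_half h₁ 2 hx)).congr
      hE (hE hx)
  · intro x hx
    exact (hasDerivWithinAt_pull₁ hγ h₁ h₂ hx).add (hasDerivWithinAt_comp_half h₂ _ hx)
  · refine (continuousOn_pull₂ hγ (fun x hx => (h₁ x hx).continuousWithinAt)
      (fun x hx => (h₂ x hx).continuousWithinAt) hc).add (ContinuousOn.div_const ?_ _)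
    exact hc.comp (by fun_prop) fun x hx => half_mem_Ioc hx
  · intro x hx
    have hg := branchInv_mem_Ioc hγ hx
    have hz := half_mem_Ioc hx
    have hbr := branch_branchInv hγ (x := x) ⟨hx.1.le, hx.2⟩
    obtain ⟨hb0, hb1, hb2⟩ := hb _ hg
    obtain ⟨hc0, hc1, hc2⟩ := hb _ hz
    have p₁ := abs_pull₁_le hγ hγ1 hg.1 hb0 hb1
    have p₂ := abs_pull₂_le hγ hγ1 hg.1 hb0 hb1 hb2
    rw [hbr] at p₁ p₂
    have q₁ := abs_comp_half_div_le (n := 1) hx zero_le_two hc0 (by simpa using hc1)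
    have q₂ := abs_comp_half_div_le (n := 2) hx (by norm_num : (0 : ℝ) ≤ 30) hc0 hc2
    refine ⟨transfer_nonneg hγ (fun x hx => (hb x hx).1) hx, ?_, ?_⟩
    · rw [hE hx, mul_add]
      refine (abs_add_le _ _).trans (add_le_add p₁ ?_)
      simpa using q₁
    · rw [hE hx, mul_add]
      refine (abs_add_le _ _).trans (add_le_add p₂ ?_)
      rwa [show (2 : ℝ) * (2 * 2) = 2 ^ 2 * 2 by norm_num]

theorem mapsTo_coneThree (hγ : 0 ≤ γ) (hγ1 : γ ≤ 1) :
    MapsTo (transfer γ) (coneThree 2 30 1000) (coneThree 2 30 1000) := by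
  intro φ hφ
  obtain ⟨φ₁, φ₂, φ₃, h₁, h₂, h₃, hc, hb⟩ := mem_coneThree_iff.1 hφ
  have hE := transfer_eq_pull₀ hγ φ
  refine mem_coneThree_iff.2 ⟨fun x => pull₁ γ φ φ₁ (branchInv γ x) + φ₁ ((x + 1) / 2) / (2 * 2),
    fun x => pull₂ γ φ φ₁ φ₂ (branchInv γ x) + φ₂ ((x + 1) / 2) / (2 * (2 * 2)),
    fun x => pull₃ γ φ φ₁ φ₂ φ₃ (branchInv γ x) + φ₃ ((x + 1) / 2) / (2 * (2 * (2 * 2))),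
    ?_, ?_, ?_, ?_, ?_⟩
  · intro x hx
    exact ((hasDerivWithinAt_pull₀ hγ h₁ hx).add (hasDerivWithinAt_comp_half h₁ 2 hx)).congr
      hE (hE hx)
  · intro x hx
    exact (hasDerivWithinAt_pull₁ hγ h₁ h₂ hx).add (hasDerivWithinAt_comp_half h₂ _ hx)
  · intro x hx
    exact (hasDerivWithinAt_pull₂ hγ h₁ h₂ h₃ hx).add (hasDerivWithinAt_comp_half h₃ _ hx)
  · refine (continuousOn_pull₃ hγ (fun x hx => (h₁ x hx).continuousWithinAt)
      (fun x hx => (h₂ x hx).continuousWithinAt) (fun x hx => (h₃ x hx).continuousWithinAt)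
      hc).add (ContinuousOn.div_const ?_ _)
    exact hc.comp (by fun_prop) fun x hx => half_mem_Ioc hx
  · intro x hx
    have hg := branchInv_mem_Ioc hγ hx
    have hz := half_mem_Ioc hx
    have hbr := branch_branchInv hγ (x := x) ⟨hx.1.le, hx.2⟩
    obtain ⟨hb0, hb1, hb2, hb3⟩ := hb _ hg
    obtain ⟨hc0, hc1, hc2, hc3⟩ := hb _ hz
    have p₁ := abs_pull₁_le hγ hγ1 hg.1 hb0 hb1
    have p₂ := abs_pull₂_le hγ hγ1 hg.1 hb0 hb1 hb2
    have p₃ := abs_pull₃_le hγ hγ1 hg.1 hb0 hb1 hb2 hb3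
    rw [hbr] at p₁ p₂ p₃
    have q₁ := abs_comp_half_div_le (n := 1) hx zero_le_two hc0 (by simpa using hc1)
    have q₂ := abs_comp_half_div_le (n := 2) hx (by norm_num : (0 : ℝ) ≤ 30) hc0 hc2
    have q₃ := abs_comp_half_div_le (n := 3) hx (by norm_num : (0 : ℝ) ≤ 1000) hc0 hc3
    refine ⟨transfer_nonneg hγ (fun x hx => (hb x hx).1) hx, ?_, ?_, ?_⟩
    · rw [hE hx, mul_add]
      refine (abs_add_le _ _).trans (add_le_add p₁ ?_)
      simpa using q₁
    · rw [hE hx, mul_add]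
      refine (abs_add_le _ _).trans (add_le_add p₂ ?_)
      rwa [show (2 : ℝ) * (2 * 2) = 2 ^ 2 * 2 by norm_num]
    · rw [hE hx, mul_add]
      refine (abs_add_le _ _).trans (add_le_add p₃ ?_)
      rwa [show (2 : ℝ) * (2 * (2 * 2)) = 2 ^ 3 * 2 by norm_num]

end Smooth

/-! ### The cocycle of transfer operators -/

section Cocycle

variable {Ω : Type*} {σ : Ω → Ω} {β : Ω → Ioo (0 : ℝ) 1} {α : ℝ} {φ ψ : ℝ → ℝ}

theorem cocycle_succ' (ω : Ω) (n : ℕ) (φ : ℝ → ℝ) :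
    cocycle σ β ω (n + 1) φ = cocycle σ β (σ ω) n (transfer (β ω) φ) := by
  induction n with
  | zero => rfl
  | succ n ih =>
    rw [cocycle, ih, cocycle, ← Function.iterate_succ_apply σ n ω]

theorem cocycle_add (ω : Ω) (n m : ℕ) (φ : ℝ → ℝ) :
    cocycle σ β ω (n + m) φ = cocycle σ β (σ^[n] ω) m (cocycle σ β ω n φ) := by
  induction n generalizing ω φ with
  | zero => simp [cocycle]
  | succ n ih => rw [Nat.succ_add n m, cocycle_succ', ih, cocycle_succ',
      Function.iterate_succ_apply]

theorem transfer_congr {γ : ℝ} (hγ : 0 ≤ γ) (h : EqOn φ ψ (Ioc 0 1)) :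
    EqOn (transfer γ φ) (transfer γ ψ) (Ioc 0 1) := fun x hx => by
  rw [transfer_eq hγ _ hx, transfer_eq hγ _ hx, h (branchInv_mem_Ioc hγ hx), h (half_mem_Ioc hx)]

theorem cocycle_mono (ω : Ω) (n : ℕ) (h : ∀ x ∈ Ioc (0 : ℝ) 1, φ x ≤ ψ x) :
    ∀ x ∈ Ioc (0 : ℝ) 1, cocycle σ β ω n φ x ≤ cocycle σ β ω n ψ x := by
  induction n with
  | zero => exact h
  | succ n ih => exact fun x hx => transfer_mono (β _).2.1.le ih hx

theorem cocycle_sub (ω : Ω) (n : ℕ) (φ ψ : ℝ → ℝ) (x : ℝ) :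
    cocycle σ β ω n (fun x => φ x - ψ x) x = cocycle σ β ω n φ x - cocycle σ β ω n ψ x := by
  induction n generalizing x with
  | zero => rfl
  | succ n ih => simp only [cocycle, transfer, ih]; ring

theorem integrableOn_cocycle (ω : Ω) (n : ℕ) (h : IntegrableOn φ (Ioc 0 1)) :
    IntegrableOn (cocycle σ β ω n φ) (Ioc 0 1) := by
  induction n with
  | zero => exact h
  | succ n ih => exact integrableOn_transfer (β _).2.1.le ih

theorem integral_cocycle (ω : Ω) (n : ℕ) (h : IntegrableOn φ (Ioc 0 1)) :
    ∫ x in Ioc 0 1, cocycle σ β ω n φ x = ∫ x in Ioc 0 1, φ x := by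
  induction n with
  | zero => rfl
  | succ n ih => rw [cocycle, integral_transfer (β _).2.1.le (integrableOn_cocycle ω n h), ih]

/-- The transfer operators are contractions of `L¹`. -/
theorem integral_abs_cocycle_le (ω : Ω) (n : ℕ) (h : IntegrableOn φ (Ioc 0 1)) :
    ∫ x in Ioc 0 1, |cocycle σ β ω n φ x| ≤ ∫ x in Ioc 0 1, |φ x| := by
  rw [← integral_cocycle (σ := σ) (β := β) ω n h.abs]
  refine setIntegral_mono_on (integrableOn_cocycle ω n h).abs (integrableOn_cocycle ω n h.abs)
    measurableSet_Ioc fun x hx => ?_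
  have h1 := cocycle_mono (σ := σ) (β := β) ω n (φ := φ) (ψ := fun x => |φ x|)
    (fun x _ => le_abs_self _) x hx
  have h2 := cocycle_mono (σ := σ) (β := β) ω n (φ := fun x => -|φ x|) (ψ := φ)
    (fun x _ => neg_abs_le _) x hx
  have h3 := cocycle_sub (σ := σ) (β := β) ω n (fun _ => 0) (fun x => |φ x|) x
  have h4 := cocycle_sub (σ := σ) (β := β) ω n (fun _ => 0) (fun _ => 0) x
  simp only [zero_sub, sub_self] at h3 h4
  rw [abs_le]
  constructor <;> linarith

theorem mapsTo_cocycle {K : Set (ℝ → ℝ)}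
    (hK : ∀ γ : ℝ, 0 < γ → γ ≤ α → MapsTo (transfer γ) K K) {ω : Ω}
    (hω : ∀ n, (β (σ^[n] ω) : ℝ) ≤ α) (n : ℕ) : MapsTo (cocycle σ β ω n) K K := by
  intro φ hφ
  induction n with
  | zero => exact hφ
  | succ n ih => exact hK _ (β _).2.1 (hω n) ih

end Cocycle

/-! ### Growth of intervals

A nonnegative function that is bounded below on an interval is bounded below on `(0, 1)` after a
number of steps that depends on the length of the interval only. -/

section Growth

variable {γ c : ℝ} {f : ℝ → ℝ}

/-- A lower bound on an interval in the domain of the first branch is inherited by the image, up to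
the maximal slope `3`. -/
theorem le_transfer_of_le_left (hγ : 0 ≤ γ) (hγ1 : γ ≤ 1) (hf : ∀ x ∈ Ioc (0 : ℝ) 1, 0 ≤ f x)
    {p q : ℝ} (hp : 0 ≤ p) (hpq : p ≤ q) (hq : q ≤ 1 / 2) (h : ∀ x ∈ Ioo p q, c ≤ f x) :
    ∀ x ∈ Ioo (branch γ p) (branch γ q), c / 3 ≤ transfer γ f x := by
  intro x hx
  have hp' := branch_mem_Icc hγ (y := p) ⟨hp, hpq.trans hq⟩
  have hq' := branch_mem_Icc hγ (y := q) ⟨hp.trans hpq, hq⟩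
  have hxI : x ∈ Ioc (0 : ℝ) 1 := ⟨hp'.1.trans_lt hx.1, hx.2.le.trans hq'.2⟩
  have hx' : x ∈ Icc (0 : ℝ) 1 := ⟨hxI.1.le, hxI.2⟩
  have hy : branchInv γ x ∈ Ioo p q :=
    ⟨(lt_branchInv_iff hγ hx' hp).2 hx.1, (branchInv_lt_iff hγ hx' (hp.trans hpq)).2 hx.2⟩
  have h1 := h _ hy
  have h2 := hf _ (half_mem_Ioc hxI)
  have hy2 := branchInv_mem hγ hxI
  have h3 := slope_pos hγ hy2.1.le
  have h4 := slope_le_three hγ hγ1 hy2.1.le hy2.2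
  have h5 := hf _ (branchInv_mem_Ioc hγ hxI)
  rw [transfer_eq hγ _ hxI, ← div_eq_mul_inv]
  have h6 : f (branchInv γ x) / 3 ≤ f (branchInv γ x) / slope γ (branchInv γ x) := by gcongr
  linarith

/-- A lower bound on an interval in the domain of the second branch is inherited by the image. The
factor `1 / 3` is not sharp here; it is the one of the first branch. -/
theorem le_transfer_of_le_right (hγ : 0 ≤ γ) (hc : 0 ≤ c) (hf : ∀ x ∈ Ioc (0 : ℝ) 1, 0 ≤ f x)
    {p q : ℝ} (hp : 1 / 2 ≤ p) (hq : q ≤ 1) (h : ∀ x ∈ Ioo p q, c ≤ f x) :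
    ∀ x ∈ Ioo (2 * p - 1) (2 * q - 1), c / 3 ≤ transfer γ f x := by
  intro x hx
  have hxI : x ∈ Ioc (0 : ℝ) 1 := ⟨by linarith [hx.1], by linarith [hx.2]⟩
  have h1 := h ((x + 1) / 2) ⟨by linarith [hx.1], by linarith [hx.2]⟩
  have h3 := slope_pos hγ (branchInv_pos hγ hxI).le
  have h5 := hf _ (branchInv_mem_Ioc hγ hxI)
  rw [transfer_eq hγ _ hxI, ← div_eq_mul_inv]
  have h6 : 0 ≤ f (branchInv γ x) / slope γ (branchInv γ x) := by positivity
  linarith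

theorem branch_sub_ge (hγ : 0 ≤ γ) (hγ1 : γ ≤ 1) {p q : ℝ} (hp : 0 ≤ p) (hpq : p ≤ q)
    (hq : q ≤ 1 / 2) : (q - p) + 2 * (q - p) ^ 2 ≤ branch γ q - branch γ p := by
  have h1 := branch_sub_le hγ hp hpq
  have h2 := le_pw hγ1 (hp.trans hpq) hq
  nlinarith

/-- One step for an interval that touches an end point of `[0, 1]`: the new interval touches the
same end point and has gained `l ^ 2` in length, unless it is all of `(0, 1)`. -/
theorem endInterval_step (hγ : 0 ≤ γ) (hγ1 : γ ≤ 1) (hc : 0 ≤ c)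
    (hf : ∀ x ∈ Ioc (0 : ℝ) 1, 0 ≤ f x) {l p q : ℝ} (hl : 0 < l) (hp : 0 ≤ p) (hq : q ≤ 1)
    (hlpq : l ≤ q - p) (hend : p = 0 ∨ q = 1) (h : ∀ x ∈ Ioo p q, c ≤ f x) :
    ∃ p' q', 0 ≤ p' ∧ q' ≤ 1 ∧ (p' = 0 ∨ q' = 1) ∧ l ≤ q' - p' ∧
      min 1 (q - p + l ^ 2) ≤ q' - p' ∧ ∀ x ∈ Ioo p' q', c / 3 ≤ transfer γ f x := by
  have hl2 : l ^ 2 ≤ (q - p) ^ 2 := by gcongr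
  have hl1 : l ≤ 1 := by linarith
  rcases hend with rfl | rfl
  · rcases le_total q (1 / 2) with hq2 | hq2
    · have hg := branch_sub_ge hγ hγ1 hp (by linarith : (0 : ℝ) ≤ q) hq2
      rw [branch_zero] at hg
      refine ⟨0, branch γ q, le_rfl, (branch_mem_Icc hγ ⟨by linarith, hq2⟩).2, Or.inl rfl,
        by nlinarith, (min_le_right _ _).trans (by nlinarith), ?_⟩
      have := le_transfer_of_le_left hγ hγ1 hf le_rfl (by linarith : (0 : ℝ) ≤ q) hq2 h
      rwa [branch_zero] at this
    · refine ⟨0, 1, le_rfl, le_rfl, Or.inl rfl, by linarith, by simp, ?_⟩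
      have := le_transfer_of_le_left hγ hγ1 hf le_rfl (by norm_num : (0 : ℝ) ≤ 1 / 2) le_rfl
        fun x hx => h x ⟨hx.1, hx.2.trans_le hq2⟩
      rwa [branch_zero, branch_half] at this
  · rcases le_total (1 / 2) p with hp2 | hp2
    · have := le_transfer_of_le_right hγ hc hf hp2 le_rfl h
      refine ⟨2 * p - 1, 1, by linarith, le_rfl, Or.inr rfl, by linarith,
        (min_le_right _ _).trans (by nlinarith), ?_⟩
      convert this using 3; norm_num
    · have := le_transfer_of_le_right hγ hc hf le_rfl le_rfl
        fun x hx => h x ⟨hp2.trans_lt hx.1, hx.2⟩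
      refine ⟨0, 1, le_rfl, le_rfl, Or.inr rfl, by linarith, by simp, ?_⟩
      convert this using 3; norm_num

/-- One step for an arbitrary interval: it gains `l ^ 2` in length, unless it contains `1 / 2`, in
which case it is replaced by an interval that touches an end point of `[0, 1]`. -/
theorem interval_step (hγ : 0 ≤ γ) (hγ1 : γ ≤ 1) (hc : 0 ≤ c)
    (hf : ∀ x ∈ Ioc (0 : ℝ) 1, 0 ≤ f x) {l p q : ℝ} (hl : 0 < l) (hp : 0 ≤ p) (hq : q ≤ 1)
    (hlpq : l ≤ q - p) (h : ∀ x ∈ Ioo p q, c ≤ f x) :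
    ∃ p' q', 0 ≤ p' ∧ q' ≤ 1 ∧ l ≤ q' - p' ∧
      (p' = 0 ∨ q' = 1 ∨ q - p + l ^ 2 ≤ q' - p') ∧
      ∀ x ∈ Ioo p' q', c / 3 ≤ transfer γ f x := by
  have hl2 : l ^ 2 ≤ (q - p) ^ 2 := by gcongr
  rcases le_total q (1 / 2) with hq2 | hq2
  · have hg := branch_sub_ge hγ hγ1 hp (by linarith : p ≤ q) hq2
    exact ⟨branch γ p, branch γ q, (branch_mem_Icc hγ ⟨hp, by linarith⟩).1,
      (branch_mem_Icc hγ ⟨by linarith, hq2⟩).2, by nlinarith, Or.inr (Or.inr (by nlinarith)),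
      le_transfer_of_le_left hγ hγ1 hf hp (by linarith) hq2 h⟩
  rcases le_total (1 / 2) p with hp2 | hp2
  · exact ⟨2 * p - 1, 2 * q - 1, by linarith, by linarith, by linarith,
      Or.inr (Or.inr (by nlinarith)), le_transfer_of_le_right hγ hc hf hp2 hq h⟩
  -- the longer of the two parts on either side of `1 / 2` is stretched by a factor of at least `2`,
  -- and its image touches an end point
  rcases le_total ((q - p) / 2) (q - 1 / 2) with h2 | h2
  · have := le_transfer_of_le_right hγ hc hf le_rfl hq fun x hx => h x ⟨hp2.trans_lt hx.1, hx.2⟩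
    refine ⟨0, 2 * q - 1, le_rfl, by linarith, by linarith, Or.inl rfl, ?_⟩
    convert this using 3; norm_num
  · have := le_transfer_of_le_left hγ hγ1 hf hp hp2 le_rfl
      fun x hx => h x ⟨hx.1, hx.2.trans_le hq2⟩
    have hg := branch_sub_le hγ hp hp2
    have hpw : pw γ (1 / 2) = 1 := by rw [pw_eq (by norm_num)]; norm_num
    rw [branch_half, hpw] at hg
    rw [branch_half] at this
    exact ⟨branch γ p, 1, (branch_mem_Icc hγ ⟨hp, hp2⟩).1, le_rfl, by linarith,
      Or.inr (Or.inl rfl), this⟩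

variable {Ω : Type*} {σ : Ω → Ω} {β : Ω → Ioo (0 : ℝ) 1}

/-- Here `j` bounds the number of steps in which an interval that touches an end point of `[0, 1]`
grows to `(0, 1)`; the lower bound persists in all later steps. -/
theorem le_cocycle_of_endInterval {l : ℝ} (hl : 0 < l) (j : ℕ) :
    ∀ n, j ≤ n → ∀ (ω : Ω) (f : ℝ → ℝ) (c p q : ℝ), 0 ≤ c → (∀ x ∈ Ioc (0 : ℝ) 1, 0 ≤ f x) →
      0 ≤ p → q ≤ 1 → l ≤ q - p → (p = 0 ∨ q = 1) → 1 - j * l ^ 2 ≤ q - p →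
      (∀ x ∈ Ioo p q, c ≤ f x) → ∀ x ∈ Ioo (0 : ℝ) 1, c / 3 ^ n ≤ cocycle σ β ω n f x := by
  induction j with
  | zero =>
    intro n _
    induction n with
    | zero =>
      intro ω f c p q _ _ hp hq _ _ h1 h x hx
      norm_num at h1
      simpa [cocycle] using h x ⟨by linarith [hx.1], by linarith [hx.2]⟩
    | succ n ih =>
      intro ω f c p q hc hf hp hq hlpq hend h1 h
      obtain ⟨p', q', hp', hq', hend', hl', hgrow, h'⟩ :=
        endInterval_step (β ω).2.1.le (β ω).2.2.le hc hf hl hp hq hlpq hend h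
      have hmin : (1 : ℝ) ≤ min 1 (q - p + l ^ 2) := by
        norm_num at h1
        exact le_min le_rfl (by nlinarith)
      intro x hx
      have := ih n.zero_le (σ ω) _ (c / 3) p' q' (by positivity)
        (fun x hx => transfer_nonneg (β ω).2.1.le hf hx) hp' hq' hl' hend' (by
          norm_num; linarith) h' x hx
      rw [cocycle_succ']
      rwa [div_div, ← pow_succ'] at this
  | succ j ihj =>
    intro n hn ω f c p q hc hf hp hq hlpq hend h1 h x hx
    obtain ⟨n, rfl⟩ : ∃ k, n = k + 1 := ⟨n - 1, by omega⟩
    obtain ⟨p', q', hp', hq', hend', hl', hgrow, h'⟩ :=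
      endInterval_step (β ω).2.1.le (β ω).2.2.le hc hf hl hp hq hlpq hend h
    have hmin : 1 - j * l ^ 2 ≤ min 1 (q - p + l ^ 2) := by
      push_cast at h1
      refine le_min ?_ (by linarith)
      have : 0 ≤ (j : ℝ) * l ^ 2 := by positivity
      linarith
    have := ihj n (by omega) (σ ω) _ (c / 3) p' q' (by positivity)
      (fun x hx => transfer_nonneg (β ω).2.1.le hf hx) hp' hq' hl' hend' (hmin.trans hgrow) h' x hx
    rw [cocycle_succ']
    rwa [div_div, ← pow_succ'] at this

/-- An interval grows for at most `j` steps until it contains `1 / 2`, and then for at most `M`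
steps from an end point of `[0, 1]`. -/
theorem le_cocycle_of_interval_aux {l : ℝ} (hl : 0 < l) {M : ℕ} (hM : 1 ≤ M * l ^ 2) (j : ℕ) :
    ∀ n, j + M ≤ n → ∀ (ω : Ω) (f : ℝ → ℝ) (c p q : ℝ), 0 ≤ c →
      (∀ x ∈ Ioc (0 : ℝ) 1, 0 ≤ f x) →
      0 ≤ p → q ≤ 1 → l ≤ q - p → 1 - j * l ^ 2 ≤ q - p →
      (∀ x ∈ Ioo p q, c ≤ f x) → ∀ x ∈ Ioo (0 : ℝ) 1, c / 3 ^ n ≤ cocycle σ β ω n f x := by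
  induction j with
  | zero =>
    intro n hn ω f c p q hc hf hp hq hlpq h1 h
    norm_num at h1
    exact le_cocycle_of_endInterval hl 0 n n.zero_le ω f c p q hc hf hp hq hlpq
      (Or.inl (by linarith)) (by simpa using h1) h
  | succ j ihj =>
    intro n hn ω f c p q hc hf hp hq hlpq h1 h x hx
    obtain ⟨n, rfl⟩ : ∃ k, n = k + 1 := ⟨n - 1, by omega⟩
    obtain ⟨p', q', hp', hq', hl', halt, h'⟩ :=
      interval_step (β ω).2.1.le (β ω).2.2.le hc hf hl hp hq hlpq h
    have hf' : ∀ x ∈ Ioc (0 : ℝ) 1, 0 ≤ transfer (β ω) f x :=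
      fun x hx => transfer_nonneg (β ω).2.1.le hf hx
    have hend : p' = 0 ∨ q' = 1 → c / 3 / 3 ^ n ≤ cocycle σ β (σ ω) n (transfer (β ω) f) x :=
      fun he => le_cocycle_of_endInterval hl M n (by omega) (σ ω) _ (c / 3) p' q' (by positivity)
        hf' hp' hq' hl' he (by linarith) h' x hx
    have : c / 3 / 3 ^ n ≤ cocycle σ β (σ ω) n (transfer (β ω) f) x := by
      rcases halt with he | he | he
      · exact hend (Or.inl he)
      · exact hend (Or.inr he)
      · push_cast at h1
        exact ihj n (by omega) (σ ω) _ (c / 3) p' q' (by positivity) hf' hp' hq' hl'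
          (by linarith) h' x hx
    rw [cocycle_succ']
    rwa [div_div, ← pow_succ'] at this

variable (σ β) in
/-- Uniform covering: a lower bound on an interval of length `l` spreads to all of `(0, 1)` in a
number of steps that depends on `l` only. -/
theorem exists_le_cocycle_of_interval {l : ℝ} (hl : 0 < l) :
    ∃ N : ℕ, ∀ (ω : Ω) (f : ℝ → ℝ) (c p q : ℝ), 0 ≤ c → (∀ x ∈ Ioc (0 : ℝ) 1, 0 ≤ f x) →
      0 ≤ p → q ≤ 1 → l ≤ q - p →
      (∀ x ∈ Ioo p q, c ≤ f x) → ∀ x ∈ Ioo (0 : ℝ) 1, c / 3 ^ N ≤ cocycle σ β ω N f x := by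
  obtain ⟨M, hM⟩ := exists_nat_ge (1 / l ^ 2)
  rw [div_le_iff₀ (by positivity)] at hM
  exact ⟨M + M, fun ω f c p q hc hf hp hq hlpq h =>
    le_cocycle_of_interval_aux hl hM M (M + M) le_rfl ω f c p q hc hf hp hq hlpq (by linarith) h⟩

end Growth

/-! ### Loss of memory -/

section MemoryLoss

variable {α a : ℝ} {φ ψ : ℝ → ℝ}

theorem coneStar_le_rpow (hφ : φ ∈ coneStar α a) (hm : ∫ t in Ioc 0 1, φ t = 1) {x : ℝ}
    (hx : x ∈ Ioc (0 : ℝ) 1) : φ x ≤ a * x ^ (-α) := by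
  have h1 := (coneStar_mul_le hφ hx).trans (coneStar_setIntegral_le hφ hx)
  have hx0 := hx.1
  rw [hm, mul_one, sub_eq_add_neg, Real.rpow_add hx0, Real.rpow_one] at h1
  refine le_of_mul_le_mul_left ?_ hx0
  linarith

theorem coneStar_mul_le_const (hα1 : α < 1) (ha : 0 ≤ a) (hφ : φ ∈ coneStar α a)
    (hm : ∫ t in Ioc 0 1, φ t = 1) {x : ℝ} (hx : x ∈ Ioc (0 : ℝ) 1) : x * φ x ≤ a := by
  have h1 := (coneStar_mul_le hφ hx).trans (coneStar_setIntegral_le hφ hx)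
  rw [hm, mul_one] at h1
  have h2 : x ^ (1 - α) ≤ 1 := Real.rpow_le_one hx.1.le hx.2 (by linarith)
  nlinarith

/-- Normalized functions in the cone are Lipschitz on `[δ, 1]`, with a constant that depends on
`δ` only. -/
theorem coneStar_sub_le (hα1 : α < 1) (ha : 0 ≤ a) (hφ : φ ∈ coneStar α a)
    (hm : ∫ t in Ioc 0 1, φ t = 1) {δ t x : ℝ} (hδ : 0 < δ) (hδt : δ ≤ t) (htx : t ≤ x)
    (hx1 : x ≤ 1) : φ t - φ x ≤ 2 * a / δ ^ 2 * (x - t) := by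
  have ht0 : 0 < t := hδ.trans_le hδt
  have hx0 : 0 < x := ht0.trans_le htx
  have hx : x ∈ Ioc (0 : ℝ) 1 := ⟨hx0, hx1⟩
  have ht : t ∈ Ioc (0 : ℝ) 1 := ⟨ht0, htx.trans hx1⟩
  have hφx := hφ.2.2.1 x hx
  have h1 : t ^ (α + 1) * φ t ≤ x ^ (α + 1) * φ x := hφ.2.2.2.2.1 ht hx htx
  have h2 := coneStar_mul_le_const hα1 ha hφ hm hx
  have hr : 1 ≤ x / t := (one_le_div ht0).2 htx
  have h3 : φ t ≤ (x / t) ^ (2 : ℕ) * φ x := by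
    have h4 : (x / t) ^ (α + 1) ≤ (x / t) ^ (2 : ℕ) := by
      rw [← Real.rpow_natCast]
      exact Real.rpow_le_rpow_of_exponent_le hr (by push_cast; linarith)
    refine le_trans ?_ (mul_le_mul_of_nonneg_right h4 hφx)
    rw [Real.div_rpow hx0.le ht0.le, div_mul_eq_mul_div, le_div_iff₀ (by positivity)]
    linarith
  have hxt : 0 ≤ x - t := sub_nonneg.2 htx
  have h5 : (x + t) * φ x ≤ 2 * a := by nlinarith
  calc φ t - φ x ≤ (x / t) ^ 2 * φ x - φ x := by linarith
    _ = (x - t) * ((x + t) * φ x) / t ^ 2 := by field_simp; ring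
    _ ≤ (x - t) * (2 * a) / t ^ 2 := by
        gcongr
    _ ≤ (x - t) * (2 * a) / δ ^ 2 := by gcongr
    _ = _ := by ring

/-- If two normalized functions in the cone are at `L¹` distance at least `ε`, then the first one
exceeds the second one by `ε / 8` on an interval whose length is bounded below. -/
theorem exists_interval_of_le_integral_abs_sub (hα1 : α < 1) (ha : 0 < a) {ε : ℝ} (hε : 0 < ε) :
    ∃ l > 0, ∀ φ ∈ coneStar α a, ∀ ψ ∈ coneStar α a, ∫ t in Ioc 0 1, φ t = 1 →
      ∫ t in Ioc 0 1, ψ t = 1 → ε ≤ ∫ t in Ioc 0 1, |φ t - ψ t| →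
      ∃ p q, 0 ≤ p ∧ q ≤ 1 ∧ l ≤ q - p ∧ ∀ x ∈ Ioo p q, ε / 8 ≤ φ x - ψ x := by
  -- `δ` is chosen such that the mass near the neutral fixed point is negligible
  have hpos : 0 < 1 - α := by linarith
  obtain ⟨δ, hδ0, hδ1, hδ⟩ : ∃ δ : ℝ, 0 < δ ∧ δ < 1 ∧ a * δ ^ (1 - α) ≤ ε / 8 := by
    have ht : Tendsto (fun δ : ℝ => a * δ ^ (1 - α)) (𝓝[>] 0) (𝓝 0) := by
      have h := ((Real.continuousAt_rpow_const 0 (1 - α) (Or.inr hpos.le)).tendsto.const_mul a)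
      rw [Real.zero_rpow hpos.ne', mul_zero] at h
      exact h.mono_left nhdsWithin_le_nhds
    have h1 := ht.eventually_le_const (by positivity : (0 : ℝ) < ε / 8)
    have h2 : ∀ᶠ δ : ℝ in 𝓝[>] 0, δ < 1 :=
      nhdsWithin_le_nhds (gt_mem_nhds one_pos)
    obtain ⟨δ, ⟨h1, h2⟩, h3⟩ := ((h1.and h2).and self_mem_nhdsWithin).exists
    exact ⟨δ, h3, h2, h1⟩
  set C := 2 * a / (δ / 2) ^ 2 with hC
  have hC0 : 0 < C := by positivity
  refine ⟨min (δ / 2) (ε / 8 / C), by positivity, fun φ hφ ψ hψ hm hm' hle => ?_⟩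
  set l := min (δ / 2) (ε / 8 / C) with hl
  have hl0 : 0 < l := by positivity
  have hiφ := hφ.2.1
  have hiψ := hψ.2.1
  have hi : IntegrableOn (fun t => φ t - ψ t) (Ioc 0 1) := hiφ.sub hiψ
  -- the positive part of `φ - ψ` carries half of the distance
  have hplus : ε / 2 ≤ ∫ t in Ioc 0 1, max (φ t - ψ t) 0 := by
    have h1 : ∫ t in Ioc 0 1, max (φ t - ψ t) 0 =
        ((∫ t in Ioc 0 1, |φ t - ψ t|) + ∫ t in Ioc 0 1, (φ t - ψ t)) / 2 := by
      rw [← integral_add hi.abs hi, ← integral_div]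
      refine integral_congr_ae (Eventually.of_forall fun t => ?_)
      simp only
      rcases le_total (φ t - ψ t) 0 with h | h
      · rw [max_eq_right h, abs_of_nonpos h]; ring
      · rw [max_eq_left h, abs_of_nonneg h]; ring
    rw [h1, integral_sub hiφ hiψ, hm, hm']
    linarith
  have hipos : IntegrableOn (fun t => max (φ t - ψ t) 0) (Ioc 0 1) := hi.pos_part
  have hδI : δ ∈ Ioc (0 : ℝ) 1 := ⟨hδ0, hδ1.le⟩
  obtain ⟨x, hx, hfx⟩ : ∃ x ∈ Ioc δ 1, ε / 4 ≤ φ x - ψ x := by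
    by_contra! hcon
    have hsub1 : Ioc 0 δ ⊆ Ioc (0 : ℝ) 1 := Ioc_subset_Ioc_right hδ1.le
    have hsub2 : Ioc δ 1 ⊆ Ioc (0 : ℝ) 1 := Ioc_subset_Ioc_left hδ0.le
    have hsplit : ∫ t in Ioc 0 1, max (φ t - ψ t) 0 =
        (∫ t in Ioc 0 δ, max (φ t - ψ t) 0) + ∫ t in Ioc δ 1, max (φ t - ψ t) 0 := by
      rw [← setIntegral_union (Ioc_disjoint_Ioc_of_le le_rfl) measurableSet_Ioc
        (hipos.mono_set hsub1) (hipos.mono_set hsub2), Ioc_union_Ioc_eq_Ioc hδ0.le hδ1.le]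
    have h1 : ∫ t in Ioc 0 δ, max (φ t - ψ t) 0 ≤ ε / 8 := by
      have h2 := coneStar_setIntegral_le hφ hδI
      rw [hm, mul_one] at h2
      refine le_trans ?_ (h2.trans hδ)
      refine setIntegral_mono_on (hipos.mono_set hsub1) (hiφ.mono_set hsub1) measurableSet_Ioc
        fun t ht => ?_
      have h3 := hφ.2.2.1 t (hsub1 ht)
      have h4 := hψ.2.2.1 t (hsub1 ht)
      exact max_le (by linarith) h3
    have h2 : ∫ t in Ioc δ 1, max (φ t - ψ t) 0 ≤ ε / 4 := by
      have h3 := setIntegral_mono_on (g := fun _ => ε / 4) (hipos.mono_set hsub2) (by simp)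
        measurableSet_Ioc fun t ht => max_le (hcon t ht).le (by positivity)
      refine h3.trans ?_
      simp only [integral_const, smul_eq_mul, measureReal_restrict_apply_univ]
      rw [Real.volume_real_Ioc_of_le hδ1.le]
      nlinarith
    linarith
  have hl1 : l ≤ δ / 2 := min_le_left _ _
  have hl2 : C * l ≤ ε / 8 := by
    have : l ≤ ε / 8 / C := min_le_right _ _
    rw [le_div_iff₀ hC0] at this
    linarith
  refine ⟨x - l, x, by linarith [hx.1], hx.2, by linarith, fun t ht => ?_⟩
  have htI : t ∈ Ioc (0 : ℝ) 1 := ⟨by linarith [ht.1, hx.1], ht.2.le.trans hx.2⟩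
  have h1 : φ x ≤ φ t := hφ.2.2.2.1 htI ⟨hδ0.trans hx.1, hx.2⟩ ht.2.le
  have h2 := coneStar_sub_le hα1 ha.le hψ hm' (δ := δ / 2) (t := t) (x := x) (by positivity)
    (by linarith [ht.1, hx.1]) ht.2.le hx.2
  rw [← hC] at h2
  have h3 : C * (x - t) ≤ C * l := by
    gcongr; linarith [ht.1]
  linarith

variable {Ω : Type*}

theorem integral_abs_cocycle_sub_le {σ : Ω → Ω} {β : Ω → Ioo (0 : ℝ) 1} (ω : Ω) (n : ℕ)
    (hφ : IntegrableOn φ (Ioc 0 1)) (hψ : IntegrableOn ψ (Ioc 0 1)) :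
    ∫ x in Ioc 0 1, |cocycle σ β ω n φ x - cocycle σ β ω n ψ x| ≤
      ∫ x in Ioc 0 1, |φ x - ψ x| := by
  simpa only [cocycle_sub] using
    integral_abs_cocycle_le (σ := σ) (β := β) (φ := fun x => φ x - ψ x) ω n (hφ.sub hψ)

/-- Functions with lower bounds on intervals, pushed forward, have a common part, which cancels. -/
theorem integral_abs_sub_le_of_le {A B : ℝ → ℝ} {c : ℝ} (hA : IntegrableOn A (Ioc 0 1))
    (hB : IntegrableOn B (Ioc 0 1)) (hcA : ∀ x ∈ Ioo (0 : ℝ) 1, c ≤ A x)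
    (hcB : ∀ x ∈ Ioo (0 : ℝ) 1, c ≤ B x) :
    ∫ x in Ioc 0 1, |A x - B x| ≤ (∫ x in Ioc 0 1, A x) + (∫ x in Ioc 0 1, B x) - 2 * c := by
  have hAB := hA.add hB
  have hc : IntegrableOn (fun _ : ℝ => 2 * c) (Ioc 0 1) := integrable_const _
  have h : (∫ x in Ioc 0 1, A x) + (∫ x in Ioc 0 1, B x) - 2 * c =
      ∫ x in Ioo 0 1, (A x + B x - 2 * c) := by
    rw [← integral_Ioc_eq_integral_Ioo]
    have h1 : ∫ x in Ioc 0 1, (A x + B x - 2 * c) =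
        (∫ x in Ioc 0 1, (A x + B x)) - ∫ _ in Ioc (0 : ℝ) 1, 2 * c := integral_sub hAB hc
    rw [h1, integral_add hA hB]
    simp
  rw [h, integral_Ioc_eq_integral_Ioo]
  have hd : IntegrableOn (fun x => |A x - B x|) (Ioc 0 1) := (hA.sub hB).abs
  refine setIntegral_mono_on (hd.mono_set Ioo_subset_Ioc_self)
    ((hAB.sub hc).mono_set Ioo_subset_Ioc_self) measurableSet_Ioo fun x hx => ?_
  have h1 := hcA x hx
  have h2 := hcB x hx
  rw [abs_le]
  constructor <;> linarith

/-- Positive and negative parts of a difference, both pushed forward to `(0, 1)`, cancel a definite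
amount. -/
theorem exists_integral_abs_cocycle_le (σ : Ω → Ω) (β : Ω → Ioo (0 : ℝ) 1) (hα1 : α < 1)
    (ha : 0 < a) {ε : ℝ} (hε : 0 < ε) :
    ∃ c > 0, ∃ N : ℕ, ∀ ω, ∀ φ ∈ coneStar α a, ∀ ψ ∈ coneStar α a, ∫ t in Ioc 0 1, φ t = 1 →
      ∫ t in Ioc 0 1, ψ t = 1 → ε ≤ ∫ t in Ioc 0 1, |φ t - ψ t| →
      ∫ t in Ioc 0 1, |cocycle σ β ω N φ t - cocycle σ β ω N ψ t| ≤
        (∫ t in Ioc 0 1, |φ t - ψ t|) - c := by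
  obtain ⟨l, hl, H⟩ := exists_interval_of_le_integral_abs_sub (a := a) hα1 ha hε
  obtain ⟨N, hN⟩ := exists_le_cocycle_of_interval σ β hl
  refine ⟨2 * (ε / 8 / 3 ^ N), by positivity, N, fun ω φ hφ ψ hψ hm hm' hle => ?_⟩
  have hi : IntegrableOn (fun t => φ t - ψ t) (Ioc 0 1) := hφ.2.1.sub hψ.2.1
  have hi' : IntegrableOn (fun t => ψ t - φ t) (Ioc 0 1) := hψ.2.1.sub hφ.2.1
  set A : ℝ → ℝ := fun t => max (φ t - ψ t) 0 with hA
  set B : ℝ → ℝ := fun t => max (ψ t - φ t) 0 with hB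
  have hiA : IntegrableOn A (Ioc 0 1) := hi.pos_part
  have hiB : IntegrableOn B (Ioc 0 1) := hi'.pos_part
  obtain ⟨p, q, hp, hq, hpq, h⟩ := H φ hφ ψ hψ hm hm' hle
  obtain ⟨p', q', hp', hq', hpq', h'⟩ := H ψ hψ φ hφ hm' hm (by simpa only [abs_sub_comm] using hle)
  have kA := hN ω A (ε / 8) p q (by positivity) (fun x _ => le_max_right _ _) hp hq hpq
    fun x hx => (h x hx).trans (le_max_left _ _)
  have kB := hN ω B (ε / 8) p' q' (by positivity) (fun x _ => le_max_right _ _) hp' hq' hpq'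
    fun x hx => (h' x hx).trans (le_max_left _ _)
  have key := integral_abs_sub_le_of_le (integrableOn_cocycle ω N hiA)
    (integrableOn_cocycle ω N hiB) kA kB
  rw [integral_cocycle ω N hiA, integral_cocycle ω N hiB, ← integral_add hiA hiB] at key
  have e1 : ∀ t, |φ t - ψ t| = A t + B t := fun t => by
    simp only [hA, hB]
    rcases le_total (φ t) (ψ t) with h | h
    · rw [max_eq_right (sub_nonpos.2 h), max_eq_left (sub_nonneg.2 h),
        abs_of_nonpos (sub_nonpos.2 h)]; ring
    · rw [max_eq_left (sub_nonneg.2 h), max_eq_right (sub_nonpos.2 h),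
        abs_of_nonneg (sub_nonneg.2 h)]; ring
  have e2 : ∀ t, φ t - ψ t = A t - B t := fun t => by
    simp only [hA, hB]
    rcases le_total (φ t) (ψ t) with h | h
    · rw [max_eq_right (sub_nonpos.2 h), max_eq_left (sub_nonneg.2 h)]; ring
    · rw [max_eq_left (sub_nonneg.2 h), max_eq_right (sub_nonpos.2 h)]; ring
  have e3 : ∀ t, cocycle σ β ω N φ t - cocycle σ β ω N ψ t =
      cocycle σ β ω N A t - cocycle σ β ω N B t := fun t => by
    rw [← cocycle_sub, ← cocycle_sub]
    simp only [e2]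
  simp only [e1, e3]
  exact key

/-- Loss of memory: along the cocycle, the `L¹` distance of normalized functions in the cone tends
to zero, uniformly in the functions and in the orbit of parameters. -/
theorem exists_integral_abs_cocycle_sub_lt (σ : Ω → Ω) (β : Ω → Ioo (0 : ℝ) 1)
    (hα1 : α < 1) (ha : 0 < a)
    (hK : ∀ γ : ℝ, 0 < γ → γ ≤ α → MapsTo (transfer γ) (coneStar α a) (coneStar α a))
    {ε : ℝ} (hε : 0 < ε) :
    ∃ N : ℕ, ∀ n ≥ N, ∀ ω, (∀ n, (β (σ^[n] ω) : ℝ) ≤ α) → ∀ φ ∈ coneStar α a, ∀ ψ ∈ coneStar α a,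
      ∫ t in Ioc 0 1, φ t = 1 → ∫ t in Ioc 0 1, ψ t = 1 →
      ∫ t in Ioc 0 1, |cocycle σ β ω n φ t - cocycle σ β ω n ψ t| < ε := by
  obtain ⟨c, hc, N, hN⟩ := exists_integral_abs_cocycle_le (a := a) σ β hα1 ha hε
  -- as long as the distance is at least `ε`, it decreases by `c` every `N` steps
  have key : ∀ k : ℕ, ∀ ω, (∀ n, (β (σ^[n] ω) : ℝ) ≤ α) → ∀ φ ∈ coneStar α a,
      ∀ ψ ∈ coneStar α a, ∫ t in Ioc 0 1, φ t = 1 → ∫ t in Ioc 0 1, ψ t = 1 →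
      ε ≤ ∫ t in Ioc 0 1, |cocycle σ β ω (k * N) φ t - cocycle σ β ω (k * N) ψ t| →
      ∫ t in Ioc 0 1, |cocycle σ β ω (k * N) φ t - cocycle σ β ω (k * N) ψ t| ≤ 2 - k * c := by
    intro k
    induction k with
    | zero =>
      intro ω hω φ hφ ψ hψ hm hm' hle
      simp only [cocycle, Nat.cast_zero, zero_mul, sub_zero]
      calc ∫ t in Ioc 0 1, |φ t - ψ t| ≤ ∫ t in Ioc 0 1, (φ t + ψ t) := by
            refine setIntegral_mono_on (hφ.2.1.sub hψ.2.1).abs (hφ.2.1.add hψ.2.1)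
              measurableSet_Ioc fun x hx => ?_
            have h1 := hφ.2.2.1 x hx
            have h2 := hψ.2.2.1 x hx
            rw [abs_le]
            constructor <;> linarith
        _ = 2 := by rw [integral_add hφ.2.1 hψ.2.1, hm, hm']; norm_num
    | succ k ih =>
      intro ω hω φ hφ ψ hψ hm hm' hle
      have hadd : ∀ φ, cocycle σ β ω ((k + 1) * N) φ =
          cocycle σ β (σ^[k * N] ω) N (cocycle σ β ω (k * N) φ) := fun φ => by
        rw [Nat.succ_mul, cocycle_add]
      rw [hadd, hadd] at hle ⊢
      have hφ' := mapsTo_cocycle hK hω (k * N) hφ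
      have hψ' := mapsTo_cocycle hK hω (k * N) hψ
      have hle' : ε ≤ ∫ t in Ioc 0 1, |cocycle σ β ω (k * N) φ t - cocycle σ β ω (k * N) ψ t| := by
        refine hle.trans ?_
        exact integral_abs_cocycle_sub_le (σ^[k * N] ω) N hφ'.2.1 hψ'.2.1
      have h1 := ih ω hω φ hφ ψ hψ hm hm' hle'
      have h2 := hN (σ^[k * N] ω) _ hφ' _ hψ'
        (by rw [integral_cocycle ω _ hφ.2.1, hm]) (by rw [integral_cocycle ω _ hψ.2.1, hm']) hle'
      push_cast
      linarith
  obtain ⟨k, hk⟩ := exists_nat_gt (2 / c)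
  rw [div_lt_iff₀ hc] at hk
  refine ⟨k * N, fun n hn ω hω φ hφ ψ hψ hm hm' => ?_⟩
  obtain ⟨m, rfl⟩ := Nat.exists_eq_add_of_le hn
  have hφ' := mapsTo_cocycle hK hω (k * N) hφ
  have hψ' := mapsTo_cocycle hK hω (k * N) hψ
  have hlt : ∫ t in Ioc 0 1, |cocycle σ β ω (k * N) φ t - cocycle σ β ω (k * N) ψ t| < ε := by
    by_contra! hcon
    have := key k ω hω φ hφ ψ hψ hm hm' hcon
    linarith
  refine lt_of_le_of_lt ?_ hlt
  rw [cocycle_add, cocycle_add]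
  exact integral_abs_cocycle_sub_le (σ^[k * N] ω) m hφ'.2.1 hψ'.2.1

end MemoryLoss

/-! ### Pointwise limits of functions in the cones -/

section Limits

/-- A first order Taylor estimate on `[δ, 1]`. -/
theorem abs_taylor_le {f f₁ f₂ : ℝ → ℝ} {δ M : ℝ} (hδ : 0 < δ)
    (h₁ : ∀ x ∈ Ioc (0 : ℝ) 1, HasDerivWithinAt f (f₁ x) (Ioc 0 1) x)
    (h₂ : ∀ x ∈ Ioc (0 : ℝ) 1, HasDerivWithinAt f₁ (f₂ x) (Ioc 0 1) x)
    (hM : ∀ x ∈ Icc δ 1, |f₂ x| ≤ M) {x y : ℝ} (hx : x ∈ Icc δ 1) (hy : y ∈ Icc δ 1) :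
    |f y - f x - f₁ x * (y - x)| ≤ M * (y - x) ^ 2 := by
  have hsub : Icc δ 1 ⊆ Ioc (0 : ℝ) 1 := fun z hz => ⟨hδ.trans_le hz.1, hz.2⟩
  have huI : uIcc x y ⊆ Icc δ 1 := (convex_Icc δ 1).ordConnected.uIcc_subset hx hy
  have hM0 : 0 ≤ M := (abs_nonneg _).trans (hM x hx)
  have hlip : ∀ z ∈ uIcc x y, |f₁ z - f₁ x| ≤ M * |y - x| := fun z hz => by
    have h := (convex_Icc δ 1).norm_image_sub_le_of_norm_hasDerivWithin_le
      (fun w hw => (h₂ w (hsub hw)).mono hsub) hM hx (huI hz)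
    refine h.trans ?_
    gcongr
    exact abs_sub_left_of_mem_uIcc hz
  have h := (convex_uIcc x y).norm_image_sub_le_of_norm_hasDerivWithin_le
    (f := fun z => f z - f₁ x * z) (f' := fun z => f₁ z - f₁ x * 1) (C := M * |y - x|)
    (fun w hw => ((h₁ w (hsub (huI hw))).mono (huI.trans hsub)).sub
      ((hasDerivWithinAt_id w _).const_mul (f₁ x)))
    (fun w hw => by simpa using hlip w hw) left_mem_uIcc right_mem_uIcc
  simp only [Real.norm_eq_abs] at h
  calc |f y - f x - f₁ x * (y - x)| = |f y - f₁ x * y - (f x - f₁ x * x)| := by congr 1; ring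
    _ ≤ M * |y - x| * |y - x| := h
    _ = M * (y - x) ^ 2 := by rw [mul_assoc, ← sq, sq_abs]

/-- If functions with locally uniform Taylor estimates converge pointwise on `(0, 1]`, then so do
their derivatives, and the limit of the derivatives is the derivative of the limit. -/
theorem exists_tendsto_hasDerivWithinAt {F G : ℕ → ℝ → ℝ} {f : ℝ → ℝ}
    (hT : ∀ δ : ℝ, 0 < δ → ∃ M : ℝ, 0 < M ∧ ∀ n, ∀ x ∈ Icc δ 1, ∀ y ∈ Icc δ 1,
      |F n y - F n x - G n x * (y - x)| ≤ M * (y - x) ^ 2)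
    (hF : ∀ x ∈ Ioc (0 : ℝ) 1, Tendsto (fun n => F n x) atTop (𝓝 (f x))) :
    ∃ g : ℝ → ℝ, ∀ x ∈ Ioc (0 : ℝ) 1, Tendsto (fun n => G n x) atTop (𝓝 (g x)) ∧
      HasDerivWithinAt f (g x) (Ioc 0 1) x := by
  have key : ∀ x ∈ Ioc (0 : ℝ) 1, ∃ l, Tendsto (fun n => G n x) atTop (𝓝 l) := by
    intro x hx
    have hx0 := hx.1
    obtain ⟨M, hM0, hM⟩ := hT (x / 2) (by positivity)
    refine cauchySeq_tendsto_of_complete (Metric.cauchySeq_iff.2 fun ε hε => ?_)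
    -- compare difference quotients over an interval of length `t`, with `t` of order `ε`
    set t := min (x / 2) (ε / (8 * M)) with ht
    have ht0 : 0 < t := by positivity
    have ht1 : t ≤ x / 2 := min_le_left _ _
    have ht2 : t * M ≤ ε / 8 := by
      have : t ≤ ε / (8 * M) := min_le_right _ _
      calc t * M ≤ ε / (8 * M) * M := by gcongr
        _ = ε / 8 := by field_simp
    have hy : x - t ∈ Ioc (0 : ℝ) 1 := ⟨by linarith, by linarith [hx.2]⟩
    obtain ⟨N₁, hN₁⟩ := Metric.cauchySeq_iff.1 (hF x hx).cauchySeq (ε * t / 4) (by positivity)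
    obtain ⟨N₂, hN₂⟩ := Metric.cauchySeq_iff.1 (hF _ hy).cauchySeq (ε * t / 4) (by positivity)
    refine ⟨max N₁ N₂, fun m hm n hn => ?_⟩
    have e₁ := hN₁ m (le_of_max_le_left hm) n (le_of_max_le_left hn)
    have e₂ := hN₂ m (le_of_max_le_right hm) n (le_of_max_le_right hn)
    have t₁ := hM m x ⟨by linarith, hx.2⟩ (x - t) ⟨by linarith, by linarith [hx.2]⟩
    have t₂ := hM n x ⟨by linarith, hx.2⟩ (x - t) ⟨by linarith, by linarith [hx.2]⟩
    have hsq : M * (x - t - x) ^ 2 ≤ ε / 8 * t := by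
      calc M * (x - t - x) ^ 2 = t * M * t := by ring
        _ ≤ ε / 8 * t := by gcongr
    rw [Real.dist_eq] at *
    have : |G m x - G n x| * t < ε * t := by
      rw [← abs_of_pos ht0, ← abs_mul, abs_of_pos ht0, abs_lt]
      rw [abs_lt] at e₁ e₂
      rw [abs_le] at t₁ t₂
      have : 0 < ε * t := by positivity
      constructor <;> nlinarith
    exact lt_of_mul_lt_mul_right this ht0.le
  choose! g hg using key
  refine ⟨g, fun x hx => ⟨hg x hx, ?_⟩⟩
  have hx0 := hx.1
  obtain ⟨M, hM0, hM⟩ := hT (x / 2) (by positivity)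
  rw [hasDerivWithinAt_iff_isLittleO]
  refine Asymptotics.IsLittleO.of_bound fun c hc => ?_
  have hev : ∀ᶠ y in 𝓝[Ioc 0 1] x, x / 2 ≤ y ∧ |y - x| ≤ c / M := by
    have h1 : ∀ᶠ y in 𝓝 x, x / 2 ≤ y := (lt_mem_nhds (by linarith)).mono fun y hy => le_of_lt hy
    have h2 : ∀ᶠ y in 𝓝 x, |y - x| ≤ c / M := Metric.closedBall_mem_nhds x (by positivity)
    exact nhdsWithin_le_nhds (h1.and h2)
  filter_upwards [hev, self_mem_nhdsWithin] with y ⟨hy1, hy2⟩ hy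
  have hlim : Tendsto (fun n => |F n y - F n x - G n x * (y - x)|) atTop
      (𝓝 |f y - f x - g x * (y - x)|) :=
    (((hF y hy).sub (hF x hx)).sub ((hg x hx).mul_const _)).abs
  have := le_of_tendsto' hlim fun n => hM n x ⟨by linarith, hx.2⟩ y ⟨hy1, hy.2⟩
  simp only [smul_eq_mul, Real.norm_eq_abs]
  rw [mul_comm (y - x)]
  refine this.trans ?_
  rw [← sq_abs, sq, ← mul_assoc]
  gcongr
  rw [le_div_iff₀ hM0] at hy2
  linarith

theorem integrableOn_rpow_neg {α : ℝ} (hα1 : α < 1) (a : ℝ) :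
    IntegrableOn (fun x : ℝ => a * x ^ (-α)) (Ioc 0 1) := by
  have h := intervalIntegral.intervalIntegrable_rpow' (a := 0) (b := 1) (r := -α) (by linarith)
  exact ((intervalIntegrable_iff_integrableOn_Ioc_of_le zero_le_one).1 h).const_mul a

variable {α a b₁ b₂ b₃ : ℝ}

/-- Dominated convergence for normalized functions in the cone. -/
theorem tendsto_integral_of_coneStar (hα1 : α < 1) {F : ℕ → ℝ → ℝ} {f : ℝ → ℝ}
    (hF : ∀ n, F n ∈ coneStar α a) (hm : ∀ n, ∫ t in Ioc 0 1, F n t = 1)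
    (hlim : ∀ x ∈ Ioc (0 : ℝ) 1, Tendsto (fun n => F n x) atTop (𝓝 (f x))) :
    IntegrableOn f (Ioc 0 1) ∧
    (∀ x ∈ Ioc (0 : ℝ) 1,
      Tendsto (fun n => ∫ t in Ioc 0 x, F n t) atTop (𝓝 (∫ t in Ioc 0 x, f t))) ∧
    Tendsto (fun n => ∫ t in Ioc 0 1, |F n t - f t|) atTop (𝓝 0) := by
  have hb : ∀ n, ∀ x ∈ Ioc (0 : ℝ) 1, |F n x| ≤ a * x ^ (-α) := fun n x hx => by
    rw [abs_of_nonneg ((hF n).2.2.1 x hx)]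
    exact coneStar_le_rpow (hF n) (hm n) hx
  have hbf : ∀ x ∈ Ioc (0 : ℝ) 1, |f x| ≤ a * x ^ (-α) := fun x hx =>
    le_of_tendsto' (hlim x hx).abs fun n => hb n x hx
  have hmeas : AEStronglyMeasurable f (volume.restrict (Ioc 0 1)) :=
    aestronglyMeasurable_of_tendsto_ae atTop (fun n => (hF n).2.1.aestronglyMeasurable)
      ((ae_restrict_mem measurableSet_Ioc).mono hlim)
  have hi : IntegrableOn f (Ioc 0 1) := (integrableOn_rpow_neg hα1 a).mono' hmeas
    ((ae_restrict_mem measurableSet_Ioc).mono hbf)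
  refine ⟨hi, fun x hx => ?_, ?_⟩
  · have hsub : Ioc 0 x ⊆ Ioc (0 : ℝ) 1 := Ioc_subset_Ioc_right hx.2
    refine tendsto_integral_of_dominated_convergence (fun x => a * x ^ (-α))
      (fun n => ((hF n).2.1.mono_set hsub).aestronglyMeasurable)
      ((integrableOn_rpow_neg hα1 a).mono_set hsub) (fun n => ?_) ?_
    · exact (ae_restrict_mem measurableSet_Ioc).mono fun t ht => hb n t (hsub ht)
    · exact (ae_restrict_mem measurableSet_Ioc).mono fun t ht => hlim t (hsub ht)
  · have hd : ∀ n, IntegrableOn (fun t => |F n t - f t|) (Ioc 0 1) :=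
      fun n => ((hF n).2.1.sub hi).abs
    suffices h : Tendsto (fun n => ∫ t in Ioc 0 1, |F n t - f t|) atTop
        (𝓝 (∫ _ in Ioc (0 : ℝ) 1, (0 : ℝ))) by simpa using h
    refine tendsto_integral_of_dominated_convergence (fun x => 2 * (a * x ^ (-α)))
      (fun n => (hd n).aestronglyMeasurable)
      ((integrableOn_rpow_neg hα1 a).const_mul 2) (fun n => ?_) ?_
    · refine (ae_restrict_mem measurableSet_Ioc).mono fun t ht => ?_
      rw [Real.norm_eq_abs, abs_abs]
      linarith [abs_sub (F n t) (f t), hb n t ht, hbf t ht]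
    · refine (ae_restrict_mem measurableSet_Ioc).mono fun t ht => ?_
      simpa using ((hlim t ht).sub_const (f t)).abs

/-- The bounds on third derivatives make the second derivatives equicontinuous, so that a
pointwise limit of functions in `coneThree` belongs to `coneTwo`. -/
theorem mem_cones_of_tendsto (hα1 : α < 1) (ha : 0 < a) (hb₂ : 0 ≤ b₂) (hb₃ : 0 ≤ b₃)
    {F : ℕ → ℝ → ℝ} {f : ℝ → ℝ}
    (hF : ∀ n, F n ∈ coneStar α a) (hF3 : ∀ n, F n ∈ coneThree b₁ b₂ b₃)
    (hm : ∀ n, ∫ t in Ioc 0 1, F n t = 1)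
    (hlim : ∀ x ∈ Ioc (0 : ℝ) 1, Tendsto (fun n => F n x) atTop (𝓝 (f x))) :
    f ∈ coneStar α a ∩ coneTwo b₁ b₂ := by
  choose F₁ F₂ F₃ h₁ h₂ h₃ hc hb using fun n => mem_coneThree_iff.1 (hF3 n)
  have hle : ∀ n, ∀ δ > 0, ∀ x ∈ Icc δ 1, F n x ≤ a / δ := fun n δ hδ x hx => by
    have hxI : x ∈ Ioc (0 : ℝ) 1 := ⟨hδ.trans_le hx.1, hx.2⟩
    have h := coneStar_mul_le_const hα1 ha.le (hF n) (hm n) hxI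
    rw [le_div_iff₀ hδ]
    have := (hF n).2.2.1 x hxI
    nlinarith [hx.1]
  have hbd₂ : ∀ δ > 0, ∀ n, ∀ x ∈ Icc δ 1, |F₂ n x| ≤ b₂ / δ ^ 2 * (a / δ) := by
    intro δ hδ n x hx
    have hxI : x ∈ Ioc (0 : ℝ) 1 := ⟨hδ.trans_le hx.1, hx.2⟩
    refine (hb n x hxI).2.2.1.trans ?_
    have := hle n δ hδ x hx
    have h0 := (hb n x hxI).1
    have := hx.1
    gcongr
  have hbd₃ : ∀ δ > 0, ∀ n, ∀ x ∈ Icc δ 1, |F₃ n x| ≤ b₃ / δ ^ 3 * (a / δ) := by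
    intro δ hδ n x hx
    have hxI : x ∈ Ioc (0 : ℝ) 1 := ⟨hδ.trans_le hx.1, hx.2⟩
    refine (hb n x hxI).2.2.2.trans ?_
    have := hle n δ hδ x hx
    have h0 := (hb n x hxI).1
    have := hx.1
    gcongr
  obtain ⟨f₁, hf₁⟩ := exists_tendsto_hasDerivWithinAt (F := F) (G := F₁) (f := f)
    (fun δ hδ => ⟨b₂ / δ ^ 2 * (a / δ) + 1, by positivity, fun n x hx y hy =>
      abs_taylor_le hδ (h₁ n) (h₂ n) (fun x hx => (hbd₂ δ hδ n x hx).trans (by linarith)) hx hy⟩)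
    hlim
  obtain ⟨f₂, hf₂⟩ := exists_tendsto_hasDerivWithinAt (F := F₁) (G := F₂) (f := f₁)
    (fun δ hδ => ⟨b₃ / δ ^ 3 * (a / δ) + 1, by positivity, fun n x hx y hy =>
      abs_taylor_le hδ (h₂ n) (h₃ n) (fun x hx => (hbd₃ δ hδ n x hx).trans (by linarith)) hx hy⟩)
    fun x hx => (hf₁ x hx).1
  have hcont : ContinuousOn f₂ (Ioc 0 1) := by
    intro x hx
    have hx0 := hx.1
    set δ := x / 2 with hδ
    have hδ0 : 0 < δ := by positivity
    set M := b₃ / δ ^ 3 * (a / δ) with hM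
    have hM0 : 0 ≤ M := by positivity
    have hsub : Icc δ 1 ⊆ Ioc (0 : ℝ) 1 := fun z hz => ⟨hδ0.trans_le hz.1, hz.2⟩
    have hlip : LipschitzOnWith M.toNNReal f₂ (Icc δ 1) := by
      refine LipschitzOnWith.of_dist_le_mul fun y hy z hz => ?_
      rw [Real.coe_toNNReal _ hM0]
      refine le_of_tendsto' ((hf₂ y (hsub hy)).1.dist (hf₂ z (hsub hz)).1) fun n => ?_
      exact (convex_Icc δ 1).norm_image_sub_le_of_norm_hasDerivWithin_le
        (fun w hw => (h₃ n w (hsub hw)).mono hsub) (hbd₃ δ hδ0 n) hz hy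
    refine (hlip.continuousOn x ⟨by linarith, hx.2⟩).mono_of_mem_nhdsWithin ?_
    have : Ici δ ∈ 𝓝 x := Ici_mem_nhds (by linarith)
    filter_upwards [nhdsWithin_le_nhds this, self_mem_nhdsWithin] with y hy1 hy2
    exact ⟨hy1, hy2.2⟩
  obtain ⟨hi, hint, -⟩ := tendsto_integral_of_coneStar hα1 hF hm hlim
  have h0 : ∀ x ∈ Ioc (0 : ℝ) 1, 0 ≤ f x := fun x hx =>
    ge_of_tendsto' (hlim x hx) fun n => (hF n).2.2.1 x hx
  refine ⟨⟨fun x hx => (hf₁ x hx).2.continuousWithinAt, hi, h0, ?_, ?_, ?_⟩, mem_coneTwo_iff.2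
    ⟨f₁, f₂, fun x hx => (hf₁ x hx).2, fun x hx => (hf₂ x hx).2, hcont, fun x hx =>
      ⟨h0 x hx, ?_, ?_⟩⟩⟩
  · intro x hx y hy hxy
    exact le_of_tendsto_of_tendsto' (hlim y hy) (hlim x hx) fun n => (hF n).2.2.2.1 hx hy hxy
  · intro x hx y hy hxy
    exact le_of_tendsto_of_tendsto' ((hlim x hx).const_mul _) ((hlim y hy).const_mul _)
      fun n => (hF n).2.2.2.2.1 hx hy hxy
  · intro x hx
    rw [intervalIntegral.integral_of_le hx.1.le, intervalIntegral.integral_of_le zero_le_one]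
    exact le_of_tendsto_of_tendsto' (hint x hx)
      ((hint 1 (right_mem_Ioc.2 one_pos)).const_mul _)
      fun n => coneStar_setIntegral_le (hF n) hx
  · exact le_of_tendsto_of_tendsto' (hf₁ x hx).1.abs ((hlim x hx).const_mul _)
      fun n => (hb n x hx).2.1
  · exact le_of_tendsto_of_tendsto' (hf₂ x hx).1.abs ((hlim x hx).const_mul _)
      fun n => (hb n x hx).2.2.1

/-- Convergence in `L¹` of normalized functions in the cone entails pointwise convergence, in the
form of a Cauchy condition. -/
theorem cauchySeq_of_coneStar (hα1 : α < 1) (ha : 0 < a) {F : ℕ → ℝ → ℝ}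
    (hF : ∀ n, F n ∈ coneStar α a) (hm : ∀ n, ∫ t in Ioc 0 1, F n t = 1)
    (hC : ∀ ε > 0, ∃ N, ∀ m ≥ N, ∀ n ≥ N, ∫ t in Ioc 0 1, |F m t - F n t| < ε)
    {x : ℝ} (hx : x ∈ Ioc (0 : ℝ) 1) : CauchySeq fun n => F n x := by
  refine Metric.cauchySeq_iff.2 fun ε hε => ?_
  have hx0 := hx.1
  set C := 2 * a / (x / 2) ^ 2 with hCdef
  have hC0 : 0 < C := by positivity
  set l := min (x / 2) (ε / (4 * C)) with hl
  have hl0 : 0 < l := by positivity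
  have hl1 : l ≤ x / 2 := min_le_left _ _
  have hl2 : C * l ≤ ε / 4 := by
    calc C * l ≤ C * (ε / (4 * C)) := by gcongr; exact min_le_right _ _
      _ = ε / 4 := by field_simp
  obtain ⟨N, hN⟩ := hC (ε / 4 * l) (by positivity)
  refine ⟨N, fun m hm' n hn' => ?_⟩
  have hsub : Ioc (x - l) x ⊆ Ioc (0 : ℝ) 1 := fun t ht =>
    ⟨by linarith [ht.1], ht.2.trans hx.2⟩
  have hi : IntegrableOn (fun t => |F m t - F n t|) (Ioc 0 1) := ((hF m).2.1.sub (hF n).2.1).abs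
  have hpt : ∀ t ∈ Ioc (x - l) x, |F m x - F n x| - ε / 2 ≤ |F m t - F n t| := by
    intro t ht
    have hlow : ∀ k, F k x ≤ F k t := fun k => (hF k).2.2.2.1 (hsub ht) hx ht.2
    have hup : ∀ k, F k t - F k x ≤ ε / 4 := fun k => by
      refine (coneStar_sub_le hα1 ha.le (hF k) (hm k) (δ := x / 2) (by positivity)
        (by linarith [ht.1]) ht.2 hx.2).trans (le_trans ?_ hl2)
      gcongr
      linarith [ht.1]
    have h1 := hlow m
    have h2 := hlow n
    have h3 := hup m
    have h4 := hup n
    have h5 : |F m x - F n x| ≤ |F m t - F n t| + |(F m x - F m t) - (F n x - F n t)| := by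
      refine le_trans (le_of_eq ?_) (abs_add_le _ _)
      congr 1; ring
    have h6 : |(F m x - F m t) - (F n x - F n t)| ≤ ε / 2 := by
      rw [abs_le]; constructor <;> linarith
    linarith
  have h1 := setIntegral_mono_on (f := fun _ => |F m x - F n x| - ε / 2) (by simp)
    (hi.mono_set hsub) measurableSet_Ioc hpt
  have h2 := setIntegral_le_of_subset hi (fun _ _ => abs_nonneg _) hsub
  have h3 := hN m hm' n hn'
  simp only [integral_const, smul_eq_mul, measureReal_restrict_apply_univ] at h1
  rw [Real.volume_real_Ioc_of_le (by linarith)] at h1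
  rw [Real.dist_eq]
  have : (|F m x - F n x| - ε / 2) * l < ε / 4 * l := by nlinarith
  have := lt_of_mul_lt_mul_right this hl0.le
  linarith

end Limits

/-! ### Joint measurability -/

section JointMeasurability

/-- A map into a second countable metric space is measurable if its distances to all points are. -/
theorem measurable_of_measurable_dist {X E : Type*} [MeasurableSpace X] [PseudoMetricSpace E]
    [SecondCountableTopology E] [MeasurableSpace E] [BorelSpace E] {f : X → E}
    (h : ∀ c, Measurable fun x => dist (f x) c) : Measurable f := by
  refine measurable_of_isOpen fun U hU => ?_
  choose! r hr hrU using Metric.isOpen_iff.1 hU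
  obtain ⟨T, hTU, hT, hTeq⟩ := TopologicalSpace.isOpen_biUnion_countable U
    (fun x => Metric.ball x (r x)) fun _ _ => Metric.isOpen_ball
  have hUeq : U = ⋃ x ∈ T, Metric.ball x (r x) := by
    rw [hTeq]
    refine Subset.antisymm (fun x hx => mem_biUnion hx (Metric.mem_ball_self (hr x hx))) ?_
    exact iUnion₂_subset hrU
  rw [hUeq, preimage_iUnion₂]
  refine MeasurableSet.biUnion hT fun x _ => ?_
  exact measurableSet_lt (h x) measurable_const

/-- A jointly measurable family of integrable functions is measurable as a map into `L¹`. -/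
theorem stronglyMeasurable_of_measurable_uncurry {X Y : Type*} [MeasurableSpace X]
    [MeasurableSpace Y] {μ : Measure Y} [SFinite μ] [SecondCountableTopology (Lp ℝ 1 μ)]
    {F : X → Y → ℝ} (hF : Measurable (Function.uncurry F)) {H : X → Lp ℝ 1 μ}
    (hH : ∀ x, H x =ᵐ[μ] F x) : StronglyMeasurable H := by
  borelize ↥(Lp ℝ 1 μ)
  refine Measurable.stronglyMeasurable (measurable_of_measurable_dist fun c => ?_)
  have hd : ∀ x, dist (H x) c = ∫ y, |F x y - c y| ∂μ := fun x => by
    rw [dist_eq_norm, L1.norm_eq_integral_norm]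
    refine integral_congr_ae ?_
    filter_upwards [hH x, Lp.coeFn_sub (H x) c] with y h1 h2
    rw [h2, Pi.sub_apply, h1, Real.norm_eq_abs]
  simp only [hd]
  have hc : Measurable fun p : X × Y => c p.2 :=
    (Lp.stronglyMeasurable c).measurable.comp measurable_snd
  have hm : Measurable fun p : X × Y => |F p.1 p.2 - c p.2| := (hF.sub hc).abs
  exact (hm.stronglyMeasurable.integral_prod_right).measurable

/-- The inverse branch, precomposed with the projection onto `[0, 1]`, is jointly measurable in the
parameter and the point. -/
theorem measurable_branchInv_clamp :
    Measurable fun p : Ioo (0 : ℝ) 1 × ℝ => branchInv p.1 (max 0 (min 1 p.2)) := by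
  refine measurable_of_Iic fun t => ?_
  have hI : ∀ x : ℝ, max 0 (min 1 x) ∈ Icc (0 : ℝ) 1 := fun x =>
    ⟨le_max_left _ _, max_le zero_le_one (min_le_left _ _)⟩
  rcases lt_or_ge t 0 with ht | ht
  · convert MeasurableSet.empty
    ext p
    simp only [mem_preimage, mem_Iic, mem_empty_iff_false, iff_false, not_le]
    exact ht.trans_le (branchInv_mem_Icc p.1.2.1.le (hI p.2)).1
  · have : (fun p : Ioo (0 : ℝ) 1 × ℝ => branchInv p.1 (max 0 (min 1 p.2))) ⁻¹' Iic t =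
        {p | max 0 (min 1 p.2) ≤ branch p.1 t} := by
      ext p
      exact branchInv_le_iff p.1.2.1.le (hI p.2) ht
    rw [this]
    refine measurableSet_le (by fun_prop) ?_
    unfold branch
    fun_prop

variable {Ω : Type*} [MeasurableSpace Ω]

/-- Joint measurability of a family of functions on `(0, 1]`. -/
def JointlyMeasurable (φ : Ω → ℝ → ℝ) : Prop :=
  Measurable ({p : Ω × ℝ | p.2 ∈ Ioc (0 : ℝ) 1}.indicator fun p => φ p.1 p.2)

theorem measurableSet_snd_mem_Ioc : MeasurableSet {p : Ω × ℝ | p.2 ∈ Ioc (0 : ℝ) 1} :=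
  measurable_snd measurableSet_Ioc

theorem JointlyMeasurable.transfer {φ : Ω → ℝ → ℝ} (hφ : JointlyMeasurable φ)
    {β : Ω → Ioo (0 : ℝ) 1} (hβ : Measurable β) :
    JointlyMeasurable fun ω => LSV.transfer (β ω) (φ ω) := by
  unfold JointlyMeasurable at hφ
  obtain ⟨Φ, hΦm, hΦ⟩ : ∃ Φ : Ω × ℝ → ℝ, Measurable Φ ∧
      ∀ ω, ∀ x ∈ Ioc (0 : ℝ) 1, Φ (ω, x) = φ ω x :=
    ⟨_, hφ, fun ω x hx => indicator_of_mem (s := {p : Ω × ℝ | p.2 ∈ Ioc (0 : ℝ) 1}) hx _⟩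
  obtain ⟨g, hgm, hg⟩ : ∃ g : Ω × ℝ → ℝ, Measurable g ∧
      ∀ ω, ∀ x ∈ Ioc (0 : ℝ) 1, g (ω, x) = branchInv (β ω) x := by
    refine ⟨_, measurable_branchInv_clamp.comp ((hβ.comp measurable_fst).prodMk measurable_snd),
      fun ω x hx => ?_⟩
    simp only [Function.comp_apply]
    rw [min_eq_right hx.2, max_eq_right hx.1.le]
  have hβ' : Measurable fun p : Ω × ℝ => (β p.1 : ℝ) :=
    measurable_subtype_coe.comp (hβ.comp measurable_fst)
  have hs : Measurable fun p : Ω × ℝ => slope (β p.1) (g p) := by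
    unfold slope pw
    fun_prop
  have h1 : Measurable fun p : Ω × ℝ =>
      Φ (p.1, g p) * (slope (β p.1) (g p))⁻¹ + Φ (p.1, (p.2 + 1) / 2) / 2 := by
    fun_prop
  unfold JointlyMeasurable
  convert h1.indicator (measurableSet_snd_mem_Ioc (Ω := Ω)) using 1
  refine indicator_congr ?_
  rintro ⟨ω, x⟩ hx
  have hx' : x ∈ Ioc (0 : ℝ) 1 := hx
  simp only [hg ω x hx', hΦ ω _ (half_mem_Ioc hx'),
    hΦ ω _ (branchInv_mem_Ioc (β ω).2.1.le hx')]
  exact transfer_eq (β ω).2.1.le _ hx'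

theorem jointlyMeasurable_cocycle {σ : Ω → Ω} (hσ : Measurable σ) {β : Ω → Ioo (0 : ℝ) 1}
    (hβ : Measurable β) (n : ℕ) :
    JointlyMeasurable fun ω => cocycle σ β ω n fun _ => 1 := by
  induction n with
  | zero => exact measurable_const.indicator measurableSet_snd_mem_Ioc
  | succ n ih => exact ih.transfer (hβ.comp (hσ.iterate n))

theorem JointlyMeasurable.comp {φ : Ω → ℝ → ℝ} (hφ : JointlyMeasurable φ) {s : Ω → Ω}
    (hs : Measurable s) : JointlyMeasurable fun ω => φ (s ω) :=
  Measurable.comp hφ ((hs.comp measurable_fst).prodMk measurable_snd)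

end JointMeasurability

/-! ### The equivariant density -/

section Density

variable {α a b₁ b₂ b₃ : ℝ}

theorem one_mem_coneStar (hα0 : 0 ≤ α) (ha : 1 ≤ a) : (fun _ => 1) ∈ coneStar α a := by
  refine ⟨continuousOn_const, integrable_const _, fun _ _ => zero_le_one, antitoneOn_const, ?_, ?_⟩
  · intro x hx y hy hxy
    have := hx.1.le
    simp only [mul_one]
    gcongr
  · intro x hx
    have h : x ^ (1 : ℝ) ≤ x ^ (1 - α) :=
      Real.rpow_le_rpow_of_exponent_ge hx.1 hx.2 (by linarith)
    rw [Real.rpow_one] at h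
    have := hx.1
    simp only [intervalIntegral.integral_const, smul_eq_mul, mul_one, sub_zero]
    nlinarith

theorem one_mem_coneThree (hb₁ : 0 ≤ b₁) (hb₂ : 0 ≤ b₂) (hb₃ : 0 ≤ b₃) :
    (fun _ => 1) ∈ coneThree b₁ b₂ b₃ := by
  refine mem_coneThree_iff.2 ⟨fun _ => 0, fun _ => 0, fun _ => 0,
    fun x _ => hasDerivWithinAt_const _ _ _, fun x _ => hasDerivWithinAt_const _ _ _,
    fun x _ => hasDerivWithinAt_const _ _ _, continuousOn_const, fun x hx => ?_⟩
  have := hx.1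
  simp only [abs_zero]
  refine ⟨zero_le_one, ?_, ?_, ?_⟩ <;> positivity

variable {Ω : Type*} [MeasurableSpace Ω]

/-- The density `𝓛^n_{σ^{-n} ω} 1`, pushed forward from the past. -/
noncomputable def pastDensity (σ : Ω ≃ᵐ Ω) (β : Ω → Ioo (0 : ℝ) 1) (n : ℕ) (ω : Ω) : ℝ → ℝ :=
  cocycle σ β (σ.symm^[n] ω) n fun _ => 1

open Classical in
/-- The limit of the densities pushed forward from the past; the value `1` outside `Ω'` and
`(0, 1]` is chosen for the sake of measurability and positivity. -/
noncomputable def limitDensity (σ : Ω ≃ᵐ Ω) (β : Ω → Ioo (0 : ℝ) 1) (Ω' : Set Ω) (ω : Ω) (x : ℝ) :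
    ℝ :=
  if ω ∈ Ω' ∧ x ∈ Ioc (0 : ℝ) 1 then limUnder atTop fun n => pastDensity σ β n ω x else 1

variable {σ : Ω ≃ᵐ Ω} {β : Ω → Ioo (0 : ℝ) 1} {Ω' : Set Ω}

theorem iterate_symm_mem (hΩ : σ ⁻¹' Ω' = Ω') (n : ℕ) {ω : Ω} (hω : ω ∈ Ω') :
    σ.symm^[n] ω ∈ Ω' := by
  have h : MapsTo σ.symm Ω' Ω' := fun ω hω => by
    rw [← hΩ]; simpa using hω
  exact h.iterate n hω

theorem iterate_mem (hΩ : σ ⁻¹' Ω' = Ω') (n : ℕ) {ω : Ω} (hω : ω ∈ Ω') : σ^[n] ω ∈ Ω' := by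
  have h : MapsTo σ Ω' Ω' := fun ω hω => by rw [← hΩ] at hω; exact hω
  exact h.iterate n hω

theorem iterate_iterate_symm (n : ℕ) (ω : Ω) : σ^[n] (σ.symm^[n] ω) = ω :=
  (Function.LeftInverse.iterate σ.apply_symm_apply n) ω

theorem pastDensity_succ (n : ℕ) (ω : Ω) :
    pastDensity σ β (n + 1) (σ ω) = transfer (β ω) (pastDensity σ β n ω) := by
  unfold pastDensity
  rw [Function.iterate_succ_apply, σ.symm_apply_apply, cocycle, iterate_iterate_symm]

theorem pastDensity_add (n k : ℕ) (ω : Ω) :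
    pastDensity σ β (k + n) ω =
      cocycle σ β (σ.symm^[n] ω) n (pastDensity σ β k (σ.symm^[n] ω)) := by
  unfold pastDensity
  rw [cocycle_add, Function.iterate_add_apply, iterate_iterate_symm]

/-- The hypotheses on the cones under which the equivariant density exists. -/
structure ConeData (α a b₁ b₂ b₃ : ℝ) : Prop where
  pos : 0 < α
  lt_one : α < 1
  one_le : 1 ≤ a
  b₁_nonneg : 0 ≤ b₁
  b₂_nonneg : 0 ≤ b₂
  b₃_nonneg : 0 ≤ b₃
  star : ∀ γ : ℝ, 0 < γ → γ ≤ α → MapsTo (transfer γ) (coneStar α a) (coneStar α a)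
  three : ∀ γ : ℝ, 0 < γ → γ ≤ α →
    MapsTo (transfer γ) (coneThree b₁ b₂ b₃) (coneThree b₁ b₂ b₃)

variable (D : ConeData α a b₁ b₂ b₃) (hΩ : σ ⁻¹' Ω' = Ω') (hβα : ∀ ω ∈ Ω', (β ω : ℝ) ≤ α)

include D hΩ hβα

omit D in
theorem le_of_iterate_symm {ω : Ω} (hω : ω ∈ Ω') (k n : ℕ) :
    (β (σ^[n] (σ.symm^[k] ω)) : ℝ) ≤ α :=
  hβα _ (iterate_mem hΩ n (iterate_symm_mem hΩ k hω))

theorem pastDensity_mem_coneStar (n : ℕ) {ω : Ω} (hω : ω ∈ Ω') :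
    pastDensity σ β n ω ∈ coneStar α a :=
  mapsTo_cocycle D.star (le_of_iterate_symm hΩ hβα hω n) n (one_mem_coneStar D.pos.le D.one_le)

theorem pastDensity_mem_coneThree (n : ℕ) {ω : Ω} (hω : ω ∈ Ω') :
    pastDensity σ β n ω ∈ coneThree b₁ b₂ b₃ :=
  mapsTo_cocycle D.three (le_of_iterate_symm hΩ hβα hω n) n
    (one_mem_coneThree D.b₁_nonneg D.b₂_nonneg D.b₃_nonneg)

omit D hΩ hβα in
theorem integral_pastDensity (n : ℕ) (ω : Ω) : ∫ x in Ioc 0 1, pastDensity σ β n ω x = 1 := by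
  unfold pastDensity
  rw [integral_cocycle _ n (integrable_const _)]
  simp

theorem pastDensity_cauchy {ω : Ω} (hω : ω ∈ Ω') :
    ∀ ε > 0, ∃ N, ∀ m ≥ N, ∀ n ≥ N,
      ∫ t in Ioc 0 1, |pastDensity σ β m ω t - pastDensity σ β n ω t| < ε := by
  intro ε hε
  obtain ⟨N, hN⟩ := exists_integral_abs_cocycle_sub_lt (σ := σ) (β := β) D.lt_one
    (one_pos.trans_le D.one_le) D.star hε
  refine ⟨N, fun m hm n hn => ?_⟩
  obtain ⟨m, rfl⟩ := Nat.exists_eq_add_of_le' hm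
  obtain ⟨n, rfl⟩ := Nat.exists_eq_add_of_le' hn
  have hω' := iterate_symm_mem hΩ N hω
  rw [pastDensity_add, pastDensity_add]
  exact hN N le_rfl _ (le_of_iterate_symm hΩ hβα hω N) _
    (pastDensity_mem_coneStar D hΩ hβα m hω') _ (pastDensity_mem_coneStar D hΩ hβα n hω')
    (integral_pastDensity _ _) (integral_pastDensity _ _)

theorem tendsto_pastDensity {ω : Ω} (hω : ω ∈ Ω') {x : ℝ} (hx : x ∈ Ioc (0 : ℝ) 1) :
    Tendsto (fun n => pastDensity σ β n ω x) atTop (𝓝 (limitDensity σ β Ω' ω x)) := by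
  rw [limitDensity, if_pos ⟨hω, hx⟩]
  exact (cauchySeq_of_coneStar D.lt_one (one_pos.trans_le D.one_le)
    (fun n => pastDensity_mem_coneStar D hΩ hβα n hω) (fun n => integral_pastDensity n ω)
    (pastDensity_cauchy D hΩ hβα hω) hx).tendsto_limUnder

/-- The densities from the past start from the function `1`, which belongs to all cones, and the
cones pass to the limit, at the loss of one derivative. -/
theorem limitDensity_mem {ω : Ω} (hω : ω ∈ Ω') :
    limitDensity σ β Ω' ω ∈ coneStar α a ∩ coneTwo b₁ b₂ :=
  mem_cones_of_tendsto D.lt_one (one_pos.trans_le D.one_le) D.b₂_nonneg D.b₃_nonneg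
    (fun n => pastDensity_mem_coneStar D hΩ hβα n hω)
    (fun n => pastDensity_mem_coneThree D hΩ hβα n hω) (fun n => integral_pastDensity n ω)
    fun _ hx => tendsto_pastDensity D hΩ hβα hω hx

theorem integral_limitDensity {ω : Ω} (hω : ω ∈ Ω') :
    ∫ x in Ioc 0 1, limitDensity σ β Ω' ω x = 1 := by
  have h := (tendsto_integral_of_coneStar D.lt_one
    (fun n => pastDensity_mem_coneStar D hΩ hβα n hω) (fun n => integral_pastDensity n ω)
    fun _ hx => tendsto_pastDensity D hΩ hβα hω hx).2.1 1 (right_mem_Ioc.2 one_pos)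
  simp only [integral_pastDensity] at h
  exact (tendsto_nhds_unique h tendsto_const_nhds)

theorem tendsto_integral_abs_pastDensity_sub {ω : Ω} (hω : ω ∈ Ω') :
    Tendsto (fun n => ∫ t in Ioc 0 1, |pastDensity σ β n ω t - limitDensity σ β Ω' ω t|) atTop
      (𝓝 0) :=
  (tendsto_integral_of_coneStar D.lt_one
    (fun n => pastDensity_mem_coneStar D hΩ hβα n hω) (fun n => integral_pastDensity n ω)
    fun _ hx => tendsto_pastDensity D hΩ hβα hω hx).2.2

theorem transfer_limitDensity {ω : Ω} (hω : ω ∈ Ω') :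
    EqOn (transfer (β ω) (limitDensity σ β Ω' ω)) (limitDensity σ β Ω' (σ ω)) (Ioc 0 1) := by
  intro x hx
  have hσω : σ ω ∈ Ω' := iterate_mem hΩ 1 hω
  have h1 := (tendsto_pastDensity D hΩ hβα hσω hx).comp (tendsto_add_atTop_nat 1)
  have h2 : Tendsto (fun n => transfer (β ω) (pastDensity σ β n ω) x) atTop
      (𝓝 (transfer (β ω) (limitDensity σ β Ω' ω) x)) :=
    ((tendsto_pastDensity D hΩ hβα hω (branchInv_mem_Ioc (β ω).2.1.le hx)).div_const _).add
      ((tendsto_pastDensity D hΩ hβα hω (half_mem_Ioc hx)).div_const 2)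
  refine tendsto_nhds_unique h2 (h1.congr fun n => ?_)
  rw [Function.comp_apply, pastDensity_succ]

theorem measurable_limitDensity (hβ : Measurable β) (hΩm : MeasurableSet Ω') :
    Measurable (Function.uncurry (limitDensity σ β Ω')) := by
  classical
  have hset : MeasurableSet {p : Ω × ℝ | p.1 ∈ Ω' ∧ p.2 ∈ Ioc (0 : ℝ) 1} :=
    (measurable_fst hΩm).inter (measurable_snd measurableSet_Ioc)
  refine measurable_of_tendsto_metrizable (f := fun n (p : Ω × ℝ) =>
    if p.1 ∈ Ω' ∧ p.2 ∈ Ioc (0 : ℝ) 1 then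
      {p : Ω × ℝ | p.2 ∈ Ioc (0 : ℝ) 1}.indicator (fun p => pastDensity σ β n p.1 p.2) p else 1)
    (fun n => ?_) ?_
  · exact Measurable.ite hset ((jointlyMeasurable_cocycle σ.measurable hβ n).comp
      (σ.symm.measurable.iterate n)) measurable_const
  · rw [tendsto_pi_nhds]
    rintro ⟨ω, x⟩
    by_cases h : ω ∈ Ω' ∧ x ∈ Ioc (0 : ℝ) 1
    · refine (tendsto_pastDensity D hΩ hβα h.1 h.2).congr fun n => ?_
      rw [if_pos h, indicator_of_mem (by exact h.2)]
    · simp only [h, if_false, Function.uncurry, limitDensity]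
      exact tendsto_const_nhds

theorem isEquivariantDensity_limitDensity (hβ : Measurable β) (hΩm : MeasurableSet Ω') :
    IsEquivariantDensity σ β Ω' (coneStar α a ∩ coneTwo b₁ b₂) (limitDensity σ β Ω') where
  measurable := by
    have : Fact ((1 : ℝ≥0∞) ≠ ∞) := ⟨by simp⟩
    have hi : ∀ ω : Ω', Integrable (limitDensity σ β Ω' ω) (volume.restrict (Ioc 0 1)) :=
      fun ω => (limitDensity_mem D hΩ hβα ω.2).1.2.1
    refine ⟨fun ω => (hi ω).toL1 _, stronglyMeasurable_of_measurable_uncurry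
      (F := fun (ω : Ω') x => limitDensity σ β Ω' ω x) ?_ fun ω => (hi ω).coeFn_toL1,
      fun ω => (hi ω).coeFn_toL1⟩
    exact (measurable_limitDensity D hΩ hβα hβ hΩm).comp
      ((measurable_subtype_coe.comp measurable_fst).prodMk measurable_snd)
  mem _ hω := limitDensity_mem D hΩ hβα hω
  equivariant _ hω := transfer_limitDensity D hΩ hβα hω
  integral_eq_one ω hω := by
    rw [intervalIntegral.integral_of_le zero_le_one]
    exact integral_limitDensity D hΩ hβα hω

omit D hβα in
theorem cocycle_eq_of_isEquivariantDensity {K : Set (ℝ → ℝ)} {k : Ω → ℝ → ℝ}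
    (hk : IsEquivariantDensity σ β Ω' K k) (n : ℕ) {ω : Ω} (hω : ω ∈ Ω') :
    EqOn (cocycle σ β ω n (k ω)) (k (σ^[n] ω)) (Ioc 0 1) := by
  induction n with
  | zero => exact fun _ _ => rfl
  | succ n ih =>
    rw [Function.iterate_succ_apply']
    exact (transfer_congr (β _).2.1.le ih).trans (hk.equivariant _ (iterate_mem hΩ n hω))

/-- An equivariant density in the cone is determined by its remote past, which is forgotten. -/
theorem eqOn_of_isEquivariantDensity {k h : Ω → ℝ → ℝ}
    (hk : IsEquivariantDensity σ β Ω' (coneStar α a ∩ coneTwo b₁ b₂) k)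
    (hh : IsEquivariantDensity σ β Ω' (coneStar α a ∩ coneTwo b₁ b₂) h) {ω : Ω} (hω : ω ∈ Ω') :
    EqOn (k ω) (h ω) (Ioc 0 1) := by
  have hint : ∀ {k : Ω → ℝ → ℝ}, IsEquivariantDensity σ β Ω' (coneStar α a ∩ coneTwo b₁ b₂) k →
      ∀ ω ∈ Ω', ∫ t in Ioc 0 1, k ω t = 1 := fun hk ω hω => by
    have := hk.integral_eq_one ω hω
    rwa [intervalIntegral.integral_of_le zero_le_one] at this
  have hkc := (hk.mem ω hω).1
  have hhc := (hh.mem ω hω).1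
  have hle : ∀ ε > 0, ∫ t in Ioc 0 1, |k ω t - h ω t| ≤ ε := by
    intro ε hε
    obtain ⟨N, hN⟩ := exists_integral_abs_cocycle_sub_lt (σ := σ) (β := β) D.lt_one
      (one_pos.trans_le D.one_le) D.star hε
    have hω' := iterate_symm_mem hΩ N hω
    have := hN N le_rfl _ (le_of_iterate_symm hΩ hβα hω N) _ (hk.mem _ hω').1 _ (hh.mem _ hω').1
      (hint hk _ hω') (hint hh _ hω')
    refine le_of_eq_of_le (setIntegral_congr_fun measurableSet_Ioc fun t ht => ?_) this.le
    have e1 := cocycle_eq_of_isEquivariantDensity hΩ hk N hω' ht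
    have e2 := cocycle_eq_of_isEquivariantDensity hΩ hh N hω' ht
    rw [iterate_iterate_symm] at e1 e2
    rw [e1, e2]
  have hi : IntegrableOn (fun t => |k ω t - h ω t|) (Ioc 0 1) := (hkc.2.1.sub hhc.2.1).abs
  have h0 : ∫ t in Ioc 0 1, |k ω t - h ω t| = 0 :=
    le_antisymm (le_of_forall_pos_le_add fun ε hε => by simpa using hle ε hε)
      (setIntegral_nonneg measurableSet_Ioc fun _ _ => abs_nonneg _)
  -- the sequence that alternates between `k ω` and `h ω` is Cauchy in `L¹`, hence pointwise
  intro x hx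
  have hC := cauchySeq_of_coneStar D.lt_one (one_pos.trans_le D.one_le)
    (F := fun n => if Even n then k ω else h ω)
    (fun n => by split_ifs <;> assumption)
    (fun n => by split_ifs; exacts [hint hk ω hω, hint hh ω hω])
    (fun ε hε => ⟨0, fun m _ n _ => by
      split_ifs
      · simpa using hε
      · simpa only [h0] using hε
      · simpa only [abs_sub_comm, h0] using hε
      · simpa using hε⟩) hx
  refine eq_of_forall_dist_le fun ε hε => ?_
  obtain ⟨N, hN⟩ := Metric.cauchySeq_iff.1 hC ε hε
  have := hN (2 * N) (by omega) (2 * N + 1) (by omega)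
  simp only [even_two_mul, if_true, Nat.not_even_two_mul_add_one, if_false] at this
  exact this.le

end Density

/-! ### The skew product and its invariant measure -/

section SkewProduct

/-- The conditional measures of the invariant measure, expressed on the real line. -/
theorem setLIntegral_unitInterval {f : ℝ → ℝ} (hf : IntegrableOn f (Ioc 0 1))
    (h0 : ∀ x ∈ Ioc (0 : ℝ) 1, 0 ≤ f x) {R : Set ℝ} (hR : MeasurableSet R) :
    ∫⁻ x in (Subtype.val ⁻¹' R : Set unitInterval), ENNReal.ofReal (f (x : ℝ)) ∂volume =
      ENNReal.ofReal (∫ x in R ∩ Ioc 0 1, f x) := by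
  have hmp : MeasurePreserving (Subtype.val : unitInterval → ℝ) volume
      (volume.restrict (Icc 0 1)) := measurePreserving_subtype_coe measurableSet_Icc
  have he : MeasurableEmbedding (Subtype.val : unitInterval → ℝ) :=
    MeasurableEmbedding.subtype_coe measurableSet_Icc
  rw [hmp.setLIntegral_comp_preimage_emb he (fun x => ENNReal.ofReal (f x)) R,
    Measure.restrict_restrict hR]
  have hae : (R ∩ Icc 0 1 : Set ℝ) =ᵐ[volume] (R ∩ Ioc 0 1 : Set ℝ) :=
    (ae_eq_refl R).inter Ioc_ae_eq_Icc.symm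
  rw [Measure.restrict_congr_set hae, ofReal_integral_eq_lintegral_ofReal]
  · exact hf.mono_set inter_subset_right
  · exact (ae_restrict_mem (hR.inter measurableSet_Ioc)).mono fun x hx => h0 x hx.2

theorem measurableSet_image_val {B : Set unitInterval} (hB : MeasurableSet B) :
    MeasurableSet (Subtype.val '' B : Set ℝ) :=
  (MeasurableEmbedding.subtype_coe measurableSet_Icc).measurableSet_image' hB

theorem preimage_val_image_val (B : Set unitInterval) :
    Subtype.val ⁻¹' (Subtype.val '' B : Set ℝ) = B :=
  preimage_image_eq B Subtype.val_injective

theorem map_preimage {γ : ℝ} (hγ : 0 ≤ γ) (B : Set unitInterval) :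
    map γ hγ ⁻¹' B = Subtype.val ⁻¹' (mapReal γ ⁻¹' (Subtype.val '' B : Set ℝ)) := by
  conv_lhs => rw [← preimage_val_image_val B]
  rfl

variable {Ω : Type*} [MeasurableSpace Ω] {σ : Ω ≃ᵐ Ω} {β : Ω → Ioo (0 : ℝ) 1} {Ω' : Set Ω}
  {P : Measure Ω}

theorem measurable_skewProduct (hβ : Measurable β) : Measurable (skewProduct σ β) := by
  refine (σ.measurable.comp measurable_fst).prodMk (Measurable.subtype_mk ?_)
  exact measurable_mapReal_uncurry.comp
    ((measurable_subtype_coe.comp (hβ.comp measurable_fst)).prodMk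
      (measurable_subtype_coe.comp measurable_snd))

/-- The measure on `Ω × [0,1]` with density `h` with respect to `P × m`. -/
noncomputable def densityMeasure (P : Measure Ω) (h : Ω → ℝ → ℝ) : Measure (Ω × unitInterval) :=
  (P.prod volume).withDensity fun p => ENNReal.ofReal (h p.1 p.2)

variable {h : Ω → ℝ → ℝ} (hm : Measurable (Function.uncurry h))

include hm

theorem measurable_ofReal_density :
    Measurable fun p : Ω × unitInterval => ENNReal.ofReal (h p.1 p.2) :=
  ENNReal.measurable_ofReal.comp
    (hm.comp (measurable_fst.prodMk (measurable_subtype_coe.comp measurable_snd)))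

theorem measurable_fibreMass {B : Set unitInterval} :
    Measurable fun ω => ∫⁻ x in B, ENNReal.ofReal (h ω (x : ℝ)) ∂volume :=
  Measurable.lintegral_prod_right' (ν := volume.restrict B) (measurable_ofReal_density hm)

theorem densityMeasure_apply {E : Set (Ω × unitInterval)} (hE : MeasurableSet E) :
    densityMeasure P h E =
      ∫⁻ ω, ∫⁻ x in Prod.mk ω ⁻¹' E, ENNReal.ofReal (h ω (x : ℝ)) ∂volume ∂P := by
  have hd := measurable_ofReal_density hm
  rw [densityMeasure, withDensity_apply _ hE, ← lintegral_indicator hE,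
    lintegral_prod _ (hd.indicator hE).aemeasurable]
  refine lintegral_congr fun ω => ?_
  rw [← lintegral_indicator (measurable_prodMk_left hE)]
  rfl

theorem densityMeasure_prod {A : Set Ω} {B : Set unitInterval} (hA : MeasurableSet A)
    (hB : MeasurableSet B) :
    densityMeasure P h (A ×ˢ B) =
      ∫⁻ ω in A, ∫⁻ x in B, ENNReal.ofReal (h ω (x : ℝ)) ∂volume ∂P := by
  rw [densityMeasure_apply hm (hA.prod hB), ← lintegral_indicator hA]
  refine lintegral_congr fun ω => ?_
  by_cases hω : ω ∈ A
  · rw [indicator_of_mem hω, mk_preimage_prod_right hω]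
  · rw [indicator_of_notMem hω, mk_preimage_prod_right_eq_empty hω]
    simp

variable [IsProbabilityMeasure P] {α a : ℝ} {K : Set (ℝ → ℝ)}
  (hh : IsEquivariantDensity σ β Ω' (coneStar α a ∩ K) h)

omit hm [IsProbabilityMeasure P] in
include hh in
theorem fibreMass_univ {ω : Ω} (hω : ω ∈ Ω') :
    ∫⁻ x, ENNReal.ofReal (h ω ((x : unitInterval) : ℝ)) ∂volume = 1 := by
  have hc := (hh.mem ω hω).1
  have := setLIntegral_unitInterval hc.2.1 hc.2.2.1 MeasurableSet.univ
  have h1 := hh.integral_eq_one ω hω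
  rw [intervalIntegral.integral_of_le zero_le_one] at h1
  simpa [h1] using this

omit hm [IsProbabilityMeasure P] in
include hh in
/-- Equivariance of the density means that the fibre measures are mapped to each other. -/
theorem fibreMass_preimage (hΩ : σ ⁻¹' Ω' = Ω') {ω : Ω} (hω : ω ∈ Ω') {B : Set unitInterval}
    (hB : MeasurableSet B) :
    ∫⁻ x in map (β ω) (β ω).2.1.le ⁻¹' B, ENNReal.ofReal (h ω (x : ℝ)) ∂volume =
      ∫⁻ x in B, ENNReal.ofReal (h (σ ω) (x : ℝ)) ∂volume := by
  have hγ := (β ω).2.1.le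
  have hσω : σ ω ∈ Ω' := by rw [← hΩ] at hω; exact hω
  have hc := (hh.mem ω hω).1
  have hc' := (hh.mem _ hσω).1
  have hR := measurableSet_image_val hB
  have e1 := setLIntegral_unitInterval hc.2.1 hc.2.2.1 (measurable_mapReal (β ω) hR)
  have e2 := setLIntegral_unitInterval hc'.2.1 hc'.2.2.1 hR
  rw [preimage_val_image_val] at e2
  rw [map_preimage, e1, e2, ← setIntegral_transfer hγ hc.2.1 hR]
  congr 1
  exact setIntegral_congr_fun (hR.inter measurableSet_Ioc) fun x hx => hh.equivariant ω hω hx.2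

variable (hΩ : σ ⁻¹' Ω' = Ω') (hP : P Ω'ᶜ = 0)

include hh hP

theorem isProbabilityMeasure_densityMeasure : IsProbabilityMeasure (densityMeasure P h) := by
  refine ⟨?_⟩
  rw [densityMeasure_apply hm MeasurableSet.univ]
  have hae : ∀ᵐ ω ∂P, ω ∈ Ω' := hP
  rw [lintegral_congr_ae (g := fun _ => 1)]
  · simp
  · filter_upwards [hae] with ω hω
    rw [preimage_univ, Measure.restrict_univ, fibreMass_univ hh hω]

include hΩ

theorem measurePreserving_skewProduct (hσ : MeasurePreserving σ P P) (hβ : Measurable β) :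
    MeasurePreserving (skewProduct σ β) (densityMeasure P h) (densityMeasure P h) := by
  have hτ := measurable_skewProduct (σ := σ) hβ
  have hprob := isProbabilityMeasure_densityMeasure hm hh hP
  have : IsProbabilityMeasure ((densityMeasure P h).map (skewProduct σ β)) :=
    Measure.isProbabilityMeasure_map hτ.aemeasurable
  refine ⟨hτ, Measure.ext_prod fun {A B} hA hB => ?_⟩
  have hae : ∀ᵐ ω ∂P, ω ∈ Ω' := hP
  rw [Measure.map_apply hτ (hA.prod hB), densityMeasure_apply hm (hτ (hA.prod hB)),
    densityMeasure_prod hm hA hB, ← lintegral_indicator hA,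
    ← hσ.lintegral_comp ((measurable_fibreMass hm).indicator hA)]
  refine lintegral_congr_ae ?_
  filter_upwards [hae] with ω hω
  by_cases hA' : σ ω ∈ A
  · rw [indicator_of_mem hA', ← fibreMass_preimage hh hΩ hω hB]
    congr 2
    ext x
    simp [skewProduct, hA']
  · rw [indicator_of_notMem hA']
    have : Prod.mk ω ⁻¹' (skewProduct σ β ⁻¹' A ×ˢ B) = ∅ := by
      ext x
      simp [skewProduct, hA']
    rw [this]
    simp

end SkewProduct

/-! ### Ergodicity -/

section Fibres

variable {α a : ℝ} {Ω : Type*} {σ : Ω → Ω} {β : Ω → Ioo (0 : ℝ) 1}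

/-- If the sets `R n` are the fibres of an invariant set along an orbit, then the integral of a
function over `R 0` is preserved by the cocycle. -/
theorem setIntegral_cocycle {ω : Ω} {R : ℕ → Set ℝ} (hR : ∀ n, MeasurableSet (R n))
    (hinv : ∀ n, R n ∩ Ioc 0 1 = mapReal (β (σ^[n] ω)) ⁻¹' R (n + 1) ∩ Ioc 0 1) {φ : ℝ → ℝ}
    (hφ : IntegrableOn φ (Ioc 0 1)) (n : ℕ) :
    ∫ x in R n ∩ Ioc 0 1, cocycle σ β ω n φ x = ∫ x in R 0 ∩ Ioc 0 1, φ x := by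
  induction n with
  | zero => rfl
  | succ n ih =>
    rw [cocycle, setIntegral_transfer (β _).2.1.le (integrableOn_cocycle ω n hφ) (hR _), ← hinv, ih]

/-- By loss of memory, all normalized functions in the cone have the same integral over the fibres
of an invariant set. -/
theorem setIntegral_eq_of_invariant (hα1 : α < 1) (ha : 0 < a)
    (hK : ∀ γ : ℝ, 0 < γ → γ ≤ α → MapsTo (transfer γ) (coneStar α a) (coneStar α a))
    {ω : Ω} (hω : ∀ n, (β (σ^[n] ω) : ℝ) ≤ α) {R : ℕ → Set ℝ} (hR : ∀ n, MeasurableSet (R n))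
    (hinv : ∀ n, R n ∩ Ioc 0 1 = mapReal (β (σ^[n] ω)) ⁻¹' R (n + 1) ∩ Ioc 0 1)
    {φ ψ : ℝ → ℝ} (hφ : φ ∈ coneStar α a) (hψ : ψ ∈ coneStar α a)
    (hm : ∫ t in Ioc 0 1, φ t = 1) (hm' : ∫ t in Ioc 0 1, ψ t = 1) :
    ∫ x in R 0 ∩ Ioc 0 1, φ x = ∫ x in R 0 ∩ Ioc 0 1, ψ x := by
  refine eq_of_forall_dist_le fun ε hε => ?_
  obtain ⟨N, hN⟩ := exists_integral_abs_cocycle_sub_lt (σ := σ) (β := β) hα1 ha hK hε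
  have h := hN N le_rfl ω hω φ hφ ψ hψ hm hm'
  have i1 := integrableOn_cocycle (σ := σ) (β := β) ω N hφ.2.1
  have i2 := integrableOn_cocycle (σ := σ) (β := β) ω N hψ.2.1
  rw [← setIntegral_cocycle hR hinv hφ.2.1 N, ← setIntegral_cocycle hR hinv hψ.2.1 N, Real.dist_eq,
    ← integral_sub (i1.mono_set inter_subset_right) (i2.mono_set inter_subset_right)]
  refine (abs_integral_le_integral_abs).trans (le_trans ?_ h.le)
  exact setIntegral_le_of_subset (i1.sub i2).abs (fun _ _ => abs_nonneg _) inter_subset_right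

theorem const_mul_mem_coneStar {φ : ℝ → ℝ} (hφ : φ ∈ coneStar α a) {c : ℝ} (hc : 0 ≤ c) :
    (fun x => c * φ x) ∈ coneStar α a := by
  obtain ⟨h1, h2, h3, h4, h5, h6⟩ := hφ
  refine ⟨continuousOn_const.mul h1, h2.const_mul c, fun x hx => mul_nonneg hc (h3 x hx),
    fun x hx y hy hxy => mul_le_mul_of_nonneg_left (h4 hx hy hxy) hc, fun x hx y hy hxy => ?_,
    fun x hx => ?_⟩
  · have := mul_le_mul_of_nonneg_left (h5 hx hy hxy) hc
    simp only at this ⊢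
    linarith
  · have := mul_le_mul_of_nonneg_left (h6 x hx) hc
    simp only [intervalIntegral.integral_const_mul]
    linarith

/-- A Lipschitz function becomes an element of the cone when a steep affine function is added. -/
theorem add_affine_mem_coneStar (hα0 : 0 ≤ α) (ha : 2 ≤ a) {f : ℝ → ℝ} {K : ℝ}
    (hK : 0 ≤ K) (hf0 : ∀ x, 0 ≤ f x) (hfK : ∀ x, f x ≤ K)
    (hlip : ∀ x y, x ≤ y → |f y - f x| ≤ K * (y - x)) :
    (fun x => f x + K * (3 - x)) ∈ coneStar α a := by
  have hcont : Continuous f := by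
    have : LipschitzWith K.toNNReal f := LipschitzWith.of_dist_le_mul fun x y => by
      rw [Real.coe_toNNReal _ hK, Real.dist_eq, Real.dist_eq]
      rcases le_total x y with h | h
      · rw [abs_sub_comm, abs_sub_comm x y, abs_of_nonneg (sub_nonneg.2 h)]
        exact hlip x y h
      · rw [abs_of_nonneg (sub_nonneg.2 h)]
        exact hlip y x h
    exact this.continuous
  have hc : Continuous fun x => f x + K * (3 - x) := by fun_prop
  have hanti : Antitone fun x => f x + K * (3 - x) := fun x y hxy => by
    have := abs_le.1 (hlip x y hxy)
    simp only
    linarith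
  refine ⟨hc.continuousOn, hc.integrableOn_Ioc, fun x hx => ?_, hanti.antitoneOn _,
    fun x hx y hy hxy => ?_, fun x hx => ?_⟩
  · have := hf0 x
    have := hx.2
    have : 0 ≤ K * (3 - x) := mul_nonneg hK (by linarith)
    linarith
  · have hx0 := hx.1
    have hy0 := hy.1
    simp only [Real.rpow_add hx0, Real.rpow_add hy0, Real.rpow_one]
    have h1 : x ^ α ≤ y ^ α := by gcongr
    have h2 := abs_le.1 (hlip x y hxy)
    have h3 : x * (f x + K * (3 - x)) ≤ y * (f y + K * (3 - y)) := by
      have h4 := hf0 y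
      have h5 := hy.2
      have h6 := hx.2
      have h7 : 0 ≤ (y - x) * f y := mul_nonneg (by linarith) h4
      have h8 : x * (f x - f y) ≤ x * (K * (y - x)) := by
        gcongr; linarith
      have h9 : 0 ≤ K * (y - x) := mul_nonneg hK (by linarith)
      nlinarith
    have h4 : 0 ≤ x * (f x + K * (3 - x)) := by
      have := hf0 x
      have : 0 ≤ K * (3 - x) := mul_nonneg hK (by linarith [hx.2])
      positivity
    calc x ^ α * x * (f x + K * (3 - x)) = x ^ α * (x * (f x + K * (3 - x))) := by ring
      _ ≤ y ^ α * (y * (f y + K * (3 - y))) := by gcongr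
      _ = _ := by ring
  · have hx0 := hx.1
    have h1 : x ≤ x ^ (1 - α) := by
      have h : x ^ (1 : ℝ) ≤ x ^ (1 - α) :=
        Real.rpow_le_rpow_of_exponent_ge hx.1 hx.2 (by linarith)
      rwa [Real.rpow_one] at h
    have h2 : ∫ t in (0 : ℝ)..x, (f t + K * (3 - t)) ≤ 4 * K * x := by
      have h := intervalIntegral.integral_mono_on hx0.le (hc.intervalIntegrable 0 x)
        (intervalIntegrable_const : IntervalIntegrable (fun _ : ℝ => 4 * K) volume 0 x)
        fun t ht => by
          have := hfK t
          nlinarith [ht.1]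
      simpa [mul_comm, mul_left_comm, mul_assoc] using h
    have h3 : 2 * K ≤ ∫ t in (0 : ℝ)..1, (f t + K * (3 - t)) := by
      have h := intervalIntegral.integral_mono_on zero_le_one
        (intervalIntegrable_const : IntervalIntegrable (fun _ : ℝ => 2 * K) volume 0 1)
        (hc.intervalIntegrable 0 1) fun t ht => by
          have := hf0 t
          nlinarith [ht.2]
      simpa using h
    refine h2.trans ?_
    have h4 : 0 ≤ x ^ (1 - α) := by positivity
    calc 4 * K * x = 2 * x * (2 * K) := by ring
      _ ≤ a * x ^ (1 - α) * ∫ t in (0 : ℝ)..1, (f t + K * (3 - t)) := by gcongr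

/-- Bounded Lipschitz functions separate probability measures. -/
theorem eq_of_forall_lipschitz_integral_eq {E : Type*} [PseudoEMetricSpace E]
    [MeasurableSpace E] [BorelSpace E] {μ ν : Measure E}
    [hμ : IsProbabilityMeasure μ] [hν : IsProbabilityMeasure ν]
    (h : ∀ f : E → ℝ, (∃ C : ℝ, ∀ x y, dist (f x) (f y) ≤ C) → (∃ L, LipschitzWith L f) →
      ∫ x, f x ∂μ = ∫ x, f x ∂ν) : μ = ν := by
  have key : ∀ μ₁ μ₂ : ProbabilityMeasure E, (∀ f : E → ℝ,
      (∃ C : ℝ, ∀ x y, dist (f x) (f y) ≤ C) → (∃ L, LipschitzWith L f) →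
      ∫ x, f x ∂(μ₁ : Measure E) = ∫ x, f x ∂(μ₂ : Measure E)) → μ₁ = μ₂ := by
    intro μ₁ μ₂ h
    have ht : Tendsto (fun _ : ℕ => μ₁) atTop (𝓝 μ₂) := by
      rw [tendsto_iff_forall_lipschitz_integral_tendsto]
      intro f hf1 hf2
      rw [h f hf1 hf2]
      exact tendsto_const_nhds
    exact tendsto_nhds_unique tendsto_const_nhds ht
  exact congrArg Subtype.val (key ⟨μ, hμ⟩ ⟨ν, hν⟩ h)

/-- The fibres of an invariant set are null or conull: they do not distinguish between Lipschitz
densities, hence are independent of all sets. -/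
theorem volume_eq_zero_or_of_invariant (hα0 : 0 ≤ α) (hα1 : α < 1) (ha : 2 ≤ a)
    (hK : ∀ γ : ℝ, 0 < γ → γ ≤ α → MapsTo (transfer γ) (coneStar α a) (coneStar α a))
    {ω : Ω} (hω : ∀ n, (β (σ^[n] ω) : ℝ) ≤ α) {R : ℕ → Set ℝ} (hR : ∀ n, MeasurableSet (R n))
    (hinv : ∀ n, R n ∩ Ioc 0 1 = mapReal (β (σ^[n] ω)) ⁻¹' R (n + 1) ∩ Ioc 0 1) :
    volume (R 0 ∩ Ioc 0 1) = 0 ∨ volume (Ioc 0 1 \ R 0) = 0 := by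
  rcases eq_or_ne (volume (R 0 ∩ Ioc 0 1)) 0 with h0 | h0
  · exact Or.inl h0
  refine Or.inr ?_
  have hfin : volume (R 0 ∩ Ioc 0 1) ≠ ∞ :=
    ((measure_mono inter_subset_right).trans_lt (by simp : volume (Ioc (0 : ℝ) 1) < ∞)).ne
  set m := volume.real (R 0 ∩ Ioc 0 1) with hm
  have hm0 : 0 < m := ENNReal.toReal_pos h0 hfin
  -- all cone functions with positive mass have the same mean over `R 0`
  have hcone : ∀ φ ∈ coneStar α a, 0 < ∫ x in Ioc 0 1, φ x →
      ∫ x in R 0 ∩ Ioc 0 1, φ x = m * ∫ x in Ioc 0 1, φ x := by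
    intro φ hφ hpos
    have h := setIntegral_eq_of_invariant (a := a) hα1 (by linarith) hK hω hR hinv
      (const_mul_mem_coneStar hφ (inv_nonneg.2 hpos.le))
      (one_mem_coneStar (a := a) hα0 (by linarith))
      (by rw [integral_const_mul, inv_mul_cancel₀ hpos.ne']) (by simp)
    rw [integral_const_mul] at h
    have h1 : ∫ x in R 0 ∩ Ioc 0 1, (1 : ℝ) = m := by simp [hm]
    rw [h1] at h
    field_simp at h
    linarith
  have hlips : ∀ f : ℝ → ℝ, (∃ C : ℝ, ∀ x y, dist (f x) (f y) ≤ C) → (∃ L, LipschitzWith L f) →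
      ∫ x in R 0 ∩ Ioc 0 1, f x = m * ∫ x in Ioc 0 1, f x := by
    rintro f ⟨C, hC⟩ ⟨L, hL⟩
    have hC0 : 0 ≤ C := by simpa using hC 0 0
    set K : ℝ := L + 2 * C + 1 with hKdef
    have hL0 : (0 : ℝ) ≤ L := L.2
    have hK0 : 0 < K := by positivity
    -- `f` is a difference of two elements of the cone, up to a constant
    have hb : ∀ x, |f x - f 0| ≤ C := fun x => hC x 0
    have hmem1 : (fun x => (f x - f 0 + C) + K * (3 - x)) ∈ coneStar α a := by
      refine add_affine_mem_coneStar hα0 ha hK0.le (fun x => ?_) (fun x => ?_) fun x y hxy => ?_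
      · linarith [(abs_le.1 (hb x)).1]
      · linarith [(abs_le.1 (hb x)).2]
      · have h := hL.dist_le_mul y x
        rw [Real.dist_eq, Real.dist_eq, abs_of_nonneg (sub_nonneg.2 hxy)] at h
        have e : f y - f 0 + C - (f x - f 0 + C) = f y - f x := by ring
        rw [e]
        refine h.trans ?_
        gcongr
        linarith
    have hmem2 : (fun x => (0 : ℝ) + K * (3 - x)) ∈ coneStar α a :=
      add_affine_mem_coneStar hα0 ha hK0.le (fun x => le_rfl) (fun x => hK0.le)
        fun x y hxy => by simpa using mul_nonneg hK0.le (sub_nonneg.2 hxy)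
    have hpos2 : 0 < ∫ x in Ioc 0 1, ((0 : ℝ) + K * (3 - x)) := by
      have h := setIntegral_mono_on (f := fun _ => K) (μ := volume) (s := Ioc 0 1) (by simp)
        hmem2.2.1 measurableSet_Ioc fun x hx => by nlinarith [hx.2]
      simp only [integral_const, smul_eq_mul, measureReal_restrict_apply_univ] at h
      rw [Real.volume_real_Ioc_of_le zero_le_one] at h
      linarith
    have hpos1 : 0 < ∫ x in Ioc 0 1, ((f x - f 0 + C) + K * (3 - x)) :=
      hpos2.trans_le (setIntegral_mono_on hmem2.2.1 hmem1.2.1 measurableSet_Ioc fun x _ => by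
        linarith [(abs_le.1 (hb x)).1])
    have e1 := hcone _ hmem1 hpos1
    have e2 := hcone _ hmem2 hpos2
    have hsplit : ∀ s ⊆ Ioc (0 : ℝ) 1, ∫ x in s, f x =
        (∫ x in s, ((f x - f 0 + C) + K * (3 - x))) - (∫ x in s, ((0 : ℝ) + K * (3 - x)))
          + ∫ _ in s, (f 0 - C) := by
      intro s hs
      have hfs : volume s ≠ ∞ :=
        ((measure_mono hs).trans_lt (by simp : volume (Ioc (0 : ℝ) 1) < ∞)).ne
      have hci : IntegrableOn (fun _ : ℝ => f 0 - C) s := integrableOn_const hfs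
      have i1 := hmem1.2.1.mono_set hs
      have i2 := hmem2.2.1.mono_set hs
      have i3 : IntegrableOn (fun x => (f x - f 0 + C + K * (3 - x)) - (0 + K * (3 - x))) s :=
        i1.sub i2
      rw [← integral_sub i1 i2, ← integral_add i3 hci]
      refine integral_congr_ae (Eventually.of_forall fun x => ?_)
      simp only
      ring
    rw [hsplit _ inter_subset_right, hsplit _ subset_rfl, e1, e2]
    simp only [integral_const, smul_eq_mul, measureReal_restrict_apply_univ]
    rw [Real.volume_real_Ioc_of_le zero_le_one, ← hm]
    ring
  -- hence the conditional measure on `R 0` agrees with Lebesgue measure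
  have hp1 : IsProbabilityMeasure (volume.restrict (Ioc (0 : ℝ) 1)) := ⟨by simp⟩
  set ν : Measure ℝ := (volume (R 0 ∩ Ioc 0 1))⁻¹ • volume.restrict (R 0 ∩ Ioc 0 1) with hν
  have hp2 : IsProbabilityMeasure ν := ⟨by
    rw [hν, Measure.smul_apply, Measure.restrict_apply_univ, smul_eq_mul,
      ENNReal.inv_mul_cancel h0 hfin]⟩
  have heq : ν = volume.restrict (Ioc (0 : ℝ) 1) := by
    refine eq_of_forall_lipschitz_integral_eq fun f hf1 hf2 => ?_
    rw [hν, integral_smul_measure, hlips f hf1 hf2, ENNReal.toReal_inv, smul_eq_mul]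
    change m⁻¹ * (m * _) = _
    rw [inv_mul_cancel_left₀ hm0.ne']
  have hz : ν (R 0)ᶜ = 0 := by
    rw [hν, Measure.smul_apply, Measure.restrict_apply (hR 0).compl]
    have : (R 0)ᶜ ∩ (R 0 ∩ Ioc 0 1) = ∅ := by
      rw [← inter_assoc, compl_inter_self, empty_inter]
    rw [this]; simp
  rw [heq, Measure.restrict_apply (hR 0).compl, inter_comm] at hz
  rwa [Set.sdiff_eq]

/-- The maps are nonsingular: preimages of null sets are null. -/
theorem volume_preimage_mapReal {γ : ℝ} (hγ : 0 ≤ γ) {R : Set ℝ} (hR : MeasurableSet R)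
    (h : volume (R ∩ Ioc 0 1) = 0) : volume (mapReal γ ⁻¹' R ∩ Ioc 0 1) = 0 := by
  have h1 := setIntegral_transfer hγ (φ := fun _ => 1) (integrable_const _) hR
  rw [setIntegral_measure_zero _ h] at h1
  have hfin : volume (mapReal γ ⁻¹' R ∩ Ioc 0 1) ≠ ∞ :=
    ((measure_mono inter_subset_right).trans_lt (by simp : volume (Ioc (0 : ℝ) 1) < ∞)).ne
  simp only [integral_const, smul_eq_mul, measureReal_restrict_apply_univ, mul_one] at h1
  exact (measureReal_eq_zero_iff hfin).1 h1.symm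

theorem volume_unitInterval (B : Set unitInterval) :
    volume B = volume ((Subtype.val '' B : Set ℝ) ∩ Ioc 0 1) := by
  rw [unitInterval.volume_apply]
  have hsub : (Subtype.val '' B : Set ℝ) ⊆ Icc 0 1 := by
    rintro _ ⟨x, -, rfl⟩; exact x.2
  conv_lhs => rw [← inter_eq_left.2 hsub]
  exact measure_congr ((ae_eq_refl _).inter Ioc_ae_eq_Icc.symm)

end Fibres

section Ergodicity

variable {Ω : Type*} [MeasurableSpace Ω] {σ : Ω ≃ᵐ Ω} {β : Ω → Ioo (0 : ℝ) 1} {Ω' : Set Ω}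
  {P : Measure Ω} [IsProbabilityMeasure P] {α a : ℝ}

/-- The skew product has no invariant sets except null sets and their complements. -/
theorem prod_eq_zero_or_of_invariant (hα0 : 0 ≤ α) (hα1 : α < 1) (ha : 2 ≤ a)
    (hK : ∀ γ : ℝ, 0 < γ → γ ≤ α → MapsTo (transfer γ) (coneStar α a) (coneStar α a))
    (hσ : Ergodic σ P) (hΩ : σ ⁻¹' Ω' = Ω') (hP : P Ω'ᶜ = 0)
    (hβα : ∀ ω ∈ Ω', (β ω : ℝ) ≤ α) {E : Set (Ω × unitInterval)} (hE : MeasurableSet E)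
    (hinv : skewProduct σ β ⁻¹' E = E) :
    P.prod (volume : Measure unitInterval) E = 0 ∨
      P.prod (volume : Measure unitInterval) Eᶜ = 0 := by
  have hae : ∀ᵐ ω ∂P, ω ∈ Ω' := hP
  set R : Ω → Set ℝ := fun ω => Subtype.val '' (Prod.mk ω ⁻¹' E) with hRdef
  have hRm : ∀ ω, MeasurableSet (R ω) := fun ω =>
    measurableSet_image_val (measurable_prodMk_left hE)
  have hRinv : ∀ ω, R ω ∩ Ioc 0 1 = mapReal (β ω) ⁻¹' R (σ ω) ∩ Ioc 0 1 := by
    intro ω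
    have h1 : (Prod.mk ω ⁻¹' E : Set unitInterval) =
        map (β ω) (β ω).2.1.le ⁻¹' (Prod.mk (σ ω) ⁻¹' E) := by
      conv_lhs => rw [← hinv]
      rfl
    rw [map_preimage] at h1
    have hI : Ioc (0 : ℝ) 1 ⊆ range (Subtype.val : unitInterval → ℝ) := by
      rw [Subtype.range_coe]; exact Ioc_subset_Icc_self
    simp only [hRdef]
    conv_lhs => rw [h1]
    rw [image_preimage_eq_inter_range, inter_assoc, inter_eq_right.2 hI]
  have hzero : ∀ ω, volume (Prod.mk ω ⁻¹' E) = volume (R ω ∩ Ioc 0 1) := fun ω =>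
    volume_unitInterval _
  have hdich : ∀ ω ∈ Ω', volume (Prod.mk ω ⁻¹' E) = 0 ∨ volume (Prod.mk ω ⁻¹' Eᶜ) = 0 := by
    intro ω hω
    rcases volume_eq_zero_or_of_invariant (σ := σ) (β := β) (ω := ω) hα0 hα1 ha hK
      (fun n => hβα _ (iterate_mem hΩ n hω)) (R := fun n => R (σ^[n] ω)) (fun n => hRm _)
      (fun n => by rw [Function.iterate_succ_apply']; exact hRinv _) with h | h
    · exact Or.inl ((hzero ω).trans h)
    · refine Or.inr ?_
      rw [volume_unitInterval]
      refine measure_mono_null ?_ h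
      rintro _ ⟨⟨x, hx, rfl⟩, hx'⟩
      refine ⟨hx', ?_⟩
      rintro ⟨y, hy, hxy⟩
      rw [Subtype.val_injective hxy] at hy
      exact hx hy
  -- the base points with null fibres form a backward invariant set
  set Z : Set Ω := {ω | volume (Prod.mk ω ⁻¹' E) = 0} with hZ
  have hZm : MeasurableSet Z := measurable_measure_prodMk_left hE (measurableSet_singleton 0)
  have hZinv : σ ⁻¹' Z ⊆ Z := by
    intro ω hω
    have h1 : volume (Prod.mk (σ ω) ⁻¹' E) = 0 := hω
    rw [hzero] at h1
    have h2 := volume_preimage_mapReal (β ω).2.1.le (hRm _) h1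
    rw [← hRinv, ← hzero] at h2
    exact h2
  rcases hσ.ae_empty_or_univ_of_preimage_ae_le hZm.nullMeasurableSet hZinv.eventuallyLE with h | h
  · right
    rw [Measure.measure_prod_null hE.compl]
    filter_upwards [hae, h] with ω hω hωZ
    have : ω ∉ Z := fun hω' => (hωZ.mp hω' : ω ∈ (∅ : Set Ω))
    exact (hdich ω hω).resolve_left this
  · left
    rw [Measure.measure_prod_null hE]
    filter_upwards [h] with ω hωZ
    exact (hωZ.mpr trivial : ω ∈ Z)

end Ergodicity

/-! ### Properties of the invariant measure -/

section InvariantMeasure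

variable {Ω : Type*} [MeasurableSpace Ω] {σ : Ω ≃ᵐ Ω} {β : Ω → Ioo (0 : ℝ) 1} {Ω' : Set Ω}
  {P : Measure Ω} {α a b₁ b₂ b₃ : ℝ}

/-- A normalized function in the cone is positive: if it vanished somewhere, it would vanish at `1`,
being decreasing, and then everywhere, as `x ^ (α + 1) φ x` is increasing. -/
theorem pos_of_mem_coneStar {φ : ℝ → ℝ} (hφ : φ ∈ coneStar α a)
    (hm : ∫ t in Ioc 0 1, φ t = 1) {x : ℝ} (hx : x ∈ Ioc (0 : ℝ) 1) : 0 < φ x := by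
  obtain ⟨-, -, h0, h4, h5, -⟩ := hφ
  have h1 : (1 : ℝ) ∈ Ioc (0 : ℝ) 1 := right_mem_Ioc.2 one_pos
  refine lt_of_lt_of_le ?_ (h4 hx h1 hx.2)
  by_contra hneg
  have hone : φ 1 = 0 := le_antisymm (not_lt.1 hneg) (h0 1 h1)
  have hz : ∀ t ∈ Ioc (0 : ℝ) 1, φ t = 0 := by
    intro t ht
    have h := h5 ht h1 ht.2
    simp only [hone, mul_zero] at h
    have hp : 0 < t ^ (α + 1) := Real.rpow_pos_of_pos ht.1 _
    nlinarith [h0 t ht]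
  rw [setIntegral_congr_fun measurableSet_Ioc hz] at hm
  simp at hm

theorem limitDensity_pos (D : ConeData α a b₁ b₂ b₃) (hΩ : σ ⁻¹' Ω' = Ω')
    (hβα : ∀ ω ∈ Ω', (β ω : ℝ) ≤ α) (ω : Ω) (x : ℝ) : 0 < limitDensity σ β Ω' ω x := by
  by_cases h : ω ∈ Ω' ∧ x ∈ Ioc (0 : ℝ) 1
  · exact pos_of_mem_coneStar (limitDensity_mem D hΩ hβα h.1).1
      (integral_limitDensity D hΩ hβα h.1) h.2
  · rw [limitDensity, if_neg h]
    exact one_pos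

theorem tendsto_eLpNorm_pastDensity_sub (D : ConeData α a b₁ b₂ b₃) (hΩ : σ ⁻¹' Ω' = Ω')
    (hβα : ∀ ω ∈ Ω', (β ω : ℝ) ≤ α) {ω : Ω} (hω : ω ∈ Ω') :
    Tendsto (fun n => eLpNorm (fun x => pastDensity σ β n ω x - limitDensity σ β Ω' ω x) 1
      (volume.restrict (Ioc (0 : ℝ) 1))) atTop (𝓝 0) := by
  have h := ENNReal.tendsto_ofReal (tendsto_integral_abs_pastDensity_sub D hΩ hβα hω)
  rw [ENNReal.ofReal_zero] at h
  refine h.congr fun n => ?_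
  have hi : Integrable (fun x => pastDensity σ β n ω x - limitDensity σ β Ω' ω x)
      (volume.restrict (Ioc 0 1)) :=
    (pastDensity_mem_coneStar D hΩ hβα n hω).2.1.sub (limitDensity_mem D hΩ hβα hω).1.2.1
  rw [eLpNorm_one_eq_lintegral_enorm, ← ofReal_integral_norm_eq_lintegral_enorm hi]
  simp only [Real.norm_eq_abs]

theorem densityMeasure_absolutelyContinuous (h : Ω → ℝ → ℝ) :
    densityMeasure P h ≪ P.prod (volume : Measure unitInterval) :=
  withDensity_absolutelyContinuous _ _

theorem absolutelyContinuous_densityMeasure {h : Ω → ℝ → ℝ}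
    (hm : Measurable (Function.uncurry h)) (hpos : ∀ ω x, 0 < h ω x) :
    P.prod (volume : Measure unitInterval) ≪ densityMeasure P h :=
  withDensity_absolutelyContinuous' (measurable_ofReal_density hm).aemeasurable
    (Eventually.of_forall fun _ => (ENNReal.ofReal_pos.2 (hpos _ _)).ne')

theorem densityMeasure_prod_inter {h : Ω → ℝ → ℝ} (hm : Measurable (Function.uncurry h))
    (hP : P Ω'ᶜ = 0) {A : Set Ω} {B : Set unitInterval} (hA : MeasurableSet A)
    (hB : MeasurableSet B) :
    densityMeasure P h (A ×ˢ B) =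
      ∫⁻ ω in A ∩ Ω', ∫⁻ x in B, ENNReal.ofReal (h ω (x : ℝ)) ∂volume ∂P := by
  rw [densityMeasure_prod hm hA hB]
  have hae : (Ω' : Set Ω) =ᵐ[P] univ := eventuallyEq_univ.2 hP
  have : (A ∩ Ω' : Set Ω) =ᵐ[P] A := by
    simpa using (ae_eq_refl A).inter hae
  rw [Measure.restrict_congr_set this]

theorem ergodic_densityMeasure [IsProbabilityMeasure P] (hα0 : 0 ≤ α) (hα1 : α < 1) (ha : 2 ≤ a)
    (hK : ∀ γ : ℝ, 0 < γ → γ ≤ α → MapsTo (transfer γ) (coneStar α a) (coneStar α a))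
    (hσ : Ergodic σ P) (hβ : Measurable β) (hΩ : σ ⁻¹' Ω' = Ω') (hP : P Ω'ᶜ = 0)
    (hβα : ∀ ω ∈ Ω', (β ω : ℝ) ≤ α) {K : Set (ℝ → ℝ)} {h : Ω → ℝ → ℝ}
    (hm : Measurable (Function.uncurry h))
    (hh : IsEquivariantDensity σ β Ω' (coneStar α a ∩ K) h) :
    Ergodic (skewProduct σ β) (densityMeasure P h) where
  toMeasurePreserving := measurePreserving_skewProduct hm hh hΩ hP hσ.toMeasurePreserving hβ
  aeconst_set E hE hinv := by
    rw [eventuallyConst_set']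
    have hac := densityMeasure_absolutelyContinuous (P := P) h
    rcases prod_eq_zero_or_of_invariant hα0 hα1 ha hK hσ hΩ hP hβα hE hinv with h0 | h0
    · exact Or.inl (ae_eq_empty.2 (hac h0))
    · exact Or.inr (eventuallyEq_univ.2 (hac h0))

end InvariantMeasure

end LSV

theorem proposition2p6 (α : ℝ) (hα0 : 0 < α) (hα1 : α < 1) :
    -- the parameters of the cones depend on `α` only
    ∃ a b₁ b₂ b₃ : ℝ, 1 < a ∧ 0 < b₁ ∧ 0 < b₂ ∧ 0 < b₃ ∧
      (∀ γ : ℝ, 0 < γ → γ ≤ α →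
        MapsTo (LSV.transfer γ) (LSV.coneStar α a) (LSV.coneStar α a) ∧
        MapsTo (LSV.transfer γ) (LSV.coneTwo b₁ b₂) (LSV.coneTwo b₁ b₂) ∧
        MapsTo (LSV.transfer γ) (LSV.coneThree b₁ b₂ b₃) (LSV.coneThree b₁ b₂ b₃)) ∧
      ∀ (Ω : Type*) [MeasurableSpace Ω] (P : Measure Ω) [IsProbabilityMeasure P]
        (σ : Ω ≃ᵐ Ω) (_ : Ergodic σ P)
        (β : Ω → Ioo (0 : ℝ) 1) (_ : Measurable β) (_ : essSup (fun ω => (β ω : ℝ)) P = α)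
        (Ω' : Set Ω) (_ : MeasurableSet Ω') (_ : σ ⁻¹' Ω' = Ω') (_ : P Ω'ᶜ = 0)
        (_ : ∀ ω ∈ Ω', (β ω : ℝ) ≤ α),
        ∃ h : Ω → ℝ → ℝ,
          -- existence and uniqueness of the equivariant density
          LSV.IsEquivariantDensity σ β Ω' (LSV.coneStar α a ∩ LSV.coneTwo b₁ b₂) h ∧
          (∀ k : Ω → ℝ → ℝ,
            LSV.IsEquivariantDensity σ β Ω' (LSV.coneStar α a ∩ LSV.coneTwo b₁ b₂) k →
              ∀ ω ∈ Ω', EqOn (k ω) (h ω) (Ioc 0 1)) ∧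
          -- it is the limit in `L¹(m)` of the densities pushed forward from the past
          (∀ ω ∈ Ω', Tendsto
            (fun n : ℕ => eLpNorm
              (fun x => LSV.cocycle σ β (σ.symm^[n] ω) n (fun _ => 1) x - h ω x) 1
              (volume.restrict (Ioc (0 : ℝ) 1))) atTop (𝓝 0)) ∧
          -- the measure that it induces
          ∃ μ : Measure (Ω × unitInterval), IsProbabilityMeasure μ ∧
            (∀ (A : Set Ω) (B : Set unitInterval), MeasurableSet A → MeasurableSet B →
              μ (A ×ˢ B) =
                ∫⁻ ω in A ∩ Ω', ∫⁻ x in B, ENNReal.ofReal (h ω (x : ℝ)) ∂volume ∂P) ∧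
            Ergodic (LSV.skewProduct σ β) μ ∧
            μ ≪ P.prod (volume : Measure unitInterval) ∧
            P.prod (volume : Measure unitInterval) ≪ μ ∧
            ∀ ν : Measure (Ω × unitInterval), IsProbabilityMeasure ν →
              MeasurePreserving (LSV.skewProduct σ β) ν ν →
              ν ≪ P.prod (volume : Measure unitInterval) → ν = μ := by
  have hstar : ∀ γ : ℝ, 0 < γ → γ ≤ α →
      MapsTo (LSV.transfer γ) (LSV.coneStar α (2 / (1 - α))) (LSV.coneStar α (2 / (1 - α))) :=
    fun γ hγ hγα => LSV.mapsTo_coneStar hγ.le hγα hα1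
  have hthree : ∀ γ : ℝ, 0 < γ → γ ≤ α →
      MapsTo (LSV.transfer γ) (LSV.coneThree 2 30 1000) (LSV.coneThree 2 30 1000) :=
    fun γ hγ hγα => LSV.mapsTo_coneThree hγ.le (hγα.trans hα1.le)
  have ha : 2 ≤ 2 / (1 - α) := by
    rw [le_div_iff₀ (by linarith)]
    linarith
  refine ⟨2 / (1 - α), 2, 30, 1000, by linarith, by norm_num, by norm_num, by norm_num,
    fun γ hγ hγα => ⟨hstar γ hγ hγα, LSV.mapsTo_coneTwo hγ.le (hγα.trans hα1.le),
      hthree γ hγ hγα⟩, ?_⟩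
  intro Ω _ P _ σ hσ β hβ _ Ω' hΩm hΩ hP hβα
  have D : LSV.ConeData α (2 / (1 - α)) 2 30 1000 :=
    ⟨hα0, hα1, by linarith, by norm_num, by norm_num, by norm_num, hstar, hthree⟩
  have hm := LSV.measurable_limitDensity D hΩ hβα hβ hΩm
  have hh := LSV.isEquivariantDensity_limitDensity D hΩ hβα hβ hΩm
  have hprob := LSV.isProbabilityMeasure_densityMeasure hm hh hP
  have herg := LSV.ergodic_densityMeasure hα0.le hα1 ha hstar hσ hβ hΩ hP hβα hm hh
  have hac := LSV.absolutelyContinuous_densityMeasure (P := P) hm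
    (LSV.limitDensity_pos D hΩ hβα)
  -- an invariant `ν ≪ P × m` is absolutely continuous with respect to the ergodic measure, hence
  -- equal to it
  exact ⟨LSV.limitDensity σ β Ω', hh,
    fun k hk ω hω => LSV.eqOn_of_isEquivariantDensity D hΩ hβα hk hh hω,
    fun ω hω => LSV.tendsto_eLpNorm_pastDensity_sub D hΩ hβα hω,
    LSV.densityMeasure P (LSV.limitDensity σ β Ω'), hprob,
    fun A B hA hB => LSV.densityMeasure_prod_inter hm hP hA hB, herg,
    LSV.densityMeasure_absolutelyContinuous _, hac,
    fun ν _ hν hνac => herg.eq_of_absolutelyContinuous hν (hνac.trans hac)⟩
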